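/- **Notation.** For $f$ on $\mathbb R^3$ let $\widehat f(\xi)=\mathcal F f(\xi)=\int_{\mathbb R^3}e^{-ix\cdot\xi}f(x)\,dx$, extended to tempered distributions, with inverse $\mathcal F^{-1}g(x)=(2\pi)^{-3}\int e^{ix\cdot\xi}g(\xi)\,d\xi$. Fix an even smooth function $\tilde\psi:\mathbb R\to[0,1]$ supported in $[-3/2,3/2]$ with $\tilde\psi=1$ on $[-5/4,5/4]$, and for $k\in\mathbb Z$, $\xi\in\mathbb R^3$ put $\psi_k(\xi)=\tilde\psi(|\xi|/2^k)-\tilde\psi(|\xi|/2^{k-1})$. For a symbol $m:\mathbb R^3\to\mathbb C$ that is ten times continuously differentiable away from $0$ put $$\|m\|_{\mathcal S^\infty}=\sup_{k\in\mathbb Z}\ \sum_{|\alpha|\le 10}2^{|\alpha|k}\,\big\|\mathcal F^{-1}\big[(\nabla_\xi^\alpha m)\,\psi_k\big]\big\|_{L^1(\mathbb R^3)},$$ and write $m\in\mathcal S^\infty$ if this is finite. The Fourier multiplier operator with symbol $m$ is $T(u)=\mathcal F^{-1}(m\,\widehat u)$. The classical vector fields on $\mathbb R_t\times\mathbb R^3_x$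 are the ten fields $S=t\partial_t+x\cdot\nabla_x$, $\partial_{x_i}$, $\Omega_i=(e_i\times x)\cdot\nabla_x$, $L_i=t\partial_{x_i}+x_i\partial_t$ $(i=1,2,3)$. For a word $\alpha=(\alpha_1,\dots,\alpha_l)$ in these fields let $|\alpha|=l$, $\Gamma^\alpha=\Gamma^{\alpha_1}\cdots\Gamma^{\alpha_l}$ and $\phi^\alpha=\Gamma^\alpha\phi$. Let $J\subset\mathbb R$ be open and let $\phi(t,x)$ be a real-valued function of class $C^{21}$ on $J\times\mathbb R^3$ such that, for $|\alpha|\le20$ and $t\in J$, the functions $\phi^\alpha(t,\cdot)$ and $\partial_t\phi^\alpha(t,\cdot)$ are tempered and their Fourier transforms are functions. Let $u^\alpha=(\partial_t-i|\nabla|)\phi^\alpha$ be the half waves and $h^\alpha(t)=e^{it|\nabla|}u^\alpha(t)$ the profiles. For $n\in\{0,1,2,3\}$ put $$\|h\|_{X_n}=\sup_{k\in\mathbb Z}2^{(n+1)k}\,\|\nabla_\xi^n\widehat h(\xi)\,\psi_k(\xi)\|_{L^\infty_\xi},$$ $$E^\phi_{\rm low}(t)=\sum_{n=0}^{3}\ \sum_{|\alpha|\le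 20-3n}\Big(\|h^\alpha(t)\|_{X_n}+(1+|t|)\,\|\partial_th^\alpha(t)\|_{X_n}+(1+|t|)^2\,\big\|\partial_t\nabla_x(1+|\nabla_x|)^{-1}h^\alpha(t)\big\|_{X_n}\Big)\in[0,\infty],$$ where derivatives of $\widehat h$ in $\xi$ and in $t$ are taken in the sense of distributions on $\mathbb R^3\setminus\{0\}$, and a norm is $\infty$ if the derivative in it does not exist as a function. **Lemma.** There is a constant $C$, depending only on $\tilde\psi$, such that for every Fourier multiplier operator $T$ with symbol $m\in\mathcal S^\infty$, every $J$ and $\phi$ as above, all $t\in J$ and all $x\in\mathbb R^3$, $$\sum_{|\rho|\le13}\Big(|T(\partial_t\phi^\rho)(t,x)|+\sum_{j=1}^3|T(\partial_{x_j}\phi^\rho)(t,x)|\Big)\le C\,(1+|t|)^{-1}\big(1+\big||t|-|x|\big|\big)^{-1}\,\|m\|_{\mathcal S^\infty}\,E^\phi_{\rm low}(t).$$ Moreover, if $E^\phi_{\rm low}(t)<\infty$, then the functions $m\,\widehat u$ with $u=\partial_t\phi^\rho(t,\cdot)$ or $u=\partial_{x_j}\phi^\rho(t,\cdot)$, $|\rho|\le13$,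 are integrable, so that the left-hand side is given by absolutely convergent integrals. -/

import Mathlib

open MeasureTheory Filter Topology
open scoped ENNReal NNReal ContDiff SchwartzMap

noncomputable section

namespace WaveDecay

/-- Physical space and frequency space `ℝ³`, with the Euclidean norm. -/
abbrev E3 : Type := EuclideanSpace ℝ (Fin 3)

/-- The coordinate vector `e_j`. -/
def e (j : Fin 3) : E3 := EuclideanSpace.single j (1 : ℝ)

/-! ### Dyadic cutoffs -/

/-- An even smooth function `ℝ → [0,1]`, supported in `[-3/2, 3/2]`, equal to `1` on
`[-5/4, 5/4]`. -/
structure IsCutoff (ψ : ℝ → ℝ) : Prop where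
  smooth : ContDiff ℝ ∞ ψ
  even : ∀ r, ψ (-r) = ψ r
  mem_Icc : ∀ r, ψ r ∈ Set.Icc (0 : ℝ) 1
  support : Function.support ψ ⊆ Set.Icc (-(3 / 2)) (3 / 2)
  eq_one : ∀ r ∈ Set.Icc (-(5 / 4) : ℝ) (5 / 4), ψ r = 1

/-- `ψ_k(ξ) = ψ(|ξ|/2^k) - ψ(|ξ|/2^(k-1))`. -/
def dyadic (ψ : ℝ → ℝ) (k : ℤ) (ξ : E3) : ℝ :=
  ψ (‖ξ‖ / (2 : ℝ) ^ k) - ψ (‖ξ‖ / (2 : ℝ) ^ (k - 1))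

/-! ### Fourier transform, with the normalization `∫ e^{-i x·ξ} f(x) dx` -/

/-- The Fourier integral `∫ e^{-i x·ξ} f(x) dx` (used for Schwartz functions). -/
def fourierInt (f : E3 → ℂ) (ξ : E3) : ℂ :=
  ∫ x, Complex.exp (-(Complex.I * (inner ℝ x ξ : ℝ))) * f x

/-- The inverse Fourier integral `(2π)^{-3} ∫ e^{i x·ξ} g(ξ) dξ`. -/
def fourierInvInt (g : E3 → ℂ) (x : E3) : ℂ :=
  (((2 * Real.pi) ^ 3 : ℝ) : ℂ)⁻¹ * ∫ ξ, Complex.exp (Complex.I * (inner ℝ x ξ : ℝ)) * g ξ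

/-- `f` is a tempered function and the function `g` is its Fourier transform in the sense of
tempered distributions: `⟨f, 𝓕χ⟩ = ⟨g, χ⟩` for all Schwartz functions `χ`. -/
structure IsFourierTransform (f g : E3 → ℂ) : Prop where
  integrable_left : ∀ χ : 𝓢(E3, ℂ), Integrable (fun x => f x * χ x)
  integrable_right : ∀ χ : 𝓢(E3, ℂ), Integrable (fun ξ => g ξ * χ ξ)
  pairing : ∀ χ : 𝓢(E3, ℂ), ∫ x, f x * fourierInt χ x = ∫ ξ, g ξ * χ ξ

/-- The tempered distribution `f` has a Fourier transform which is a function. -/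
def HasFourierTransform (f : E3 → ℂ) : Prop := ∃ g, IsFourierTransform f g

open Classical in
/-- The (almost everywhere unique) function which is the Fourier transform of `f`. -/
def fourierFun (f : E3 → ℂ) : E3 → ℂ :=
  if h : HasFourierTransform f then h.choose else 0

/-- The Fourier multiplier operator with symbol `m`, applied to `u` and evaluated at `x`. -/
def multiplier (m : E3 → ℂ) (u : E3 → ℂ) (x : E3) : ℂ :=
  fourierInvInt (fun ξ => m ξ * fourierFun u ξ) x

/-! ### The symbol class `S^∞` -/

/-- `∂_{w 0} ⋯ ∂_{w (n-1)} F`. -/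
def partials {n : ℕ} (w : Fin n → Fin 3) (F : E3 → ℂ) (ξ : E3) : ℂ :=
  iteratedFDeriv ℝ n F ξ (fun i => e (w i))

/-- `‖m‖_{S^∞_k} = ∑_{|α| ≤ 10} 2^{|α| k} ‖𝓕⁻¹[(∇^α m) ψ_k]‖_{L¹}`. -/
def symbolNormAt (ψ : ℝ → ℝ) (k : ℤ) (m : E3 → ℂ) : ℝ≥0∞ :=
  ∑ n ∈ Finset.range 11, ∑ w : Fin n → Fin 3,
    ENNReal.ofReal ((2 : ℝ) ^ ((n : ℤ) * k)) *
      ∫⁻ x, ‖fourierInvInt (fun ξ => partials w m ξ * (dyadic ψ k ξ : ℂ)) x‖ₑ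

/-- `‖m‖_{S^∞} = sup_k ‖m‖_{S^∞_k}`. -/
def symbolNorm (ψ : ℝ → ℝ) (m : E3 → ℂ) : ℝ≥0∞ := ⨆ k : ℤ, symbolNormAt ψ k m

/-- `m ∈ S^∞`. Finiteness of the norm forces the derivatives up to order ten to be continuous
away from the origin, so that they can be taken in the classical sense. -/
def IsSymbol (ψ : ℝ → ℝ) (m : E3 → ℂ) : Prop :=
  ContDiffOn ℝ 10 m {0}ᶜ ∧ symbolNorm ψ m < ⊤

/-! ### The classical vector fields -/

/-- `∂_t φ`. -/
def dt (φ : ℝ → E3 → ℝ) : ℝ → E3 → ℝ := fun t x => deriv (fun s => φ s x) t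

/-- `∂_{x_j} φ`. -/
def dx (j : Fin 3) (φ : ℝ → E3 → ℝ) : ℝ → E3 → ℝ := fun t x => fderiv ℝ (φ t) x (e j)

/-- The ten classical vector fields: scaling `S`, translations `∂_{x_i}`, rotations `Ω_i`
and Lorentz boosts `L_i`, labelled by `Unit ⊕ Fin 3 ⊕ Fin 3 ⊕ Fin 3`. -/
abbrev VF : Type := Unit ⊕ Fin 3 ⊕ Fin 3 ⊕ Fin 3

/-- The action of the vector fields: `S = t ∂_t + x·∇`, `∂_{x_i}`, `Ω_i = (e_i × x)·∇`,
`L_i = t ∂_{x_i} + x_i ∂_t`. Indices in `Fin 3` are cyclic. -/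
def applyVF (φ : ℝ → E3 → ℝ) : VF → ℝ → E3 → ℝ
  | .inl _ => fun t x => t * dt φ t x + ∑ j, x j * dx j φ t x
  | .inr (.inl i) => dx i φ
  | .inr (.inr (.inl i)) =>
      fun t x => x (i + 1) * dx (i + 2) φ t x - x (i + 2) * dx (i + 1) φ t x
  | .inr (.inr (.inr i)) => fun t x => t * dx i φ t x + x i * dt φ t x

/-- `φ^α = Γ^α φ = Γ^{α 0} (Γ^{α 1} (⋯ (Γ^{α (l-1)} φ)))` for a word `α` of length `l`. -/
def gam {l : ℕ} (α : Fin l → VF) (φ : ℝ → E3 → ℝ) : ℝ → E3 → ℝ :=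
  (List.ofFn α).foldr (fun Z f => applyVF f Z) φ

/-- A real function on `ℝ³`, regarded as complex valued. -/
def toC (f : E3 → ℝ) : E3 → ℂ := fun x => (f x : ℂ)

/-! ### Profiles and the low order energy -/

/-- The Fourier transform of the profile `h^α(t) = e^{i t |∇|} u^α(t)` of the half wave
`u^α = (∂_t - i |∇|) φ^α`, as a function of `(t, ξ)`. -/
def profileHat {l : ℕ} (α : Fin l → VF) (φ : ℝ → E3 → ℝ) (t : ℝ) (ξ : E3) : ℂ :=
  Complex.exp (Complex.I * (t * ‖ξ‖ : ℝ)) *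
    (fourierFun (toC (dt (gam α φ) t)) ξ
      - Complex.I * (‖ξ‖ : ℂ) * fourierFun (toC (gam α φ t)) ξ)

/-- Test functions on `ℝ³ ∖ {0}`. -/
structure IsTest (χ : E3 → ℂ) : Prop where
  smooth : ContDiff ℝ ∞ χ
  compact : HasCompactSupport χ
  away : (0 : E3) ∉ tsupport χ

/-- `D` is the weak derivative `∂_{w 0} ⋯ ∂_{w (n-1)} F` on `ℝ³ ∖ {0}`. -/
structure IsWeakDeriv {n : ℕ} (w : Fin n → Fin 3) (F D : E3 → ℂ) : Prop where
  left : LocallyIntegrableOn F {0}ᶜ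
  right : LocallyIntegrableOn D {0}ᶜ
  pairing : ∀ χ, IsTest χ →
    ∫ ξ, F ξ * partials w χ ξ = (-1 : ℂ) ^ n * ∫ ξ, D ξ * χ ξ

/-- `‖h‖_{X_n} = sup_k 2^{(n+1)k} ‖(∇_ξ^n ĥ) ψ_k‖_{L^∞}` as a function of `F = ĥ`. The derivative is
the weak one (it is unique almost everywhere); the norm is `∞` if it does not exist. -/
def xNorm (ψ : ℝ → ℝ) (n : ℕ) (F : E3 → ℂ) : ℝ≥0∞ :=
  ⨅ (D : (Fin n → Fin 3) → E3 → ℂ) (_ : ∀ w, IsWeakDeriv w F (D w)),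
    ⨆ k : ℤ, ENNReal.ofReal ((2 : ℝ) ^ (((n : ℤ) + 1) * k)) *
      ∑ w, eLpNorm (fun ξ => D w ξ * (dyadic ψ k ξ : ℂ)) ⊤ volume

/-- `G` is the time derivative at `t` of `s ↦ H s`, in the sense of distributions
on `ℝ³ ∖ {0}`. -/
structure IsTimeDeriv (H : ℝ → E3 → ℂ) (t : ℝ) (G : E3 → ℂ) : Prop where
  left : ∀ᶠ s in 𝓝 t, LocallyIntegrableOn (H s) {0}ᶜ
  right : LocallyIntegrableOn G {0}ᶜ
  hasDerivAt : ∀ χ, IsTest χ →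
    HasDerivAt (fun s => ∫ ξ, H s ξ * χ ξ) (∫ ξ, G ξ * χ ξ) t

/-- `‖∂_t h(t)‖_{X_n}` as a function of `H = ĥ`; it is `∞` if `∂_t ĥ` does not exist as a function
(which is unique almost everywhere). -/
def xNormDt (ψ : ℝ → ℝ) (n : ℕ) (H : ℝ → E3 → ℂ) (t : ℝ) : ℝ≥0∞ :=
  ⨅ (G : E3 → ℂ) (_ : IsTimeDeriv H t G), xNorm ψ n G

/-- The low order energy
`∑_{n ≤ 3, |α| ≤ 20 - 3n} ‖h^α‖_{X_n} + (1+|t|) ‖∂_t h^α‖_{X_n}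
+ (1+|t|)² ‖∂_t ∇ (1+|∇|)⁻¹ h^α‖_{X_n}`. -/
def energyLow (ψ : ℝ → ℝ) (φ : ℝ → E3 → ℝ) (t : ℝ) : ℝ≥0∞ :=
  ∑ n ∈ Finset.range 4, ∑ l ∈ Finset.range (20 - 3 * n + 1), ∑ α : Fin l → VF,
    (xNorm ψ n (profileHat α φ t)
      + ENNReal.ofReal (1 + |t|) * xNormDt ψ n (profileHat α φ) t
      + ENNReal.ofReal ((1 + |t|) ^ 2) * ∑ j : Fin 3,
          xNormDt ψ n (fun s ξ =>
            Complex.I * (ξ j : ℂ) / (1 + ‖ξ‖ : ℝ) * profileHat α φ s ξ) t)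

/-- A scalar field on the time set `J`: `φ` is regular enough for `∂_t φ^α` and `∇ φ^α`,
`|α| ≤ 20`, to be classical derivatives, and `φ^α` and `∂_t φ^α` have Fourier transforms in `x`
which are functions, so that the half waves and profiles make sense. -/
structure IsScalarField (J : Set ℝ) (φ : ℝ → E3 → ℝ) : Prop where
  contDiffOn : ContDiffOn ℝ 21 (fun p : ℝ × E3 => φ p.1 p.2) (J ×ˢ Set.univ)
  fourier : ∀ l ≤ 20, ∀ α : Fin l → VF, ∀ t ∈ J,
    HasFourierTransform (toC (gam α φ t)) ∧ HasFourierTransform (toC (dt (gam α φ) t))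

end WaveDecay

end

/-! Write d = ||t| - |x||. Up to the factor (2π)⁻³, an operator with symbol M applied to the half
wave of φ^α is the oscillatory integral of e^{i(x·ξ - t|ξ|)} M(ξ) F(ξ), where F is the transform of
the profile. The energy bounds the ξ-derivatives of F of order n ≤ 2 by |ξ|^(-1-n). Since |ξ| is
radial, the rotation derivative of F is the profile transform of Ω_i φ^α, so it costs a vector field
and no power of |ξ|. Each further translation field improves the bound on F by a power |ξ|⁻¹.
Because φ is real, ∂_t φ^α and |∇|φ^α are recovered from the half waves with symbols M and `reflect
M`.

Two integrations by parts produce decay.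

Along rotations (`dispersive_axis`, `exists_dispersive`): a combination of rotations multiplies the
phase by i|x|s, with s the squared distance of ξ to the axis ℝx. A coefficient regularizing 1/s at
the scale s ~ |ξ|/|x| gains 1/|x| for one rotation derivative of the amplitude. The price is a
weight whose integral over the annulus |ξ| ~ R is O(R²), uniformly in x (`exists_ann_wt`).

Along (x + tω)·∇ with ω = ξ/|ξ| (`integral_ph_confl`): the phase has gradient i(x - tω), and (x +
tω)·(x - tω) = |x|² - t². The coefficients have size |t| + |x|, so each use gains 1/(d|ξ|).

Splitting at |ξ| ~ 1/d and using the second field twice on the high part gives a bound 1/(d|x|) for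
amplitudes of order |ξ|⁻¹ (`exists_decay_near`). Without rotations, amplitudes of order |ξ|⁻² give
1/d (`exists_decay_away`).

Far from the cone, where d ≳ 1 + |t|, a bound 1/d² is needed. There the boosts, the scaling field
and the rotations are read as a linear system for the space-time gradient of φ^α, with determinant
|x|² - t². Commuting the multiplier through the coefficients x_j leaves terms of order |ξ|⁻², of
size 1/d by the previous bound; inverting the system gains the second 1/d (`norm_le_of_cone`,
`exists_op_away`).

If d < 1 and |t| is large, the rotations alone suffice, with decay |ξ|⁻³ at high frequency
(`exists_halfWave_dispersive`). If d and |t| are both bounded, the integrals are bounded absolutely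
(`integrable_wt4`). The regions are put together in `exists_op_decay`.

Two approximations make this rigorous. Profiles are only weakly differentiable away from 0, so they
are mollified by radial bumps, which respect rotations. Symbols are first truncated to a compact set
of frequencies away from 0, with bounds uniform in the truncation. -/

noncomputable section

namespace WaveDecay

/-! ### Symbol-type bounds |ξ|^(p-k) and their calculus -/

section
/-- The partial derivative `∂_j f`. -/
def pd (j : Fin 3) (f : E3 → ℂ) (ξ : E3) : ℂ := fderiv ℝ f ξ (e j)

/-- The rotation field `(e_i × ξ)·∇` applied to `f`. -/
def rot (i : Fin 3) (f : E3 → ℂ) (ξ : E3) : ℂ :=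
  (ξ (i + 1) : ℂ) * pd (i + 2) f ξ - (ξ (i + 2) : ℂ) * pd (i + 1) f ξ

/-- `f` has derivatives up to order `n` on `U`, and those of order `k` are bounded by
`A |ξ|^(p-k)`. -/
def Ord (U : Set E3) : ℕ → ℤ → ℝ → (E3 → ℂ) → Prop
  | 0, p, A, f => ∀ ξ ∈ U, ‖f ξ‖ ≤ A * ‖ξ‖ ^ p
  | n + 1, p, A, f => (∀ ξ ∈ U, DifferentiableAt ℝ f ξ) ∧ (∀ ξ ∈ U, ‖f ξ‖ ≤ A * ‖ξ‖ ^ p) ∧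
      ∀ j, Ord U n (p - 1) A (pd j f)

variable {U V : Set E3} {n : ℕ} {p q : ℤ} {A B : ℝ} {f g : E3 → ℂ}

lemma Ord.bound (h : Ord U n p A f) : ∀ ξ ∈ U, ‖f ξ‖ ≤ A * ‖ξ‖ ^ p := by
  cases n with
  | zero => exact h
  | succ n => exact h.2.1

lemma Ord.of_succ (h : Ord U (n + 1) p A f) : Ord U n p A f := by
  induction n generalizing p f with
  | zero => exact h.2.1
  | succ n ih => exact ⟨h.1, h.2.1, fun j => ih (h.2.2 j)⟩

lemma Ord.mono_order {m : ℕ} (hm : m ≤ n) (h : Ord U n p A f) : Ord U m p A f := by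
  induction n with
  | zero => obtain rfl : m = 0 := by omega
            exact h
  | succ n ih =>
    rcases Nat.of_le_succ hm with h' | rfl
    · exact ih h' h.of_succ
    · exact h

lemma Ord.mono_const (hAB : A ≤ B) (h : Ord U n p A f) : Ord U n p B f := by
  have key : ∀ {p : ℤ} {f : E3 → ℂ}, (∀ ξ ∈ U, ‖f ξ‖ ≤ A * ‖ξ‖ ^ p) →
      ∀ ξ ∈ U, ‖f ξ‖ ≤ B * ‖ξ‖ ^ p := fun h ξ hξ => (h ξ hξ).trans (by gcongr)
  induction n generalizing p f with
  | zero => exact key h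
  | succ n ih => exact ⟨h.1, key h.2.1, fun j => ih (h.2.2 j)⟩

lemma Ord.mono_set (hVU : V ⊆ U) (h : Ord U n p A f) : Ord V n p A f := by
  induction n generalizing p f with
  | zero => exact fun ξ hξ => h ξ (hVU hξ)
  | succ n ih => exact ⟨fun ξ hξ => h.1 ξ (hVU hξ), fun ξ hξ => h.2.1 ξ (hVU hξ),
      fun j => ih (h.2.2 j)⟩

lemma Ord.union (h : Ord U n p A f) (h' : Ord V n p A f) : Ord (U ∪ V) n p A f := by
  induction n generalizing p f with
  | zero => rintro ξ (hξ | hξ); exacts [h ξ hξ, h' ξ hξ]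
  | succ n ih =>
    refine ⟨?_, ?_, fun j => ih (h.2.2 j) (h'.2.2 j)⟩
    · rintro ξ (hξ | hξ); exacts [h.1 ξ hξ, h'.1 ξ hξ]
    · rintro ξ (hξ | hξ); exacts [h.2.1 ξ hξ, h'.2.1 ξ hξ]

lemma pd_eqOn (hU : IsOpen U) (hfg : Set.EqOn f g U) (j : Fin 3) :
    Set.EqOn (pd j f) (pd j g) U := fun ξ hξ => by
  have : f =ᶠ[𝓝 ξ] g := Filter.eventually_of_mem (hU.mem_nhds hξ) hfg
  simp only [pd, this.fderiv_eq]

lemma rot_eqOn (hU : IsOpen U) (hfg : Set.EqOn f g U) (i : Fin 3) :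
    Set.EqOn (rot i f) (rot i g) U := fun ξ hξ => by
  simp only [rot, pd_eqOn hU hfg _ hξ]

lemma Ord.congr (hU : IsOpen U) (h : Ord U n p A f) (hfg : Set.EqOn f g U) : Ord U n p A g := by
  induction n generalizing p f g with
  | zero => exact fun ξ hξ => hfg hξ ▸ h ξ hξ
  | succ n ih =>
    refine ⟨fun ξ hξ => ?_, fun ξ hξ => hfg hξ ▸ h.2.1 ξ hξ, fun j =>
      ih (h.2.2 j) (pd_eqOn hU hfg j)⟩
    have : f =ᶠ[𝓝 ξ] g := Filter.eventually_of_mem (hU.mem_nhds hξ) hfg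
    exact (h.1 ξ hξ).congr_of_eventuallyEq this.symm

lemma Ord.zero (hA : 0 ≤ A) : Ord U n p A (fun _ => 0) := by
  have key : ∀ (p : ℤ), ∀ ξ ∈ U, ‖(0 : ℂ)‖ ≤ A * ‖ξ‖ ^ p := fun p ξ _ => by
    rw [norm_zero]; positivity
  induction n generalizing p with
  | zero => exact key p
  | succ n ih =>
    refine ⟨fun ξ _ => differentiableAt_const _, key p, fun j => ?_⟩
    have : pd j (fun _ => (0 : ℂ)) = fun _ => 0 := by ext ξ; simp [pd]
    rw [this]; exact ih

lemma Ord.const (c : ℂ) (hA : ‖c‖ ≤ A) : Ord U n 0 A (fun _ => c) := by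
  cases n with
  | zero => intro ξ _; simpa using hA
  | succ n =>
    refine ⟨fun ξ _ => differentiableAt_const _, fun ξ _ => by simpa using hA, fun j => ?_⟩
    have : pd j (fun _ => c) = fun _ => 0 := by ext ξ; simp [pd]
    rw [this]; exact Ord.zero ((norm_nonneg _).trans hA)

lemma pd_add {ξ : E3} (hf : DifferentiableAt ℝ f ξ) (hg : DifferentiableAt ℝ g ξ) (j : Fin 3) :
    pd j (fun ξ => f ξ + g ξ) ξ = pd j f ξ + pd j g ξ := by
  simp only [pd, fderiv_fun_add hf hg, _root_.add_apply]

lemma pd_mul {ξ : E3} (hf : DifferentiableAt ℝ f ξ) (hg : DifferentiableAt ℝ g ξ) (j : Fin 3) :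
    pd j (fun ξ => f ξ * g ξ) ξ = pd j f ξ * g ξ + f ξ * pd j g ξ := by
  simp only [pd, fderiv_fun_mul hf hg, _root_.add_apply,
    _root_.smul_apply, smul_eq_mul]
  ring

lemma pd_const_mul {ξ : E3} (hf : DifferentiableAt ℝ f ξ) (c : ℂ) (j : Fin 3) :
    pd j (fun ξ => c * f ξ) ξ = c * pd j f ξ := by
  rw [pd_mul (differentiableAt_const c) hf]; simp [pd]

lemma Ord.add (hU : IsOpen U) (hf : Ord U n p A f) (hg : Ord U n p B g) :
    Ord U n p (A + B) (fun ξ => f ξ + g ξ) := by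
  have key : ∀ {p : ℤ} {f g : E3 → ℂ}, (∀ ξ ∈ U, ‖f ξ‖ ≤ A * ‖ξ‖ ^ p) →
      (∀ ξ ∈ U, ‖g ξ‖ ≤ B * ‖ξ‖ ^ p) → ∀ ξ ∈ U, ‖f ξ + g ξ‖ ≤ (A + B) * ‖ξ‖ ^ p :=
    fun h h' ξ hξ => (norm_add_le _ _).trans (by rw [add_mul]; exact add_le_add (h ξ hξ) (h' ξ hξ))
  induction n generalizing p f g with
  | zero => exact key hf hg
  | succ n ih =>
    exact ⟨fun ξ hξ => (hf.1 ξ hξ).add (hg.1 ξ hξ), key hf.2.1 hg.2.1, fun j =>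
      (ih (hf.2.2 j) (hg.2.2 j)).congr hU fun ξ hξ => (pd_add (hf.1 ξ hξ) (hg.1 ξ hξ) j).symm⟩

lemma Ord.const_mul (hU : IsOpen U) (c : ℂ) (hf : Ord U n p A f) :
    Ord U n p (‖c‖ * A) (fun ξ => c * f ξ) := by
  have key : ∀ {p : ℤ} {f : E3 → ℂ}, (∀ ξ ∈ U, ‖f ξ‖ ≤ A * ‖ξ‖ ^ p) →
      ∀ ξ ∈ U, ‖c * f ξ‖ ≤ (‖c‖ * A) * ‖ξ‖ ^ p := fun h ξ hξ => by
    rw [norm_mul, mul_assoc]; exact mul_le_mul_of_nonneg_left (h ξ hξ) (norm_nonneg _)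
  induction n generalizing p f with
  | zero => exact key hf
  | succ n ih =>
    exact ⟨fun ξ hξ => (hf.1 ξ hξ).const_mul c, key hf.2.1, fun j =>
      (ih (hf.2.2 j)).congr hU fun ξ hξ => (pd_const_mul (hf.1 ξ hξ) c j).symm⟩

lemma Ord.neg (hU : IsOpen U) (hf : Ord U n p A f) : Ord U n p A (fun ξ => -f ξ) := by
  have := hf.const_mul hU (-1)
  simpa using this

lemma Ord.sub (hU : IsOpen U) (hf : Ord U n p A f) (hg : Ord U n p B g) :
    Ord U n p (A + B) (fun ξ => f ξ - g ξ) := by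
  simpa only [sub_eq_add_neg] using hf.add hU (hg.neg hU)

lemma Ord.sum3 (hU : IsOpen U) {F : Fin 3 → E3 → ℂ} (hF : ∀ j, Ord U n p A (F j)) :
    Ord U n p (3 * A) (fun ξ => ∑ j, F j ξ) := by
  have := ((hF 0).add hU (hF 1)).add hU (hF 2)
  simp only [Fin.sum_univ_three]
  convert this using 1; ring

/-- Every use of the product rule doubles the constant, whence 2^n. The origin is excluded so that
powers of |ξ| with negative exponents multiply correctly. -/
lemma Ord.mul (hU : IsOpen U) (h0 : (0 : E3) ∉ U) (hA : 0 ≤ A) (hB : 0 ≤ B)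
    (hf : Ord U n p A f) (hg : Ord U n q B g) :
    Ord U n (p + q) (2 ^ n * (A * B)) (fun ξ => f ξ * g ξ) := by
  have key : ∀ {n : ℕ} {p q : ℤ} {f g : E3 → ℂ}, (∀ ξ ∈ U, ‖f ξ‖ ≤ A * ‖ξ‖ ^ p) →
      (∀ ξ ∈ U, ‖g ξ‖ ≤ B * ‖ξ‖ ^ q) →
      ∀ ξ ∈ U, ‖f ξ * g ξ‖ ≤ (2 ^ n * (A * B)) * ‖ξ‖ ^ (p + q) := by
    intro n p q f g h h' ξ hξ
    have hne : ‖ξ‖ ≠ 0 := norm_ne_zero_iff.2 fun h => h0 (h ▸ hξ)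
    rw [norm_mul, zpow_add₀ hne]
    calc ‖f ξ‖ * ‖g ξ‖ ≤ (A * ‖ξ‖ ^ p) * (B * ‖ξ‖ ^ q) :=
          mul_le_mul (h ξ hξ) (h' ξ hξ) (norm_nonneg _) ((norm_nonneg _).trans (h ξ hξ))
      _ = 1 * (A * B) * (‖ξ‖ ^ p * ‖ξ‖ ^ q) := by ring
      _ ≤ _ := by gcongr; exact one_le_pow₀ (by norm_num)
  induction n generalizing p q f g with
  | zero => exact key hf hg
  | succ n ih =>
    refine ⟨fun ξ hξ => (hf.1 ξ hξ).mul (hg.1 ξ hξ), key hf.2.1 hg.2.1, fun j => ?_⟩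
    have h1 := ih (hf.2.2 j) hg.of_succ
    have h2 := ih hf.of_succ (hg.2.2 j)
    rw [show p - 1 + q = p + q - 1 by ring] at h1
    rw [show p + (q - 1) = p + q - 1 by ring] at h2
    have := h1.add hU h2
    rw [show 2 ^ n * (A * B) + 2 ^ n * (A * B) = 2 ^ (n + 1) * (A * B) by ring] at this
    exact this.congr hU fun ξ hξ => (pd_mul (hf.1 ξ hξ) (hg.1 ξ hξ) j).symm

lemma e_apply (j k : Fin 3) : e j k = if k = j then 1 else 0 := by
  simp [e]

lemma hasFDerivAt_coord (a : Fin 3) (ξ : E3) :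
    HasFDerivAt (fun ξ : E3 => (ξ a : ℂ))
      (Complex.ofRealCLM.comp (EuclideanSpace.proj a : E3 →L[ℝ] ℝ)) ξ :=
  (Complex.ofRealCLM.comp (EuclideanSpace.proj a : E3 →L[ℝ] ℝ)).hasFDerivAt

lemma contDiff_coord {k : WithTop ℕ∞} (a : Fin 3) : ContDiff ℝ k (fun ξ : E3 => (ξ a : ℂ)) :=
  (Complex.ofRealCLM.comp (EuclideanSpace.proj a : E3 →L[ℝ] ℝ)).contDiff

lemma pd_coord (a j : Fin 3) (ξ : E3) :
    pd j (fun ξ => (ξ a : ℂ)) ξ = if a = j then 1 else 0 := by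
  simp only [pd, (hasFDerivAt_coord a ξ).fderiv]
  split_ifs with h <;> simp [e_apply, h]

lemma Ord.coord (a : Fin 3) : Ord U n 1 1 (fun ξ => (ξ a : ℂ)) := by
  have key : ∀ ξ ∈ U, ‖(ξ a : ℂ)‖ ≤ 1 * ‖ξ‖ ^ (1 : ℤ) := fun ξ _ => by
    simpa using PiLp.norm_apply_le ξ a
  cases n with
  | zero => exact key
  | succ n =>
    refine ⟨fun ξ _ => (hasFDerivAt_coord a ξ).differentiableAt, key, fun j => ?_⟩
    rw [funext (pd_coord a j)]
    exact Ord.const _ (by split_ifs <;> simp)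

/-- A rotation is a difference of terms ξ_a ∂_b, so it spends one derivative but leaves the power of
|ξ| unchanged. -/
lemma Ord.rot (hU : IsOpen U) (h0 : (0 : E3) ∉ U) (hA : 0 ≤ A) (hf : Ord U (n + 1) p A f)
    (i : Fin 3) : Ord U n p (2 ^ (n + 1) * A) (rot i f) := by
  have h := fun a b : Fin 3 =>
    (Ord.coord (U := U) (n := n) a).mul hU h0 zero_le_one hA (hf.2.2 b)
  rw [show 1 + (p - 1) = p by ring] at h
  have := (h (i + 1) (i + 2)).sub hU (h (i + 2) (i + 1))
  exact this.mono_const (by rw [pow_succ]; linarith)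

/-- Bounds of order `p` for `f` and for its derivatives along rotations. -/
structure Good (U : Set E3) (n : ℕ) (p : ℤ) (A : ℝ) (f : E3 → ℂ) : Prop where
  smooth : ContDiffOn ℝ (n + 1) f U
  ord : Ord U n p A f
  rot : ∀ i, Ord U n p A (rot i f)

lemma Good.mono_const (hAB : A ≤ B) (h : Good U n p A f) : Good U n p B f :=
  ⟨h.smooth, h.ord.mono_const hAB, fun i => (h.rot i).mono_const hAB⟩

lemma Good.mono_order {m : ℕ} (hm : m ≤ n) (h : Good U n p A f) : Good U m p A f :=
  ⟨h.smooth.of_le (by gcongr), h.ord.mono_order hm, fun i => (h.rot i).mono_order hm⟩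

lemma Good.differentiableAt (hU : IsOpen U) (h : Good U n p A f) {ξ : E3} (hξ : ξ ∈ U) :
    DifferentiableAt ℝ f ξ :=
  (h.smooth.contDiffAt (hU.mem_nhds hξ)).differentiableAt (by simp)

lemma Good.congr (hU : IsOpen U) (h : Good U n p A f) (hfg : Set.EqOn f g U) : Good U n p A g :=
  ⟨h.smooth.congr fun _ hξ => (hfg hξ).symm, h.ord.congr hU hfg,
    fun i => (h.rot i).congr hU (rot_eqOn hU hfg i)⟩

lemma Ord.good (hU : IsOpen U) (h0 : (0 : E3) ∉ U) (hA : 0 ≤ A) (hs : ContDiffOn ℝ (n + 1) f U)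
    (h : Ord U (n + 1) p A f) : Good U n p (2 ^ (n + 1) * A) f :=
  ⟨hs, h.of_succ.mono_const (le_mul_of_one_le_left hA (one_le_pow₀ (by norm_num))),
    fun i => h.rot hU h0 hA i⟩

lemma rot_mul {ξ : E3} (hf : DifferentiableAt ℝ f ξ) (hg : DifferentiableAt ℝ g ξ) (i : Fin 3) :
    rot i (fun ξ => f ξ * g ξ) ξ = rot i f ξ * g ξ + f ξ * rot i g ξ := by
  simp only [rot, pd_mul hf hg]; ring

lemma rot_add {ξ : E3} (hf : DifferentiableAt ℝ f ξ) (hg : DifferentiableAt ℝ g ξ) (i : Fin 3) :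
    rot i (fun ξ => f ξ + g ξ) ξ = rot i f ξ + rot i g ξ := by
  simp only [rot, pd_add hf hg]; ring

lemma Good.mul (hU : IsOpen U) (h0 : (0 : E3) ∉ U) (hA : 0 ≤ A) (hB : 0 ≤ B)
    (hf : Good U n p A f) (hg : Good U n q B g) :
    Good U n (p + q) (2 ^ (n + 1) * (A * B)) (fun ξ => f ξ * g ξ) := by
  refine ⟨hf.smooth.mul hg.smooth, (hf.ord.mul hU h0 hA hB hg.ord).mono_const ?_, fun i => ?_⟩
  · gcongr <;> norm_num
  · have := ((hf.rot i).mul hU h0 hA hB hg.ord).add hU (hf.ord.mul hU h0 hA hB (hg.rot i))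
    rw [show 2 ^ n * (A * B) + 2 ^ n * (A * B) = 2 ^ (n + 1) * (A * B) by ring] at this
    exact this.congr hU fun ξ hξ =>
      (rot_mul (hf.differentiableAt hU hξ) (hg.differentiableAt hU hξ) i).symm

lemma Good.add (hU : IsOpen U) (hf : Good U n p A f) (hg : Good U n p B g) :
    Good U n p (A + B) (fun ξ => f ξ + g ξ) :=
  ⟨hf.smooth.add hg.smooth, hf.ord.add hU hg.ord, fun i =>
    ((hf.rot i).add hU (hg.rot i)).congr hU fun _ hξ =>
      (rot_add (hf.differentiableAt hU hξ) (hg.differentiableAt hU hξ) i).symm⟩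

lemma Good.sum3 (hU : IsOpen U) {F : Fin 3 → E3 → ℂ} (hF : ∀ j, Good U n p A (F j)) :
    Good U n p (3 * A) (fun ξ => ∑ j, F j ξ) := by
  have := ((hF 0).add hU (hF 1)).add hU (hF 2)
  simp only [Fin.sum_univ_three]
  convert this using 1; ring

lemma Good.const (hA : 0 ≤ A) (c : ℂ) (hc : ‖c‖ ≤ A) : Good U n 0 A (fun _ => c) := by
  refine ⟨contDiffOn_const, Ord.const c hc, fun i => ?_⟩
  have : WaveDecay.rot i (fun _ => c) = fun _ => 0 := by ext ξ; simp [WaveDecay.rot, pd]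
  rw [this]; exact Ord.zero hA

lemma contDiffOn_pd (hU : IsOpen U) {k : ℕ} (hf : ContDiffOn ℝ (k + 1) f U) (j : Fin 3) :
    ContDiffOn ℝ k (pd j f) U :=
  ((hf.fderiv_of_isOpen hU (m := k) (by norm_cast)).clm_apply contDiffOn_const)

lemma pd_comm {ξ : E3} (hf : ContDiffAt ℝ 2 f ξ) (j k : Fin 3) :
    pd j (pd k f) ξ = pd k (pd j f) ξ := by
  have hd : DifferentiableAt ℝ (fderiv ℝ f) ξ :=
    (hf.fderiv_right (m := 1) (by norm_num)).differentiableAt (by norm_num)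
  have key : ∀ j k, pd j (pd k f) ξ = fderiv ℝ (fderiv ℝ f) ξ (e j) (e k) := fun j k => by
    have : pd k f = fun ξ => fderiv ℝ f ξ (e k) := rfl
    rw [this, pd, fderiv_clm_apply hd (differentiableAt_const _)]
    simp
  have hs : IsSymmSndFDerivAt ℝ f ξ := hf.isSymmSndFDerivAt (by simp)
  rw [key, key, hs.eq]

/-- The commutator of ξ_a ∂_b with ∂_j is a constant multiple of ∂_b. For this reason `Good` is
stable under differentiation (`Good.pd`). -/
lemma rot_pd {ξ : E3} (hf : ContDiffAt ℝ 2 f ξ) (i j : Fin 3) :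
    rot i (pd j f) ξ = pd j (rot i f) ξ + (if i + 2 = j then 1 else 0) * pd (i + 1) f ξ
      - (if i + 1 = j then 1 else 0) * pd (i + 2) f ξ := by
  have hd : ∀ k, DifferentiableAt ℝ (pd k f) ξ := fun k =>
    ((hf.fderiv_right (m := 1) (by norm_num)).clm_apply contDiffAt_const).differentiableAt
      (by norm_num)
  have hc : ∀ a : Fin 3, DifferentiableAt ℝ (fun ξ : E3 => (ξ a : ℂ)) ξ :=
    fun a => (hasFDerivAt_coord a ξ).differentiableAt
  have h1 : pd j (rot i f) ξ = pd j (fun ξ => (ξ (i + 1) : ℂ) * pd (i + 2) f ξ) ξ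
      - pd j (fun ξ => (ξ (i + 2) : ℂ) * pd (i + 1) f ξ) ξ := by
    have : rot i f = fun ξ => (ξ (i + 1) : ℂ) * pd (i + 2) f ξ
      - (ξ (i + 2) : ℂ) * pd (i + 1) f ξ := rfl
    rw [this]
    simp only [pd]
    rw [fderiv_fun_sub]
    · rfl
    · exact (hc _).mul (hd _)
    · exact (hc _).mul (hd _)
  rw [h1, pd_mul (hc _) (hd _), pd_mul (hc _) (hd _), pd_coord, pd_coord, rot,
    pd_comm hf j, pd_comm hf j]
  ring

lemma Good.pd (hU : IsOpen U) (hA : 0 ≤ A) (hf : Good U (n + 1) p A f) (j : Fin 3) :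
    Good U n (p - 1) (3 * A) (pd j f) := by
  have hs : ContDiffOn ℝ ((n + 1 : ℕ) + 1) f U := by exact_mod_cast hf.smooth
  refine ⟨by exact_mod_cast contDiffOn_pd hU hs j,
    (hf.ord.2.2 j).mono_const (by linarith), fun i => ?_⟩
  have hδ : ∀ (P : Prop) [Decidable P], ‖(if P then 1 else 0 : ℂ)‖ ≤ 1 := fun P _ => by
    split_ifs <;> simp
  have h2 := ((hf.ord.2.2 (i + 1)).const_mul hU (if i + 2 = j then 1 else 0)).mono_const
    (mul_le_of_le_one_left hA (hδ _))
  have h3 := ((hf.ord.2.2 (i + 2)).const_mul hU (if i + 1 = j then 1 else 0)).mono_const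
    (mul_le_of_le_one_left hA (hδ _))
  have := ((((hf.rot i).2.2 j).add hU h2).sub hU h3)
  refine (this.congr hU fun ξ hξ => ?_).mono_const (by linarith)
  refine (rot_pd ?_ i j).symm
  refine (hs.contDiffAt (hU.mem_nhds hξ)).of_le ?_
  norm_cast; omega

end

/-! ### The functions 1/|ξ|, ξ_j/|ξ| and radial cutoffs -/

section
/-- The function `1/|ξ|`. -/
def rinv (ξ : E3) : ℂ := ((‖ξ‖⁻¹ : ℝ) : ℂ)

/-- The function `ξ_j/|ξ|`. -/
def om (j : Fin 3) (ξ : E3) : ℂ := (ξ j : ℂ) * rinv ξ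

lemma isOpen_compl_zero : IsOpen ({0}ᶜ : Set E3) := isOpen_compl_singleton

lemma zero_notMem_compl : (0 : E3) ∉ ({0}ᶜ : Set E3) := by simp

lemma inner_e (ξ : E3) (j : Fin 3) : inner ℝ ξ (e j) = ξ j := by
  simp [e, EuclideanSpace.inner_single_right]

lemma hasFDerivAt_norm_of_ne {ξ : E3} (hξ : ξ ≠ 0) :
    HasFDerivAt (fun ξ : E3 => ‖ξ‖) (‖ξ‖⁻¹ • innerSL ℝ ξ) ξ := by
  have h1 : HasFDerivAt (fun ξ : E3 => ‖ξ‖ ^ 2) (2 • innerSL ℝ ξ) ξ := by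
    simpa using (hasStrictFDerivAt_norm_sq ξ).hasFDerivAt
  have h2 := h1.sqrt (pow_ne_zero 2 (norm_ne_zero_iff.2 hξ))
  simp only [Real.sqrt_sq (norm_nonneg _)] at h2
  refine h2.congr_fderiv ?_
  ext v
  have := norm_ne_zero_iff.2 hξ
  simp
  field_simp

lemma hasFDerivAt_radial {h : ℝ → ℂ} {h' : ℂ} {ξ : E3} (hξ : ξ ≠ 0) (hh : HasDerivAt h h' ‖ξ‖) :
    HasFDerivAt (fun ξ : E3 => h ‖ξ‖)
      ((‖ξ‖⁻¹ • innerSL ℝ ξ : E3 →L[ℝ] ℝ).smulRight h') ξ :=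
  (hh.hasFDerivAt.comp ξ (hasFDerivAt_norm_of_ne hξ)).congr_fderiv (by ext v; simp; ring)

lemma pd_radial {h : ℝ → ℂ} {h' : ℂ} {ξ : E3} (hξ : ξ ≠ 0) (hh : HasDerivAt h h' ‖ξ‖)
    (j : Fin 3) : pd j (fun ξ : E3 => h ‖ξ‖) ξ = h' * om j ξ := by
  rw [pd, (hasFDerivAt_radial hξ hh).fderiv]
  simp [inner_e, om, rinv]
  ring

lemma contDiffOn_norm {k : WithTop ℕ∞} : ContDiffOn ℝ k (fun ξ : E3 => ‖ξ‖) {0}ᶜ :=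
  fun _ hξ => (contDiffAt_norm ℝ hξ).contDiffWithinAt

lemma contDiffOn_rinv {k : WithTop ℕ∞} : ContDiffOn ℝ k rinv {0}ᶜ :=
  Complex.ofRealCLM.contDiff.comp_contDiffOn
    (contDiffOn_norm.inv fun _ hξ => norm_ne_zero_iff.2 hξ)

lemma contDiffOn_om {k : WithTop ℕ∞} (j : Fin 3) : ContDiffOn ℝ k (om j) {0}ᶜ :=
  (contDiff_coord j).contDiffOn.mul contDiffOn_rinv

lemma pd_rinv {ξ : E3} (hξ : ξ ≠ 0) (j : Fin 3) :
    pd j rinv ξ = -(rinv ξ * (rinv ξ * om j ξ)) := by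
  have : HasDerivAt (fun s : ℝ => ((s⁻¹ : ℝ) : ℂ)) ((-(‖ξ‖ ^ 2)⁻¹ : ℝ) : ℂ) ‖ξ‖ :=
    (hasDerivAt_inv (norm_ne_zero_iff.2 hξ)).ofReal_comp
  rw [show rinv = fun ξ : E3 => ((‖ξ‖⁻¹ : ℝ) : ℂ) from rfl, pd_radial hξ this]
  push_cast
  ring

/-- The gradient of 1/|ξ| is a polynomial in the coordinates and 1/|ξ| itself, so the product rule
closes an induction on the order. -/
lemma exists_ord_rinv (n : ℕ) : ∃ C, 0 ≤ C ∧ Ord {0}ᶜ n (-1) C rinv := by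
  have hb : ∀ {C : ℝ}, 1 ≤ C → ∀ ξ ∈ ({0}ᶜ : Set E3), ‖rinv ξ‖ ≤ C * ‖ξ‖ ^ (-1 : ℤ) := by
    intro C hC ξ _
    simp only [rinv, Complex.norm_real, norm_inv, norm_norm, zpow_neg, zpow_one]
    exact le_mul_of_one_le_left (by positivity) hC
  induction n with
  | zero => exact ⟨1, zero_le_one, hb le_rfl⟩
  | succ n ih =>
    obtain ⟨C, hC, h⟩ := ih
    have ho := isOpen_compl_zero
    have hz := zero_notMem_compl
    have hom := fun j => (Ord.coord (U := {0}ᶜ) (n := n) j).mul ho hz zero_le_one hC h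
    have hp := fun j => (h.mul ho hz hC (by positivity)
      (h.mul ho hz hC (by positivity) (hom j))).neg ho
    refine ⟨max 1 (2 ^ n * (C * (2 ^ n * (C * (2 ^ n * (1 * C)))))), by positivity, fun ξ hξ => ?_,
      hb (le_max_left _ _), fun j => ((hp j).mono_const (le_max_right _ _)).congr ho
        fun ξ hξ => (pd_rinv hξ j).symm⟩
    exact ((contDiffOn_rinv (k := 1)).contDiffAt (ho.mem_nhds hξ)).differentiableAt (by norm_num)

lemma exists_ord_om (n : ℕ) : ∃ C, 0 ≤ C ∧ ∀ j, Ord {0}ᶜ n 0 C (om j) := by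
  obtain ⟨C, hC, h⟩ := exists_ord_rinv n
  exact ⟨_, by positivity, fun j => (Ord.coord (U := {0}ᶜ) (n := n) j).mul isOpen_compl_zero
    zero_notMem_compl zero_le_one hC h⟩

/-- Differentiating h(|ξ|/R) gives ω_j |ξ|⁻¹ g(|ξ|/R) with g(s) = s h'(s). No R is left over and g
is again smooth with compact support, so an induction over all h gives bounds uniform in R. -/
lemma exists_ord_cutoff {h : ℝ → ℝ} (hs : ContDiff ℝ ∞ h) (hc : HasCompactSupport h) (n : ℕ) :
    ∃ C, 0 ≤ C ∧ ∀ R > 0, Ord {0}ᶜ n 0 C (fun ξ : E3 => (h (‖ξ‖ / R) : ℂ)) := by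
  have hb : ∀ {h : ℝ → ℝ}, ContDiff ℝ ∞ h → HasCompactSupport h → ∃ C, 0 ≤ C ∧ ∀ R > 0,
      ∀ ξ ∈ ({0}ᶜ : Set E3), ‖(h (‖ξ‖ / R) : ℂ)‖ ≤ C * ‖ξ‖ ^ (0 : ℤ) := by
    intro h hs hc
    obtain ⟨C, hC⟩ := hc.exists_bound_of_continuous hs.continuous
    exact ⟨C, (norm_nonneg _).trans (hC 0), fun R _ ξ _ => by simpa using hC (‖ξ‖ / R)⟩
  induction n generalizing h with
  | zero => exact hb hs hc
  | succ n ih =>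
    have hs' : ContDiff ℝ ∞ (fun s => s * deriv h s) :=
      contDiff_id.mul (contDiff_infty_iff_deriv.1 hs).2
    obtain ⟨C₀, hC₀, h₀⟩ := hb hs hc
    obtain ⟨C₁, hC₁, h₁⟩ := ih hs' (hc.deriv.mul_left)
    obtain ⟨C₂, hC₂, h₂⟩ := exists_ord_rinv n
    obtain ⟨C₃, hC₃, h₃⟩ := exists_ord_om n
    have ho := isOpen_compl_zero
    have hz := zero_notMem_compl
    refine ⟨max C₀ (2 ^ n * (C₁ * (2 ^ n * (C₂ * C₃)))), by positivity, fun R hR => ?_⟩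
    have hd : ∀ s : ℝ, HasDerivAt (fun s => (h (s / R) : ℂ)) ((deriv h (s / R) * (1 / R) : ℝ) : ℂ) s :=
      fun s => (((hs.differentiable (by simp)).differentiableAt.hasDerivAt).comp s
        ((hasDerivAt_id s).div_const R)).ofReal_comp
    refine ⟨fun ξ hξ => (hasFDerivAt_radial hξ (hd ‖ξ‖)).differentiableAt,
      fun ξ hξ => (h₀ R hR ξ hξ).trans (by gcongr; exact le_max_left _ _), fun j => ?_⟩
    have hm := (h₁ R hR).mul ho hz hC₁ (by positivity) (h₂.mul ho hz hC₂ hC₃ (h₃ j))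
    refine (hm.mono_const (le_max_right _ _)).congr ho fun ξ hξ => ?_
    rw [pd_radial hξ (hd ‖ξ‖)]
    have hne : (‖ξ‖ : ℂ) ≠ 0 := by exact_mod_cast norm_ne_zero_iff.2 hξ
    have hR' : (R : ℂ) ≠ 0 := by exact_mod_cast hR.ne'
    simp only [rinv]
    push_cast
    field_simp

lemma IsCutoff.hasCompactSupport {ψ : ℝ → ℝ} (hψ : IsCutoff ψ) : HasCompactSupport ψ :=
  HasCompactSupport.of_support_subset_isCompact isCompact_Icc hψ.support

lemma contDiffOn_cutoff {h : ℝ → ℝ} (hs : ContDiff ℝ ∞ h) (R : ℝ) (k : ℕ) :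
    ContDiffOn ℝ k (fun ξ : E3 => (h (‖ξ‖ / R) : ℂ)) {0}ᶜ :=
  Complex.ofRealCLM.contDiff.comp_contDiffOn
    ((hs.of_le (by exact_mod_cast le_top)).comp_contDiffOn (contDiffOn_norm.div_const R))

lemma exists_good_rinv (n : ℕ) : ∃ C, 0 ≤ C ∧ Good {0}ᶜ n (-1) C rinv := by
  obtain ⟨C, hC, h⟩ := exists_ord_rinv (n + 1)
  exact ⟨_, by positivity, h.good isOpen_compl_zero zero_notMem_compl hC contDiffOn_rinv⟩

lemma exists_good_om (n : ℕ) : ∃ C, 0 ≤ C ∧ ∀ j, Good {0}ᶜ n 0 C (om j) := by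
  obtain ⟨C, hC, h⟩ := exists_ord_om (n + 1)
  exact ⟨_, by positivity, fun j =>
    (h j).good isOpen_compl_zero zero_notMem_compl hC (contDiffOn_om j)⟩

lemma exists_good_cutoff {h : ℝ → ℝ} (hs : ContDiff ℝ ∞ h) (hc : HasCompactSupport h) (n : ℕ) :
    ∃ C, 0 ≤ C ∧ ∀ R > 0, Good {0}ᶜ n 0 C (fun ξ : E3 => (h (‖ξ‖ / R) : ℂ)) := by
  obtain ⟨C, hC, h'⟩ := exists_ord_cutoff hs hc (n + 1)
  exact ⟨_, by positivity, fun R hR => (h' R hR).good isOpen_compl_zero zero_notMem_compl hC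
    (by exact_mod_cast contDiffOn_cutoff hs R (n + 1))⟩

end

/-! ### The phase and integration by parts along (x + tω)·∇ -/

section
/-- `f` has compact support in `ℝ³ ∖ {0}`. -/
structure Away (f : E3 → ℂ) : Prop where
  compact : HasCompactSupport f
  away : (0 : E3) ∉ tsupport f

variable {f g : E3 → ℂ}

lemma Away.eventually_eq_zero (hf : Away f) : f =ᶠ[𝓝 0] 0 :=
  notMem_tsupport_iff_eventuallyEq.1 hf.away

lemma Away.apply_zero (hf : Away f) : f 0 = 0 := hf.eventually_eq_zero.self_of_nhds

lemma Away.mul_left (hf : Away f) (h : E3 → ℂ) : Away (fun ξ => h ξ * f ξ) :=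
  ⟨hf.compact.mul_left, fun h0 => hf.away (tsupport_mul_subset_right h0)⟩

lemma Away.mul_right (hf : Away f) (h : E3 → ℂ) : Away (fun ξ => f ξ * h ξ) := by
  simpa only [mul_comm] using hf.mul_left h

lemma Away.of_support (hf : Away f) (h : Function.support g ⊆ tsupport f) : Away g := by
  have h' : tsupport g ⊆ tsupport f := closure_minimal h (isClosed_tsupport f)
  exact ⟨hf.compact.of_isClosed_subset (isClosed_tsupport g) h', fun h0 => hf.away (h' h0)⟩

lemma support_pd_subset (j : Fin 3) : Function.support (pd j f) ⊆ tsupport f := fun ξ hξ => by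
  by_contra h
  exact hξ (by simp [pd, fderiv_of_notMem_tsupport ℝ h])

lemma Away.pd (hf : Away f) (j : Fin 3) : Away (pd j f) := hf.of_support (support_pd_subset j)

lemma Away.contDiff (hf : Away f) {k : WithTop ℕ∞} (h : ContDiffOn ℝ k f {0}ᶜ) :
    ContDiff ℝ k f := by
  rw [contDiff_iff_contDiffAt]
  intro ξ
  by_cases hξ : ξ = 0
  · subst hξ
    exact contDiffAt_const.congr_of_eventuallyEq (hf.eventually_eq_zero)
  · exact h.contDiffAt (isOpen_compl_zero.mem_nhds hξ)

lemma continuous_pd (hf : ContDiff ℝ 1 f) (j : Fin 3) : Continuous (pd j f) :=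
  (hf.continuous_fderiv (by norm_num)).clm_apply continuous_const

lemma integral_pd_eq_zero (hf : ContDiff ℝ 1 f) (hc : HasCompactSupport f) (j : Fin 3) :
    ∫ ξ, pd j f ξ = 0 := by
  have hpc : HasCompactSupport (pd j f) :=
    hc.of_isClosed_subset (isClosed_tsupport _)
      (closure_minimal (support_pd_subset j) (isClosed_tsupport _))
  have hi := (continuous_pd hf j).integrable_of_hasCompactSupport hpc (μ := volume)
  have := integral_mul_fderiv_eq_neg_fderiv_mul_of_integrable (μ := (volume : Measure E3))
    (𝕜 := ℂ) (f := fun _ => 1) (g := f) (v := e j) (by simp)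
    (by simpa [pd] using! hi) (by simpa using hf.continuous.integrable_of_hasCompactSupport hc)
    (fun _ _ => differentiableAt_const _) (fun ξ _ => hf.differentiable (by norm_num) ξ)
  simpa using! this

/-- The oscillating factor `e^{i(x·ξ - t|ξ|)}`. -/
def ph (t : ℝ) (x ξ : E3) : ℂ := Complex.exp (Complex.I * ((inner ℝ x ξ - t * ‖ξ‖ : ℝ) : ℂ))

lemma norm_ph (t : ℝ) (x ξ : E3) : ‖ph t x ξ‖ = 1 := by
  rw [ph, mul_comm, Complex.norm_exp_ofReal_mul_I]

lemma continuous_ph (t : ℝ) (x : E3) : Continuous (ph t x) := by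
  unfold ph; fun_prop

lemma contDiffOn_ph {k : WithTop ℕ∞} (t : ℝ) (x : E3) : ContDiffOn ℝ k (ph t x) {0}ᶜ := by
  refine ContDiffOn.cexp (contDiffOn_const.mul (Complex.ofRealCLM.contDiff.comp_contDiffOn ?_))
  exact (contDiff_const.inner ℝ contDiff_id).contDiffOn.sub (contDiffOn_const.mul contDiffOn_norm)

lemma hasFDerivAt_ph (t : ℝ) (x : E3) {ξ : E3} (hξ : ξ ≠ 0) :
    HasFDerivAt (ph t x) ((innerSL ℝ x - t • (‖ξ‖⁻¹ • innerSL ℝ ξ) : E3 →L[ℝ] ℝ).smulRight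
      (Complex.I * ph t x ξ)) ξ := by
  have h1 : HasFDerivAt (fun ξ : E3 => inner ℝ x ξ - t * ‖ξ‖)
      (innerSL ℝ x - t • (‖ξ‖⁻¹ • innerSL ℝ ξ) : E3 →L[ℝ] ℝ) ξ :=
    (innerSL ℝ x).hasFDerivAt.sub ((hasFDerivAt_norm_of_ne hξ).const_mul t)
  have h2 := ((Complex.ofRealCLM.hasFDerivAt.comp ξ h1).const_mul Complex.I).cexp
  refine h2.congr_fderiv ?_
  ext v
  simp [ph]
  ring

lemma pd_ph (t : ℝ) (x : E3) {ξ : E3} (hξ : ξ ≠ 0) (j : Fin 3) :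
    pd j (ph t x) ξ = Complex.I * ((x j : ℂ) - t * om j ξ) * ph t x ξ := by
  rw [pd, (hasFDerivAt_ph t x hξ).fderiv]
  simp [inner_e, om, rinv]
  ring

lemma sum_sq_eq (ξ : E3) : ∑ j, (ξ j : ℂ) ^ 2 = (‖ξ‖ : ℂ) ^ 2 := by
  have := EuclideanSpace.real_norm_sq_eq ξ
  exact_mod_cast this.symm

lemma rinv_mul_norm {ξ : E3} (hξ : ξ ≠ 0) : rinv ξ * (‖ξ‖ : ℂ) = 1 := by
  have hne : (‖ξ‖ : ℂ) ≠ 0 := by exact_mod_cast norm_ne_zero_iff.2 hξ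
  simp [rinv, hne]

lemma sum_om_sq {ξ : E3} (hξ : ξ ≠ 0) : ∑ j, om j ξ * om j ξ = 1 := by
  have h1 : ∑ j, om j ξ * om j ξ = (rinv ξ) ^ 2 * ∑ j, (ξ j : ℂ) ^ 2 := by
    rw [Finset.mul_sum]; exact Finset.sum_congr rfl fun j _ => by simp only [om]; ring
  rw [h1, sum_sq_eq, ← mul_pow, rinv_mul_norm hξ, one_pow]

lemma differentiableAt_rinv {ξ : E3} (hξ : ξ ≠ 0) : DifferentiableAt ℝ rinv ξ :=
  (contDiffOn_rinv.contDiffAt (isOpen_compl_zero.mem_nhds hξ)).differentiableAt one_ne_zero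

lemma differentiableAt_om {ξ : E3} (hξ : ξ ≠ 0) (j : Fin 3) : DifferentiableAt ℝ (om j) ξ :=
  ((contDiffOn_om j).contDiffAt (isOpen_compl_zero.mem_nhds hξ)).differentiableAt one_ne_zero

lemma sum_pd_om {ξ : E3} (hξ : ξ ≠ 0) : ∑ j, pd j (om j) ξ = 2 * rinv ξ := by
  have h : ∀ j, pd j (om j) ξ = rinv ξ - rinv ξ * (om j ξ * om j ξ) := fun j => by
    rw [show om j = fun ξ : E3 => (ξ j : ℂ) * rinv ξ from rfl,
      pd_mul (hasFDerivAt_coord j ξ).differentiableAt (differentiableAt_rinv hξ), pd_coord,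
      pd_rinv hξ]
    simp only [om, if_true]; ring
  simp only [h, Finset.sum_sub_distrib, ← Finset.mul_sum, sum_om_sq hξ]
  simp
  ring

/-- The transpose, up to sign, of the field `(t ω + x)·∇_ξ`. -/
def confl (t : ℝ) (x : E3) (f : E3 → ℂ) (ξ : E3) : ℂ :=
  ∑ j, ((t : ℂ) * om j ξ + (x j : ℂ)) * pd j f ξ + (2 * t : ℂ) * (rinv ξ * f ξ)

lemma Away.confl (hf : Away f) (t : ℝ) (x : E3) : Away (confl t x f) := by
  refine hf.of_support fun ξ hξ => ?_
  by_contra h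
  refine hξ ?_
  have h1 : ∀ j, WaveDecay.pd j f ξ = 0 := fun j => by
    by_contra h'; exact h (support_pd_subset j h')
  simp [WaveDecay.confl, h1, image_eq_zero_of_notMem_tsupport h]

/-- The divergence of the compactly supported field ph·(tω + x)·f has integral zero. On the phase,
(x - tω)·(x + tω) = |x|² - t² because |ω| = 1; the divergence of tω is 2t/|ξ|, the zeroth-order term
of `confl`. -/
theorem integral_ph_confl (t : ℝ) (x : E3) (hf : Away f) (hs : ContDiffOn ℝ 1 f {0}ᶜ) :
    Complex.I * ((‖x‖ : ℂ) ^ 2 - (t : ℂ) ^ 2) * ∫ ξ, ph t x ξ * f ξ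
      = -∫ ξ, ph t x ξ * confl t x f ξ := by
  have hV : ∀ j, Away (fun ξ => (ph t x ξ * ((t : ℂ) * om j ξ + (x j : ℂ))) * f ξ) :=
    fun j => hf.mul_left _
  have hVs : ∀ j, ContDiff ℝ 1 (fun ξ => (ph t x ξ * ((t : ℂ) * om j ξ + (x j : ℂ))) * f ξ) :=
    fun j => (hV j).contDiff
      (((contDiffOn_ph t x).mul ((contDiffOn_const.mul (contDiffOn_om j)).add
        contDiffOn_const)).mul hs)
  have hsum : ∀ ξ, ∑ j, pd j (fun ξ => (ph t x ξ * ((t : ℂ) * om j ξ + (x j : ℂ))) * f ξ) ξ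
      = (Complex.I * ((‖x‖ : ℂ) ^ 2 - (t : ℂ) ^ 2)) * (ph t x ξ * f ξ)
        + ph t x ξ * confl t x f ξ := by
    intro ξ
    by_cases hξ : ξ = 0
    · subst hξ
      simp [((hV _).pd _).apply_zero, (hf.confl t x).apply_zero, hf.apply_zero]
    · have hfd : DifferentiableAt ℝ f ξ :=
        (hs.contDiffAt (isOpen_compl_zero.mem_nhds hξ)).differentiableAt one_ne_zero
      have hpd : DifferentiableAt ℝ (ph t x) ξ := (hasFDerivAt_ph t x hξ).differentiableAt
      have hod := differentiableAt_om hξ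
      have hcd : ∀ j, DifferentiableAt ℝ (fun ξ => (t : ℂ) * om j ξ + (x j : ℂ)) ξ :=
        fun j => ((hod j).const_mul _).add (differentiableAt_const _)
      have hc : ∀ j, pd j (fun ξ => (t : ℂ) * om j ξ + (x j : ℂ)) ξ = t * pd j (om j) ξ :=
        fun j => by
          rw [pd_add ((hod j).const_mul _) (differentiableAt_const _), pd_const_mul (hod j)]
          simp [pd]
      have h1 := sum_om_sq hξ
      have h2 := sum_pd_om hξ
      have h3 := sum_sq_eq x
      have hexp : ∀ j, pd j (fun ξ => (ph t x ξ * ((t : ℂ) * om j ξ + (x j : ℂ))) * f ξ) ξ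
          = (Complex.I * ((x j : ℂ) - t * om j ξ) * ph t x ξ * ((t : ℂ) * om j ξ + (x j : ℂ))
            + ph t x ξ * (t * pd j (om j) ξ)) * f ξ
            + ph t x ξ * ((t : ℂ) * om j ξ + (x j : ℂ)) * pd j f ξ := fun j => by
        rw [pd_mul (hpd.fun_mul (hcd j)) hfd, pd_mul hpd (hcd j), pd_ph t x hξ, hc]
      simp only [hexp, confl]
      simp only [Fin.sum_univ_three] at h1 h2 h3 ⊢
      linear_combination (Complex.I * ph t x ξ * f ξ) * h3
        - (Complex.I * ph t x ξ * f ξ * t ^ 2) * h1 + (ph t x ξ * t * f ξ) * h2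
  have hi1 : Integrable (fun ξ => ph t x ξ * f ξ) :=
    ((continuous_ph t x).mul (hf.contDiff hs).continuous).integrable_of_hasCompactSupport
      (hf.mul_left _).compact
  have hi0 : ∀ j, Integrable (pd j (fun ξ => (ph t x ξ * ((t : ℂ) * om j ξ + (x j : ℂ))) * f ξ)) :=
    fun j => (continuous_pd (hVs j) j).integrable_of_hasCompactSupport ((hV j).pd j).compact
  have hi2 : Integrable (fun ξ => ph t x ξ * confl t x f ξ) := by
    have h := (integrable_finsetSum Finset.univ fun j _ => hi0 j).sub
      (hi1.const_mul (Complex.I * ((‖x‖ : ℂ) ^ 2 - (t : ℂ) ^ 2)))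
    refine h.congr (Eventually.of_forall fun ξ => ?_)
    have := hsum ξ
    simp only [Pi.sub_apply]
    rw [this]; ring
  have h0 : ∫ ξ, ∑ j, pd j (fun ξ => (ph t x ξ * ((t : ℂ) * om j ξ + (x j : ℂ))) * f ξ) ξ = 0 := by
    rw [integral_finsetSum _ fun j _ => hi0 j]
    exact Finset.sum_eq_zero fun j _ => integral_pd_eq_zero (hVs j) (hV j).compact j
  simp only [hsum] at h0
  rw [integral_add (hi1.const_mul _) hi2, integral_const_mul] at h0
  linear_combination h0

end

/-! ### Weights controlled on dyadic annuli -/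

section
/-- A weight whose integral over the annulus at scale `R` is at most `C R²`. -/
def Ann (w : E3 → ℝ≥0∞) (C : ℝ≥0) : Prop :=
  ∀ R : ℝ, 0 < R → ∫⁻ ξ in {ξ | R ≤ ‖ξ‖ ∧ ‖ξ‖ ≤ 2 * R}, w ξ ≤ C * ENNReal.ofReal (R ^ 2)

lemma measurableSet_annulus (R S : ℝ) : MeasurableSet {ξ : E3 | R ≤ ‖ξ‖ ∧ ‖ξ‖ ≤ S} :=
  (measurableSet_le measurable_const measurable_norm).inter
    (measurableSet_le measurable_norm measurable_const)

lemma lintegral_annulus_le {w : E3 → ℝ≥0∞} {C : ℝ≥0} (hw : Ann w C) {h : E3 → ℝ} {R K S : ℝ}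
    (hR : 0 < R) (hh : ∀ ξ, R ≤ ‖ξ‖ → h ξ ≤ K) (hS : K * R ^ 2 ≤ S) :
    ∫⁻ ξ in {ξ | R ≤ ‖ξ‖ ∧ ‖ξ‖ ≤ 2 * R}, w ξ * ENNReal.ofReal (h ξ) ≤ C * ENNReal.ofReal S := by
  calc _ ≤ ∫⁻ ξ in {ξ | R ≤ ‖ξ‖ ∧ ‖ξ‖ ≤ 2 * R}, w ξ * ENNReal.ofReal K :=
        setLIntegral_mono' (measurableSet_annulus _ _) fun ξ hξ => by
          gcongr; exact hh ξ hξ.1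
    _ = (∫⁻ ξ in {ξ | R ≤ ‖ξ‖ ∧ ‖ξ‖ ≤ 2 * R}, w ξ) * ENNReal.ofReal K :=
        lintegral_mul_const' _ _ ENNReal.ofReal_ne_top
    _ ≤ C * ENNReal.ofReal (R ^ 2) * ENNReal.ofReal K := by gcongr; exact hw R hR
    _ = C * ENNReal.ofReal (K * R ^ 2) := by
        rw [mul_assoc, ← ENNReal.ofReal_mul (by positivity), mul_comm K]
    _ ≤ _ := by gcongr

lemma tsum_half_le (C : ℝ≥0) {a : ℝ} (ha : 0 ≤ a) :
    ∑' n : ℕ, (C : ℝ≥0∞) * ENNReal.ofReal (a / 2 / 2 ^ n) = C * ENNReal.ofReal a := by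
  rw [ENNReal.tsum_mul_left, ← ENNReal.ofReal_tsum_of_nonneg (fun n => by positivity)
    (summable_geometric_two' a), tsum_geometric_two']

/-- At scale R the integral is at most C R⁻¹ R² = C R, and the scales ρ/2^(n+1) add up to ρ. -/
lemma Ann.low {w : E3 → ℝ≥0∞} {C : ℝ≥0} (hw : Ann w C) {ρ : ℝ} (hρ : 0 < ρ) :
    ∫⁻ ξ in {ξ | ξ ≠ 0 ∧ ‖ξ‖ < ρ}, w ξ * ENNReal.ofReal (‖ξ‖ ^ (-1 : ℤ))
      ≤ C * ENNReal.ofReal ρ := by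
  have hsub : {ξ : E3 | ξ ≠ 0 ∧ ‖ξ‖ < ρ}
      ⊆ ⋃ n : ℕ, {ξ | ρ / 2 / 2 ^ n ≤ ‖ξ‖ ∧ ‖ξ‖ ≤ 2 * (ρ / 2 / 2 ^ n)} := by
    rintro ξ ⟨h0, h1⟩
    have hpos : 0 < ‖ξ‖ := norm_pos_iff.2 h0
    obtain ⟨n, hn1, hn2⟩ := exists_nat_pow_near (x := ρ / ‖ξ‖) (y := 2)
      ((one_le_div hpos).2 h1.le) (by norm_num)
    refine Set.mem_iUnion.2 ⟨n, ?_, ?_⟩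
    · rw [div_lt_iff₀ hpos, pow_succ] at hn2
      rw [div_div, div_le_iff₀ (by positivity)]; linarith
    · rw [le_div_iff₀ hpos] at hn1
      rw [show 2 * (ρ / 2 / 2 ^ n) = ρ / 2 ^ n by ring, le_div_iff₀ (by positivity)]; linarith
  calc _ ≤ ∫⁻ ξ in ⋃ n : ℕ, {ξ | ρ / 2 / 2 ^ n ≤ ‖ξ‖ ∧ ‖ξ‖ ≤ 2 * (ρ / 2 / 2 ^ n)},
          w ξ * ENNReal.ofReal (‖ξ‖ ^ (-1 : ℤ)) := lintegral_mono_set hsub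
    _ ≤ ∑' n : ℕ, ∫⁻ ξ in {ξ | ρ / 2 / 2 ^ n ≤ ‖ξ‖ ∧ ‖ξ‖ ≤ 2 * (ρ / 2 / 2 ^ n)},
          w ξ * ENNReal.ofReal (‖ξ‖ ^ (-1 : ℤ)) := lintegral_iUnion_le _ _
    _ ≤ ∑' n : ℕ, C * ENNReal.ofReal (ρ / 2 / 2 ^ n) := by
        refine ENNReal.tsum_le_tsum fun n => ?_
        have hR : 0 < ρ / 2 / 2 ^ n := by positivity
        refine lintegral_annulus_le hw hR (K := (ρ / 2 / 2 ^ n)⁻¹)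
          (fun ξ hξ => ?_) (le_of_eq (by field_simp))
        rw [zpow_neg, zpow_one]; gcongr
    _ = _ := tsum_half_le C hρ.le

/-- At scale R the integral is at most C R⁻³ R² = C/R, and the inverse scales 1/(ρ 2^n) add up to
2/ρ. -/
lemma Ann.high {w : E3 → ℝ≥0∞} {C : ℝ≥0} (hw : Ann w C) {ρ : ℝ} (hρ : 0 < ρ) :
    ∫⁻ ξ in {ξ | ρ ≤ ‖ξ‖}, w ξ * ENNReal.ofReal (‖ξ‖ ^ (-3 : ℤ))
      ≤ C * ENNReal.ofReal (2 / ρ) := by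
  have hsub : {ξ : E3 | ρ ≤ ‖ξ‖}
      ⊆ ⋃ n : ℕ, {ξ | ρ * 2 ^ n ≤ ‖ξ‖ ∧ ‖ξ‖ ≤ 2 * (ρ * 2 ^ n)} := by
    rintro ξ (h1 : ρ ≤ ‖ξ‖)
    obtain ⟨n, hn1, hn2⟩ := exists_nat_pow_near (x := ‖ξ‖ / ρ) (y := 2)
      ((one_le_div hρ).2 h1) (by norm_num)
    refine Set.mem_iUnion.2 ⟨n, ?_, ?_⟩
    · rw [le_div_iff₀ hρ] at hn1; linarith
    · rw [div_lt_iff₀ hρ, pow_succ] at hn2; linarith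
  calc _ ≤ ∫⁻ ξ in ⋃ n : ℕ, {ξ | ρ * 2 ^ n ≤ ‖ξ‖ ∧ ‖ξ‖ ≤ 2 * (ρ * 2 ^ n)},
          w ξ * ENNReal.ofReal (‖ξ‖ ^ (-3 : ℤ)) := lintegral_mono_set hsub
    _ ≤ ∑' n : ℕ, ∫⁻ ξ in {ξ | ρ * 2 ^ n ≤ ‖ξ‖ ∧ ‖ξ‖ ≤ 2 * (ρ * 2 ^ n)},
          w ξ * ENNReal.ofReal (‖ξ‖ ^ (-3 : ℤ)) := lintegral_iUnion_le _ _
    _ ≤ ∑' n : ℕ, C * ENNReal.ofReal (2 / ρ / 2 / 2 ^ n) := by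
        refine ENNReal.tsum_le_tsum fun n => ?_
        have hR : 0 < ρ * 2 ^ n := by positivity
        refine lintegral_annulus_le hw hR (K := ((ρ * 2 ^ n) ^ 3)⁻¹)
          (fun ξ hξ => ?_) (le_of_eq (by field_simp))
        rw [zpow_neg]
        exact inv_anti₀ (by positivity) (by exact_mod_cast pow_le_pow_left₀ hR.le hξ 3)
    _ = _ := tsum_half_le C (by positivity)

/-- The annulus has volume O(R³). This is the trivial weight, which replaces the dispersive one when
no factor |x| is wanted. -/
lemma exists_ann_rinv : ∃ C, Ann (fun ξ : E3 => ENNReal.ofReal (‖ξ‖ ^ (-1 : ℤ))) C := by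
  have hv : volume (Metric.ball (0 : E3) 1) ≠ ⊤ := measure_ball_lt_top.ne
  refine ⟨8 * (volume (Metric.ball (0 : E3) 1)).toNNReal, fun R hR => ?_⟩
  calc _ ≤ ∫⁻ ξ in {ξ : E3 | R ≤ ‖ξ‖ ∧ ‖ξ‖ ≤ 2 * R}, ENNReal.ofReal R⁻¹ :=
        setLIntegral_mono' (measurableSet_annulus _ _) fun ξ hξ => by
          rw [zpow_neg, zpow_one]; gcongr; exact hξ.1
    _ = ENNReal.ofReal R⁻¹ * volume {ξ : E3 | R ≤ ‖ξ‖ ∧ ‖ξ‖ ≤ 2 * R} := by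
        rw [setLIntegral_const]
    _ ≤ ENNReal.ofReal R⁻¹ * volume (Metric.closedBall (0 : E3) (2 * R)) := by
        gcongr; intro ξ hξ; simpa using hξ.2
    _ = _ := by
        rw [Measure.addHaar_closedBall _ _ (by positivity), ← mul_assoc,
          ← ENNReal.ofReal_mul (by positivity), finrank_euclideanSpace_fin]
        push_cast
        rw [ENNReal.coe_toNNReal hv,
          show R⁻¹ * (2 * R) ^ 3 = 8 * R ^ 2 by field_simp; norm_num,
          ENNReal.ofReal_mul (by norm_num)]
        norm_num
        ring

/-- Tonelli in the three coordinates. The coordinate hyperplanes, a null set, are exempted because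
the factor |a|^(-1/2) used below takes the junk value 0 at a = 0. -/
lemma lintegral_le_prod {g : E3 → ℝ≥0∞} {k : Fin 3 → ℝ → ℝ} (hk : ∀ i a, 0 ≤ k i a)
    (hi : ∀ i, Integrable (k i)) (h : ∀ ξ : E3, (∀ i, ξ i ≠ 0) →
      g ξ ≤ ENNReal.ofReal (∏ i, k i (ξ i))) :
    ∫⁻ ξ, g ξ ≤ ENNReal.ofReal (∏ i, ∫ a, k i a) := by
  have hmp := PiLp.volume_preserving_toLp (Fin 3)
  have he : MeasurableEmbedding (@WithLp.toLp 2 (Fin 3 → ℝ)) :=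
    (MeasurableEquiv.toLp 2 (Fin 3 → ℝ)).measurableEmbedding
  rw [← hmp.lintegral_comp_emb he, ← integral_fintype_prod_volume_eq_prod,
    ofReal_integral_eq_lintegral_ofReal (μ := (volume : Measure (Fin 3 → ℝ)))
      (Integrable.fintype_prod hi)
      (Eventually.of_forall fun y => Finset.prod_nonneg fun i _ => hk i _)]
  refine lintegral_mono_ae ?_
  have hne : ∀ i : Fin 3, ∀ᵐ y : Fin 3 → ℝ, y i ≠ 0 := fun i => by
    rw [ae_iff]
    simp only [ne_eq, not_not]
    exact Measure.pi_hyperplane (fun _ : Fin 3 => (volume : Measure ℝ)) i 0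
  filter_upwards [ae_all_iff.2 hne] with y hy
  exact h _ hy

lemma integrable_cauchy {η : ℝ} (hη : 0 < η) :
    Integrable (fun a : ℝ => η / (a ^ 2 + η)) ∧ ∫ a : ℝ, η / (a ^ 2 + η) = Real.pi * √η := by
  have hs : 0 < √η := Real.sqrt_pos.2 hη
  have h : (fun a : ℝ => η / (a ^ 2 + η)) = fun a => (1 + (a / √η) ^ 2)⁻¹ := by
    ext a
    rw [div_pow, Real.sq_sqrt hη.le]
    field_simp
    ring
  rw [h]
  refine ⟨integrable_inv_one_add_sq.comp_div hs.ne', ?_⟩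
  rw [Measure.integral_comp_div (fun a => (1 + a ^ 2)⁻¹), integral_univ_inv_one_add_sq,
    abs_of_pos hs, smul_eq_mul, mul_comm]

lemma integrable_abs_rpow {L : ℝ} (hL : 0 < L) :
    Integrable (Set.indicator (Set.Icc (-L) L) fun a : ℝ => |a| ^ (-(1 / 2) : ℝ)) ∧
      ∫ a, Set.indicator (Set.Icc (-L) L) (fun a : ℝ => |a| ^ (-(1 / 2) : ℝ)) a = 4 * √L := by
  have hmem : ∀ a : ℝ, Set.indicator (Set.Icc (-L) L) (fun a : ℝ => |a| ^ (-(1 / 2) : ℝ)) a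
      = (fun b => Set.indicator (Set.Iic L) (fun b : ℝ => b ^ (-(1 / 2) : ℝ)) b) |a| := fun a => by
    simp only [Set.indicator, Set.mem_Icc, Set.mem_Iic, abs_le]
  have hint : ∫ a, Set.indicator (Set.Icc (-L) L) (fun a : ℝ => |a| ^ (-(1 / 2) : ℝ)) a
      = 4 * √L := by
    simp only [hmem]
    rw [integral_comp_abs (f := fun b => Set.indicator (Set.Iic L)
      (fun b : ℝ => b ^ (-(1 / 2) : ℝ)) b), setIntegral_indicator measurableSet_Iic,
      Set.Ioi_inter_Iic, ← intervalIntegral.integral_of_le hL.le,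
      integral_rpow (Or.inl (by norm_num)), Real.sqrt_eq_rpow]
    norm_num
    ring
  -- A non-integrable function has integral 0 by convention, so the positive value just computed
  -- forces integrability.
  refine ⟨by_contra fun h => ?_, hint⟩
  rw [integral_undef h] at hint
  have := Real.sqrt_pos.2 hL
  linarith

end

/-! ### The weight of the dispersive estimate -/

section
/-- The squared distance to the first coordinate axis. -/
def axd (ξ : E3) : ℝ := ξ 1 ^ 2 + ξ 2 ^ 2

/-- The weight of the dispersive estimate at a point at distance `X` on the first axis. -/
def wt (X : ℝ) (ξ : E3) : ℝ :=
  3 * X * (‖ξ‖ ^ 2 / X ^ 2 / (axd ξ ^ 2 + ‖ξ‖ ^ 2 / X ^ 2))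
    + √(axd ξ) * axd ξ / (axd ξ ^ 2 + ‖ξ‖ ^ 2 / X ^ 2)

lemma axd_nonneg (ξ : E3) : 0 ≤ axd ξ := by unfold axd; positivity

@[fun_prop]
lemma continuous_axd : Continuous axd := by unfold axd; fun_prop

/-- On the annulus |ξ|²/X² ≤ η² with η = 2R/X, the quotient increases with this quantity, and (a² +
η)(b² + η) ≤ 2((a² + b²)² + η²). The result is a product of two Cauchy kernels, each with integral
π√η. -/
lemma wt_fst_le {X R : ℝ} (hX : 0 < X) {ξ : E3} (hR : 0 < R) (h1 : R ≤ ‖ξ‖) (h2 : ‖ξ‖ ≤ 2 * R) :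
    ‖ξ‖ ^ 2 / X ^ 2 / (axd ξ ^ 2 + ‖ξ‖ ^ 2 / X ^ 2)
      ≤ 2 * ((2 * R / X) / (ξ 1 ^ 2 + 2 * R / X)) * ((2 * R / X) / (ξ 2 ^ 2 + 2 * R / X)) := by
  set η := 2 * R / X with hη
  have hη0 : 0 < η := by positivity
  set E := ‖ξ‖ ^ 2 / X ^ 2 with hE
  have hE0 : 0 < E := by have : 0 < ‖ξ‖ := hR.trans_le h1; positivity
  have hEη : E ≤ η ^ 2 := by
    rw [hE, hη, div_pow]; gcongr
  have hs := axd_nonneg ξ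
  calc E / (axd ξ ^ 2 + E) ≤ η ^ 2 / (axd ξ ^ 2 + η ^ 2) := by
        rw [div_le_div_iff₀ (by positivity) (by positivity)]
        nlinarith [sq_nonneg (axd ξ)]
    _ ≤ 2 * η ^ 2 / ((ξ 1 ^ 2 + η) * (ξ 2 ^ 2 + η)) := by
        rw [div_le_div_iff₀ (by positivity) (by positivity)]
        have : (ξ 1 ^ 2 + η) * (ξ 2 ^ 2 + η) ≤ 2 * (axd ξ ^ 2 + η ^ 2) := by
          unfold axd
          nlinarith [sq_nonneg (ξ 1 ^ 2 - ξ 2 ^ 2), sq_nonneg (ξ 1 ^ 2 + ξ 2 ^ 2 - η),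
            sq_nonneg (ξ 1), sq_nonneg (ξ 2), sq_nonneg (ξ 1 ^ 2 + ξ 2 ^ 2)]
        nlinarith [sq_nonneg η]
    _ = _ := by field_simp

/-- The left side is at most s^(-1/2) with s = ξ₁² + ξ₂², and |ξ₁||ξ₂| ≤ s separates the variables
into integrable factors. -/
lemma wt_snd_le {E : ℝ} (hE : 0 ≤ E) {ξ : E3} (h1 : ξ 1 ≠ 0) (h2 : ξ 2 ≠ 0) :
    √(axd ξ) * axd ξ / (axd ξ ^ 2 + E) ≤ |ξ 1| ^ (-(1 / 2) : ℝ) * |ξ 2| ^ (-(1 / 2) : ℝ) := by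
  have hp : 0 < |ξ 1| * |ξ 2| := by positivity
  have hle : |ξ 1| * |ξ 2| ≤ axd ξ := by
    unfold axd
    nlinarith [sq_nonneg (|ξ 1| - |ξ 2|), sq_abs (ξ 1), sq_abs (ξ 2)]
  have hs : 0 < axd ξ := hp.trans_le hle
  rw [← Real.mul_rpow (abs_nonneg _) (abs_nonneg _), Real.rpow_neg hp.le, ← Real.sqrt_eq_rpow]
  calc √(axd ξ) * axd ξ / (axd ξ ^ 2 + E) ≤ √(axd ξ) * axd ξ / axd ξ ^ 2 := by
        gcongr; linarith
    _ = (√(axd ξ))⁻¹ := by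
        have h := Real.mul_self_sqrt hs.le
        have hq := Real.sqrt_pos.2 hs
        rw [div_eq_iff (by positivity), eq_comm, inv_mul_eq_iff_eq_mul₀ hq.ne']
        nlinarith
    _ ≤ _ := by gcongr

lemma integral_indicator_const (L : ℝ) (c : ℝ) (hL : 0 ≤ L) :
    Integrable (Set.indicator (Set.Icc (-L) L) fun _ : ℝ => c) ∧
      ∫ a, Set.indicator (Set.Icc (-L) L) (fun _ : ℝ => c) a = 2 * L * c := by
  refine ⟨(integrable_indicator_iff measurableSet_Icc).2 (integrableOn_const (by simp)), ?_⟩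
  rw [integral_indicator measurableSet_Icc, setIntegral_const, Real.volume_real_Icc_of_le
    (by linarith), smul_eq_mul]
  ring

lemma abs_apply_le (ξ : E3) (i : Fin 3) : |ξ i| ≤ ‖ξ‖ := PiLp.norm_apply_le ξ i

/-- The first part of the weight has size X on a tube of length R and cross-section R/X about the
axis. The second is at most the inverse distance to the axis. Both integrate to O(R²) whatever X is.
-/
lemma exists_ann_wt : ∃ C, ∀ X > 0, Ann (fun ξ => ENNReal.ofReal (wt X ξ)) C := by
  -- The first part gives 4R·6X·π²·(2R/X) = 48π²R², the second 4R·(4√(2R))² = 128R².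
  refine ⟨(48 * Real.pi ^ 2 + 128).toNNReal, fun X hX R hR => ?_⟩
  set S := {ξ : E3 | R ≤ ‖ξ‖ ∧ ‖ξ‖ ≤ 2 * R} with hS
  have hSm : MeasurableSet S := measurableSet_annulus _ _
  have hη0 : 0 < 2 * R / X := by positivity
  have hmem : ∀ ξ ∈ S, ∀ i, ξ i ∈ Set.Icc (-(2 * R)) (2 * R) := fun ξ hξ i =>
    abs_le.1 ((abs_apply_le ξ i).trans hξ.2)
  have hmeas : Measurable fun ξ : E3 => ENNReal.ofReal
      (3 * X * (‖ξ‖ ^ 2 / X ^ 2 / (axd ξ ^ 2 + ‖ξ‖ ^ 2 / X ^ 2))) := by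
    have := continuous_axd.measurable
    fun_prop
  obtain ⟨hc1, hc2⟩ := integrable_cauchy hη0
  obtain ⟨ha1, ha2⟩ := integrable_abs_rpow (L := 2 * R) (by positivity)
  obtain ⟨hb1, hb2⟩ := integral_indicator_const (2 * R) (6 * X) (by positivity)
  obtain ⟨hd1, hd2⟩ := integral_indicator_const (2 * R) 1 (by positivity)
  have hfst : ∫⁻ ξ in S, ENNReal.ofReal (3 * X * (‖ξ‖ ^ 2 / X ^ 2 / (axd ξ ^ 2 + ‖ξ‖ ^ 2 / X ^ 2)))
      ≤ ENNReal.ofReal (48 * Real.pi ^ 2 * R ^ 2) := by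
    rw [← lintegral_indicator hSm]
    refine (lintegral_le_prod
      (k := ![Set.indicator (Set.Icc (-(2 * R)) (2 * R)) fun _ : ℝ => 6 * X,
        fun a => (2 * R / X) / (a ^ 2 + 2 * R / X), fun a => (2 * R / X) / (a ^ 2 + 2 * R / X)])
      ?_ ?_ ?_).trans_eq ?_
    · intro i a
      have h0 : 0 ≤ Set.indicator (Set.Icc (-(2 * R)) (2 * R)) (fun _ : ℝ => 6 * X) a :=
        Set.indicator_nonneg (fun _ _ => by positivity) a
      have h1 : 0 ≤ (2 * R / X) / (a ^ 2 + 2 * R / X) := by positivity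
      fin_cases i
      exacts [h0, h1, h1]
    · intro i
      fin_cases i
      exacts [hb1, hc1, hc1]
    · intro ξ _
      by_cases hξ : ξ ∈ S
      · rw [Set.indicator_of_mem hξ]
        refine ENNReal.ofReal_le_ofReal ?_
        simp only [Fin.prod_univ_three, Matrix.cons_val_zero, Matrix.cons_val_one,
          Matrix.cons_val]
        rw [Set.indicator_of_mem (hmem ξ hξ 0)]
        nlinarith [mul_le_mul_of_nonneg_left (wt_fst_le hX hR hξ.1 hξ.2)
          (show 0 ≤ 3 * X by positivity)]
      · rw [Set.indicator_of_notMem hξ]; exact zero_le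
    · simp only [Fin.prod_univ_three, Matrix.cons_val_zero, Matrix.cons_val_one,
          Matrix.cons_val]
      rw [hb2, hc2]
      congr 1
      have := Real.mul_self_sqrt hη0.le
      calc _ = 24 * R * X * Real.pi ^ 2 * (√(2 * R / X) * √(2 * R / X)) := by ring
        _ = _ := by rw [this]; field_simp; ring
  have hsnd : ∫⁻ ξ in S, ENNReal.ofReal (√(axd ξ) * axd ξ / (axd ξ ^ 2 + ‖ξ‖ ^ 2 / X ^ 2))
      ≤ ENNReal.ofReal (128 * R ^ 2) := by
    rw [← lintegral_indicator hSm]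
    refine (lintegral_le_prod
      (k := ![Set.indicator (Set.Icc (-(2 * R)) (2 * R)) fun _ : ℝ => 1,
        Set.indicator (Set.Icc (-(2 * R)) (2 * R)) fun a : ℝ => |a| ^ (-(1 / 2) : ℝ),
        Set.indicator (Set.Icc (-(2 * R)) (2 * R)) fun a : ℝ => |a| ^ (-(1 / 2) : ℝ)])
      ?_ ?_ ?_).trans_eq ?_
    · intro i a
      have h0 : 0 ≤ Set.indicator (Set.Icc (-(2 * R)) (2 * R)) (fun _ : ℝ => (1 : ℝ)) a :=
        Set.indicator_nonneg (fun _ _ => by positivity) a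
      have h1 : 0 ≤ Set.indicator (Set.Icc (-(2 * R)) (2 * R))
          (fun a : ℝ => |a| ^ (-(1 / 2) : ℝ)) a :=
        Set.indicator_nonneg (fun _ _ => by positivity) a
      fin_cases i
      exacts [h0, h1, h1]
    · intro i
      fin_cases i
      exacts [hd1, ha1, ha1]
    · intro ξ h0
      by_cases hξ : ξ ∈ S
      · rw [Set.indicator_of_mem hξ]
        refine ENNReal.ofReal_le_ofReal ?_
        simp only [Fin.prod_univ_three, Matrix.cons_val_zero, Matrix.cons_val_one,
          Matrix.cons_val]
        rw [Set.indicator_of_mem (hmem ξ hξ 0), Set.indicator_of_mem (hmem ξ hξ 1),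
          Set.indicator_of_mem (hmem ξ hξ 2), one_mul]
        exact wt_snd_le (by positivity) (h0 1) (h0 2)
      · rw [Set.indicator_of_notMem hξ]; exact zero_le
    · simp only [Fin.prod_univ_three, Matrix.cons_val_zero, Matrix.cons_val_one,
          Matrix.cons_val]
      rw [hd2, ha2]
      congr 1
      have := Real.mul_self_sqrt (show 0 ≤ 2 * R by positivity)
      calc _ = 64 * R * (√(2 * R) * √(2 * R)) := by ring
        _ = _ := by rw [this]; ring
  calc _ ≤ ∫⁻ ξ in S, (ENNReal.ofReal
            (3 * X * (‖ξ‖ ^ 2 / X ^ 2 / (axd ξ ^ 2 + ‖ξ‖ ^ 2 / X ^ 2)))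
          + ENNReal.ofReal (√(axd ξ) * axd ξ / (axd ξ ^ 2 + ‖ξ‖ ^ 2 / X ^ 2))) :=
        lintegral_mono fun ξ => ENNReal.ofReal_add_le
    _ ≤ ENNReal.ofReal (48 * Real.pi ^ 2 * R ^ 2) + ENNReal.ofReal (128 * R ^ 2) := by
        rw [lintegral_add_left hmeas]; exact add_le_add hfst hsnd
    _ = _ := by
        rw [← ENNReal.ofReal_add (by positivity) (by positivity), ← add_mul,
          ENNReal.ofReal_mul (by positivity)]
        rfl

end

/-! ### Integration by parts along rotations -/

section
variable {f g G : E3 → ℂ}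

lemma rot_radial {h : ℝ → ℂ} {h' : ℂ} {ξ : E3} (hξ : ξ ≠ 0) (hh : HasDerivAt h h' ‖ξ‖)
    (i : Fin 3) : rot i (fun ξ : E3 => h ‖ξ‖) ξ = 0 := by
  simp only [rot, pd_radial hξ hh, om]; ring

lemma rot_inv {ξ : E3} (hf : DifferentiableAt ℝ f ξ) (h0 : f ξ ≠ 0) (i : Fin 3) :
    rot i (fun ξ => (f ξ)⁻¹) ξ = -(rot i f ξ / f ξ ^ 2) := by
  have h : ∀ j, pd j (fun ξ => (f ξ)⁻¹) ξ = -(pd j f ξ / f ξ ^ 2) := fun j => by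
    have h2 : HasFDerivAt (fun ξ => (f ξ)⁻¹)
      ((ContinuousLinearMap.toSpanSingleton ℂ (-(f ξ ^ 2)⁻¹) : ℂ →L[ℂ] ℂ).restrictScalars ℝ ∘L
        fderiv ℝ f ξ) ξ :=
      ((hasDerivAt_inv h0).hasFDerivAt.restrictScalars ℝ).comp ξ hf.hasFDerivAt
    rw [pd, h2.fderiv]
    simp [pd, div_eq_mul_inv]
  simp only [rot, h]; ring

lemma rot_coord (i a : Fin 3) (ξ : E3) : rot i (fun ξ => (ξ a : ℂ)) ξ
    = (if a = i + 2 then (ξ (i + 1) : ℂ) else 0) - if a = i + 1 then (ξ (i + 2) : ℂ) else 0 := by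
  simp only [rot, pd_coord]; split_ifs <;> ring

lemma rot_ph (t : ℝ) (x : E3) {ξ : E3} (hξ : ξ ≠ 0) (i : Fin 3) :
    rot i (ph t x) ξ
      = Complex.I * ((ξ (i + 1) : ℂ) * x (i + 2) - ξ (i + 2) * x (i + 1)) * ph t x ξ := by
  simp only [rot, pd_ph t x hξ, om]; ring

lemma continuous_rot (hf : ContDiff ℝ 1 f) (i : Fin 3) : Continuous (rot i f) :=
  ((contDiff_coord (k := 1) _).continuous.mul (continuous_pd hf _)).sub
    ((contDiff_coord (k := 1) _).continuous.mul (continuous_pd hf _))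

lemma Away.rot (hf : Away f) (i : Fin 3) : Away (rot i f) := by
  refine hf.of_support fun ξ hξ => ?_
  by_contra h
  have h1 : ∀ j, WaveDecay.pd j f ξ = 0 := fun j => by
    by_contra h'; exact h (support_pd_subset j h')
  exact hξ (by simp [WaveDecay.rot, h1])

lemma integral_rot_eq_zero (hs : ContDiff ℝ 1 f) (hc : HasCompactSupport f) (i : Fin 3) :
    ∫ ξ, rot i f ξ = 0 := by
  have h1 : ∀ a, ContDiff ℝ 1 (fun ξ : E3 => (ξ a : ℂ) * f ξ) := fun a => (contDiff_coord a).mul hs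
  have h2 : ∀ a, HasCompactSupport (fun ξ : E3 => (ξ a : ℂ) * f ξ) := fun a => hc.mul_left
  have h3 : ∀ a j, Integrable (pd j (fun ξ : E3 => (ξ a : ℂ) * f ξ)) := fun a j =>
    (continuous_pd (h1 a) j).integrable_of_hasCompactSupport
      ((h2 a).of_isClosed_subset (isClosed_tsupport _)
        (closure_minimal (support_pd_subset j) (isClosed_tsupport _)))
  have h4 : rot i f = fun ξ => pd (i + 2) (fun ξ : E3 => (ξ (i + 1) : ℂ) * f ξ) ξ
      - pd (i + 1) (fun ξ : E3 => (ξ (i + 2) : ℂ) * f ξ) ξ := by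
    ext ξ
    have hd := hs.differentiable one_ne_zero ξ
    rw [pd_mul (hasFDerivAt_coord _ ξ).differentiableAt hd,
      pd_mul (hasFDerivAt_coord _ ξ).differentiableAt hd, pd_coord, pd_coord, rot]
    have h1 : i + 1 ≠ i + 2 := by fin_cases i <;> decide
    rw [if_neg h1, if_neg h1.symm]; ring
  rw [h4, integral_sub (h3 _ _) (h3 _ _), integral_pd_eq_zero (h1 _) (h2 _),
    integral_pd_eq_zero (h1 _) (h2 _), sub_zero]

/-- The coefficient `s/(s²+E)` with `s = ξ₁²+ξ₂²`, `E = |ξ|²/X²`. -/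
def coef (X : ℝ) (ξ : E3) : ℝ := axd ξ / (axd ξ ^ 2 + ‖ξ‖ ^ 2 / X ^ 2)

lemma denom_pos {X : ℝ} (hX : 0 < X) {ξ : E3} (hξ : ξ ≠ 0) :
    0 < axd ξ ^ 2 + ‖ξ‖ ^ 2 / X ^ 2 := by
  have := norm_pos_iff.2 hξ
  positivity

lemma contDiff_axd {k : WithTop ℕ∞} : ContDiff ℝ k axd := by
  have h : ∀ a : Fin 3, ContDiff ℝ k (fun ξ : E3 => ξ a) :=
    fun a => (EuclideanSpace.proj a : E3 →L[ℝ] ℝ).contDiff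
  exact ((h 1).pow 2).add ((h 2).pow 2)

lemma contDiffOn_coef {k : WithTop ℕ∞} {X : ℝ} (hX : 0 < X) : ContDiffOn ℝ k (coef X) {0}ᶜ :=
  contDiff_axd.contDiffOn.div ((contDiff_axd.pow 2).contDiffOn.add
    (((contDiffOn_norm (k := k)).pow 2).div_const _)) fun _ hξ => (denom_pos hX hξ).ne'

lemma rot_axd (i : Fin 3) (ξ : E3) : rot i (fun ξ => (axd ξ : ℂ)) ξ
    = 2 * ξ 1 * rot i (fun ξ => (ξ 1 : ℂ)) ξ + 2 * ξ 2 * rot i (fun ξ => (ξ 2 : ℂ)) ξ := by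
  have hd : ∀ a, DifferentiableAt ℝ (fun ξ : E3 => (ξ a : ℂ)) ξ :=
    fun a => (hasFDerivAt_coord a ξ).differentiableAt
  have : (fun ξ => (axd ξ : ℂ)) = fun ξ : E3 => (ξ 1 : ℂ) * ξ 1 + (ξ 2 : ℂ) * ξ 2 := by
    ext ξ; simp only [axd]; push_cast; ring
  rw [this, rot_add ((hd 1).fun_mul (hd 1)) ((hd 2).fun_mul (hd 2)), rot_mul (hd 1) (hd 1),
    rot_mul (hd 2) (hd 2)]
  ring

lemma rot_coef {X : ℝ} (hX : 0 < X) {ξ : E3} (hξ : ξ ≠ 0) (i : Fin 3) :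
    rot i (fun ξ => (coef X ξ : ℂ)) ξ = rot i (fun ξ => (axd ξ : ℂ)) ξ
      * ((‖ξ‖ ^ 2 / X ^ 2 - axd ξ ^ 2) / (axd ξ ^ 2 + ‖ξ‖ ^ 2 / X ^ 2) ^ 2) := by
  have hs : DifferentiableAt ℝ (fun ξ => (axd ξ : ℂ)) ξ :=
    (Complex.ofRealCLM.contDiff.comp (contDiff_axd (k := 1))).differentiable one_ne_zero ξ
  have hr0 : HasDerivAt (fun s : ℝ => ((s ^ 2 / X ^ 2 : ℝ) : ℂ))
      (((2 : ℕ) * ‖ξ‖ ^ (2 - 1) / X ^ 2 : ℝ) : ℂ) ‖ξ‖ :=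
    ((hasDerivAt_pow 2 ‖ξ‖).div_const _).ofReal_comp
  have hr : DifferentiableAt ℝ (fun ξ : E3 => ((‖ξ‖ ^ 2 / X ^ 2 : ℝ) : ℂ)) ξ :=
    (hasFDerivAt_radial hξ hr0).differentiableAt
  have hD : DifferentiableAt ℝ (fun ξ => (axd ξ : ℂ) * axd ξ + ((‖ξ‖ ^ 2 / X ^ 2 : ℝ) : ℂ)) ξ :=
    (hs.fun_mul hs).fun_add hr
  have hne' : ((axd ξ ^ 2 + ‖ξ‖ ^ 2 / X ^ 2 : ℝ) : ℂ) ≠ 0 := by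
    exact_mod_cast (denom_pos hX hξ).ne'
  have hne : (axd ξ : ℂ) * axd ξ + ((‖ξ‖ ^ 2 / X ^ 2 : ℝ) : ℂ) ≠ 0 := by
    rw [← sq]; exact_mod_cast hne'
  have hq : (fun ξ => (coef X ξ : ℂ))
      = fun ξ => (axd ξ : ℂ) * ((axd ξ : ℂ) * axd ξ + ((‖ξ‖ ^ 2 / X ^ 2 : ℝ) : ℂ))⁻¹ := by
    ext ξ; simp only [coef]; push_cast; rw [div_eq_mul_inv, sq (axd ξ : ℂ)]
  rw [hq, rot_mul hs (hD.fun_inv hne), rot_inv hD hne, rot_add (hs.fun_mul hs) hr,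
    rot_radial hξ hr0, rot_mul hs hs]
  push_cast at hne hne' ⊢
  rw [← sq] at hne ⊢
  field_simp
  ring

/-- The remainder after one integration by parts along the rotations. -/
def remainder (t X : ℝ) (G : E3 → ℂ) (ξ : E3) : ℂ :=
  ph t (X • e 0) ξ * (Complex.I * X * ((‖ξ‖ ^ 2 / X ^ 2 / (axd ξ ^ 2 + ‖ξ‖ ^ 2 / X ^ 2) : ℝ) : ℂ)
      * G ξ
    + 4 * ξ 0 * ((axd ξ * (‖ξ‖ ^ 2 / X ^ 2) / (axd ξ ^ 2 + ‖ξ‖ ^ 2 / X ^ 2) ^ 2 : ℝ) : ℂ) * G ξ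
    - coef X ξ * (ξ 2 * rot 1 G ξ - ξ 1 * rot 2 G ξ))

/-- At x = X e_0 the field ξ₂ `rot 1` - ξ₁ `rot 2` multiplies the phase by iXs. With the coefficient
s/(s² + E) this becomes iX s²/(s² + E) = iX - iX E/(s² + E): the main term plus an error
concentrated near the axis. Taking E = |ξ|²/X² cuts off at s ~ |ξ|/X, the scale of stationary phase.
-/
lemma rot_add_rot_eq {X : ℝ} (hX : 0 < X) (t : ℝ) {ξ : E3} (hξ : ξ ≠ 0)
    (hG : DifferentiableAt ℝ G ξ) :
    rot 1 (fun ξ => (ph t (X • e 0) ξ * ((ξ 2 : ℂ) * coef X ξ)) * G ξ) ξ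
      - rot 2 (fun ξ => (ph t (X • e 0) ξ * ((ξ 1 : ℂ) * coef X ξ)) * G ξ) ξ
      = Complex.I * X * (ph t (X • e 0) ξ * G ξ) - remainder t X G ξ := by
  have hp := (hasFDerivAt_ph t (X • e 0) hξ).differentiableAt
  have hd : ∀ a, DifferentiableAt ℝ (fun ξ : E3 => (ξ a : ℂ)) ξ :=
    fun a => (hasFDerivAt_coord a ξ).differentiableAt
  have hq : DifferentiableAt ℝ (fun ξ => (coef X ξ : ℂ)) ξ :=
    ((Complex.ofRealCLM.contDiff.comp_contDiffOn (contDiffOn_coef (k := 1) hX)).contDiffAt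
      (isOpen_compl_zero.mem_nhds hξ)).differentiableAt one_ne_zero
  have hne : ((axd ξ ^ 2 + ‖ξ‖ ^ 2 / X ^ 2 : ℝ) : ℂ) ≠ 0 := by
    exact_mod_cast (denom_pos hX hξ).ne'
  have hc : ∀ a, DifferentiableAt ℝ (fun ξ : E3 => (ξ a : ℂ) * coef X ξ) ξ :=
    fun a => (hd a).fun_mul hq
  rw [rot_mul (hp.fun_mul (hc _)) hG, rot_mul (hp.fun_mul (hc _)) hG, rot_mul hp (hc _),
    rot_mul hp (hc _), rot_mul (hd _) hq, rot_mul (hd _) hq, rot_ph _ _ hξ, rot_ph _ _ hξ,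
    rot_coef hX hξ, rot_coef hX hξ, rot_axd, rot_axd]
  simp only [rot_coord]
  have h12 : (1 : Fin 3) + 2 = 0 := rfl
  have h11 : (1 : Fin 3) + 1 = 2 := rfl
  have h22 : (2 : Fin 3) + 2 = 1 := rfl
  have h21 : (2 : Fin 3) + 1 = 0 := rfl
  have e00 : e 0 0 = 1 := by simp [e_apply]
  have e01 : e 0 1 = 0 := by simp [e_apply]
  have e02 : e 0 2 = 0 := by simp [e_apply]
  simp only [h12, h11, h22, h21, remainder, coef, PiLp.smul_apply, e00, e01, e02, smul_eq_mul]
  have n1 : ¬ (2 : Fin 3) = 0 := by decide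
  have n2 : ¬ (1 : Fin 3) = 0 := by decide
  have n3 : ¬ (1 : Fin 3) = 2 := by decide
  have n4 : ¬ (2 : Fin 3) = 1 := by decide
  simp only [n1, n2, n3, n4, if_true, if_false]
  have hs : (axd ξ : ℂ) = (ξ 1 : ℂ) ^ 2 + (ξ 2 : ℂ) ^ 2 := by simp [axd]
  push_cast at hne ⊢
  set s := (axd ξ : ℂ)
  set E := (‖ξ‖ : ℂ) ^ 2 / (X : ℂ) ^ 2
  have h1 : (ξ 1 : ℂ) ^ 2 = s - (ξ 2 : ℂ) ^ 2 := by rw [hs]; ring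
  have hs1 : s / (s ^ 2 + E) * s = 1 - E / (s ^ 2 + E) := by field_simp; ring
  have hs2 : s / (s ^ 2 + E) * (s ^ 2 + E) = s := by field_simp
  have hs3 : s / (s ^ 2 + E) + s * ((E - s ^ 2) / (s ^ 2 + E) ^ 2)
      = 2 * (s * E / (s ^ 2 + E) ^ 2) := by field_simp; ring
  linear_combination (Complex.I * X * ph t (X • e 0) ξ * (s / (s ^ 2 + E)) * G ξ
      - 2 * ξ 0 * ((E - s ^ 2) / (s ^ 2 + E) ^ 2) * ph t (X • e 0) ξ * G ξ) * h1
    + (Complex.I * X * ph t (X • e 0) ξ * G ξ) * hs1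
    - (2 * ξ 0 * ph t (X • e 0) ξ * G ξ) * hs3

end

/-! ### The dispersive estimate -/

section
variable {f g G : E3 → ℂ} {A : E3 → ℝ}

/-- `A` bounds `G` and `|ξ|` times its tangential gradient. -/
structure TanBound (G : E3 → ℂ) (A : E3 → ℝ) : Prop where
  bound : ∀ ξ ≠ 0, ‖G ξ‖ ≤ A ξ
  tangential : ∀ ξ ≠ 0, ∀ v, inner ℝ ξ v = 0 → ‖fderiv ℝ G ξ v‖ * ‖ξ‖ ≤ A ξ * ‖v‖

/-- The only derivative of G in the remainder is along v = (s, -ξ₀ξ₁, -ξ₀ξ₂), which is orthogonal to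
ξ and has length |ξ|√s. Tangential control of G is therefore enough. -/
lemma norm_remainder_le {X : ℝ} (hX : 0 < X) (t : ℝ) (hG : TanBound G A) {ξ : E3} (hξ : ξ ≠ 0) :
    ‖remainder t X G ξ‖ ≤ wt X ξ * A ξ := by
  have hr : 0 < ‖ξ‖ := norm_pos_iff.2 hξ
  have hD := denom_pos hX hξ
  have hs := axd_nonneg ξ
  have hA : 0 ≤ A ξ := (norm_nonneg _).trans (hG.bound ξ hξ)
  have hnsq : ‖ξ‖ ^ 2 = ξ 0 ^ 2 + axd ξ := by
    rw [EuclideanSpace.real_norm_sq_eq, Fin.sum_univ_three]; unfold axd; ring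
  set D := axd ξ ^ 2 + ‖ξ‖ ^ 2 / X ^ 2 with hDdef
  set E := ‖ξ‖ ^ 2 / X ^ 2 with hE
  have hE0 : 0 < E := by positivity
  have hq0 : 0 ≤ coef X ξ := div_nonneg hs hD.le
  -- the tangential vector
  set v : E3 := (ξ 2) • ((ξ 2) • e 0 - (ξ 0) • e 2) - (ξ 1) • ((ξ 0) • e 1 - (ξ 1) • e 0) with hv
  have hcomp : v 0 = axd ξ ∧ v 1 = -(ξ 0 * ξ 1) ∧ v 2 = -(ξ 0 * ξ 2) := by
    simp [hv, e_apply, axd]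
    refine ⟨by ring, by ring, by ring⟩
  have hvorth : inner ℝ ξ v = 0 := by
    simp only [PiLp.inner_apply, Fin.sum_univ_three, hcomp.1, hcomp.2.1, hcomp.2.2]
    simp [axd]; ring
  have hvn : ‖v‖ = ‖ξ‖ * √(axd ξ) := by
    rw [← Real.sqrt_sq (norm_nonneg v), ← Real.sqrt_sq (norm_nonneg ξ), ← Real.sqrt_mul (by positivity)]
    congr 1
    rw [hnsq, EuclideanSpace.real_norm_sq_eq, Fin.sum_univ_three, hcomp.1, hcomp.2.1, hcomp.2.2]
    unfold axd; ring
  have hrot : (ξ 2 : ℂ) * rot 1 G ξ - ξ 1 * rot 2 G ξ = fderiv ℝ G ξ v := by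
    have h12 : (1 : Fin 3) + 2 = 0 := rfl
    have h11 : (1 : Fin 3) + 1 = 2 := rfl
    have h22 : (2 : Fin 3) + 2 = 1 := rfl
    have h21 : (2 : Fin 3) + 1 = 0 := rfl
    simp only [hv, rot, pd, h12, h11, h22, h21, map_sub, map_smul, Complex.real_smul]
  have h3 : ‖(coef X ξ : ℂ) * ((ξ 2 : ℂ) * rot 1 G ξ - ξ 1 * rot 2 G ξ)‖
      ≤ √(axd ξ) * axd ξ / D * A ξ := by
    have h := hG.tangential ξ hξ v hvorth
    rw [hvn, show A ξ * (‖ξ‖ * √(axd ξ)) = A ξ * √(axd ξ) * ‖ξ‖ by ring] at h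
    have h := le_of_mul_le_mul_right h hr
    rw [hrot, norm_mul, Complex.norm_real, Real.norm_of_nonneg hq0]
    calc coef X ξ * _ ≤ coef X ξ * (A ξ * √(axd ξ)) := by gcongr
      _ = _ := by simp only [coef]; ring
  have h1 : ‖Complex.I * X * ((E / D : ℝ) : ℂ) * G ξ‖ ≤ X * (E / D) * A ξ := by
    simp only [norm_mul, Complex.norm_I, Complex.norm_real, one_mul, Real.norm_of_nonneg hX.le,
      Real.norm_of_nonneg (div_nonneg hE0.le hD.le)]
    gcongr; exact hG.bound ξ hξ
  have h2 : ‖4 * (ξ 0 : ℂ) * ((axd ξ * E / D ^ 2 : ℝ) : ℂ) * G ξ‖ ≤ 2 * X * (E / D) * A ξ := by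
    simp only [norm_mul, Complex.norm_real, Complex.norm_ofNat,
      Real.norm_of_nonneg (div_nonneg (mul_nonneg hs hE0.le) (sq_nonneg D))]
    have hx0 : ‖ξ 0‖ ≤ ‖ξ‖ := PiLp.norm_apply_le ξ 0
    have hrX : ‖ξ‖ = X * √E := by
      rw [hE, Real.sqrt_div (by positivity), Real.sqrt_sq hr.le, Real.sqrt_sq hX.le]; field_simp
    -- Arithmetic-geometric mean, D being s² + E. Together with |ξ| = X√E it absorbs the term in
    -- which the coefficient is differentiated into the one coming from the phase.
    have hsE : 2 * (√E * axd ξ) ≤ D := by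
      have := Real.sq_sqrt hE0.le
      rw [hDdef]
      nlinarith [sq_nonneg (√E - axd ξ)]
    have hkey : 4 * ‖ξ‖ * (axd ξ * E / D ^ 2) ≤ 2 * X * (E / D) := by
      rw [hrX]
      calc 4 * (X * √E) * (axd ξ * E / D ^ 2) = 2 * X * E / D ^ 2 * (2 * (√E * axd ξ)) := by ring
        _ ≤ 2 * X * E / D ^ 2 * D := by gcongr
        _ = _ := by field_simp
    calc 4 * ‖ξ 0‖ * (axd ξ * E / D ^ 2) * ‖G ξ‖ ≤ 4 * ‖ξ‖ * (axd ξ * E / D ^ 2) * A ξ := by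
          gcongr; exact hG.bound ξ hξ
      _ ≤ _ := by gcongr
  rw [remainder, norm_mul, norm_ph, one_mul]
  calc _ ≤ X * (E / D) * A ξ + 2 * X * (E / D) * A ξ + √(axd ξ) * axd ξ / D * A ξ :=
        (norm_sub_le _ _).trans (add_le_add ((norm_add_le _ _).trans (add_le_add h1 h2)) h3)
    _ = _ := by simp only [wt]; ring

lemma ae_ne_zero : ∀ᵐ ξ : E3, ξ ≠ 0 := by
  rw [ae_iff]; simp

/-- Rotation fields are divergence free, so integrating `rot_add_rot_eq` equates iX times the
oscillatory integral with the integral of the remainder. -/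
theorem dispersive_axis {X : ℝ} (hX : 0 < X) (t : ℝ) (hG : Away G) (hs : ContDiffOn ℝ 1 G {0}ᶜ)
    (hA : TanBound G A) :
    ENNReal.ofReal X * ‖∫ ξ, ph t (X • e 0) ξ * G ξ‖ₑ
      ≤ ∫⁻ ξ, ENNReal.ofReal (wt X ξ) * ENNReal.ofReal (A ξ) := by
  have hq : ContDiffOn ℝ 1 (fun ξ => (coef X ξ : ℂ)) {0}ᶜ :=
    Complex.ofRealCLM.contDiff.comp_contDiffOn (contDiffOn_coef hX)
  have hVa : ∀ a : Fin 3, Away (fun ξ => (ph t (X • e 0) ξ * ((ξ a : ℂ) * coef X ξ)) * G ξ) :=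
    fun a => hG.mul_left _
  have hVs : ∀ a : Fin 3,
      ContDiff ℝ 1 (fun ξ => (ph t (X • e 0) ξ * ((ξ a : ℂ) * coef X ξ)) * G ξ) :=
    fun a => (hVa a).contDiff (((contDiffOn_ph t _).mul
      ((contDiff_coord a).contDiffOn.mul hq)).mul hs)
  have hi : ∀ a i : Fin 3, Integrable (rot i (fun ξ =>
      (ph t (X • e 0) ξ * ((ξ a : ℂ) * coef X ξ)) * G ξ)) := fun a i =>
    (continuous_rot (hVs a) i).integrable_of_hasCompactSupport ((hVa a).rot i).compact
  have hiG : Integrable (fun ξ => ph t (X • e 0) ξ * G ξ) :=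
    ((continuous_ph t _).mul (hG.contDiff hs).continuous).integrable_of_hasCompactSupport
      (hG.mul_left _).compact
  have hae : (fun ξ => rot 1 (fun ξ => (ph t (X • e 0) ξ * ((ξ 2 : ℂ) * coef X ξ)) * G ξ) ξ
      - rot 2 (fun ξ => (ph t (X • e 0) ξ * ((ξ 1 : ℂ) * coef X ξ)) * G ξ) ξ)
      =ᵐ[volume] fun ξ => Complex.I * X * (ph t (X • e 0) ξ * G ξ) - remainder t X G ξ := by
    filter_upwards [ae_ne_zero] with ξ hξ
    exact rot_add_rot_eq hX t hξ
      ((hs.contDiffAt (isOpen_compl_zero.mem_nhds hξ)).differentiableAt one_ne_zero)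
  have hir : Integrable (remainder t X G) := by
    have h := ((hiG.const_mul (Complex.I * X)).sub (((hi 2 1).sub (hi 1 2)).congr hae))
    refine h.congr (Eventually.of_forall fun ξ => ?_)
    simp
  have h0 : Complex.I * X * ∫ ξ, ph t (X • e 0) ξ * G ξ = ∫ ξ, remainder t X G ξ := by
    have h := integral_congr_ae hae
    rw [integral_sub (hi 2 1) (hi 1 2), integral_rot_eq_zero (hVs 2) (hVa 2).compact,
      integral_rot_eq_zero (hVs 1) (hVa 1).compact, sub_zero,
      integral_sub (hiG.const_mul _) hir, integral_const_mul] at h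
    exact (sub_eq_zero.1 h.symm)
  calc ENNReal.ofReal X * ‖∫ ξ, ph t (X • e 0) ξ * G ξ‖ₑ
      = ‖Complex.I * X * ∫ ξ, ph t (X • e 0) ξ * G ξ‖ₑ := by
        rw [enorm_mul, enorm_mul]
        congr 1
        rw [← ofReal_norm (X : ℂ), Complex.norm_real, Real.norm_of_nonneg hX.le,
          ← ofReal_norm Complex.I]
        simp
    _ ≤ ∫⁻ ξ, ‖remainder t X G ξ‖ₑ := by rw [h0]; exact enorm_integral_le_lintegral_enorm _
    _ ≤ _ := by
        refine lintegral_mono_ae ?_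
        filter_upwards [ae_ne_zero] with ξ hξ
        have hw : 0 ≤ wt X ξ := by
          have := denom_pos hX hξ
          have := axd_nonneg ξ
          unfold wt; positivity
        rw [← ofReal_norm, ← ENNReal.ofReal_mul hw]
        exact ENNReal.ofReal_le_ofReal (norm_remainder_le hX t hA hξ)

lemma norm_e (j : Fin 3) : ‖e j‖ = 1 := by simp [e]

/-- The phase sees ξ only through x·ξ and |ξ|, and `Away`, `TanBound` and `Ann` are invariant under
linear isometries. A reflection carrying |x| e_0 to x reduces everything to `dispersive_axis`. The
weight depends on x, its constant does not. -/
theorem exists_dispersive : ∃ C : ℝ≥0, ∀ (t : ℝ) (x : E3), x ≠ 0 → ∃ w : E3 → ℝ≥0∞, Ann w C ∧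
    ∀ (G : E3 → ℂ) (A : E3 → ℝ), Away G → ContDiffOn ℝ 1 G {0}ᶜ → TanBound G A →
      ENNReal.ofReal ‖x‖ * ‖∫ ξ, ph t x ξ * G ξ‖ₑ ≤ ∫⁻ ξ, w ξ * ENNReal.ofReal (A ξ) := by
  obtain ⟨C, hC⟩ := exists_ann_wt
  refine ⟨C, fun t x hx => ?_⟩
  have hX : 0 < ‖x‖ := norm_pos_iff.2 hx
  obtain ⟨Q, hQ⟩ : ∃ Q : E3 ≃ₗᵢ[ℝ] E3, Q (‖x‖ • e 0) = x :=
    ⟨_, Submodule.reflection_sub (by rw [norm_smul, norm_e]; simp)⟩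
  have hmp : MeasurePreserving Q := Q.measurePreserving
  have he : MeasurableEmbedding Q := Q.toHomeomorph.measurableEmbedding
  have hmp' : MeasurePreserving Q.symm := Q.symm.measurePreserving
  have he' : MeasurableEmbedding Q.symm := Q.symm.toHomeomorph.measurableEmbedding
  refine ⟨fun ξ => ENNReal.ofReal (wt ‖x‖ (Q.symm ξ)), fun R hR => ?_, fun G A hG hs hA => ?_⟩
  · have := hmp'.setLIntegral_comp_preimage_emb he' (fun ξ => ENNReal.ofReal (wt ‖x‖ ξ))
      {ξ | R ≤ ‖ξ‖ ∧ ‖ξ‖ ≤ 2 * R}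
    simp only [Set.preimage_ofPred_eq, LinearIsometryEquiv.norm_map] at this
    rw [this]
    exact hC ‖x‖ hX R hR
  · have hne : ∀ {ξ}, ξ ≠ 0 → Q ξ ≠ 0 := fun h => by simpa using h
    have hQd : ∀ {k : WithTop ℕ∞}, ContDiff ℝ k Q := Q.contDiff
    have hcl : IsClosed (Q ⁻¹' tsupport G) := (isClosed_tsupport G).preimage Q.continuous
    have hsub : tsupport (G ∘ Q) ⊆ Q ⁻¹' tsupport G :=
      closure_minimal (fun ξ hξ => subset_tsupport G hξ) hcl
    have hG' : Away (G ∘ Q) :=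
      ⟨hG.compact.comp_homeomorph Q.toHomeomorph, fun h => hG.away (by simpa using hsub h)⟩
    have hs' : ContDiffOn ℝ 1 (G ∘ Q) {0}ᶜ := hs.comp hQd.contDiffOn fun ξ hξ => hne hξ
    have hA' : TanBound (G ∘ Q) (A ∘ Q) := by
      refine ⟨fun ξ hξ => hA.bound _ (hne hξ), fun ξ hξ v hv => ?_⟩
      have hd : DifferentiableAt ℝ G (Q ξ) :=
        (hs.contDiffAt (isOpen_compl_zero.mem_nhds (hne hξ))).differentiableAt one_ne_zero
      have h1 : fderiv ℝ (G ∘ Q) ξ v = fderiv ℝ G (Q ξ) (Q v) := by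
        have := (hd.hasFDerivAt.comp ξ (Q.toContinuousLinearEquiv.hasFDerivAt (x := ξ))).fderiv
        exact congrArg (fun L : E3 →L[ℝ] ℂ => L v) this
      have := hA.tangential (Q ξ) (hne hξ) (Q v) (by rw [LinearIsometryEquiv.inner_map_map, hv])
      simpa only [h1, LinearIsometryEquiv.norm_map, Function.comp_apply] using this
    have hph : ∀ ξ, ph t x (Q ξ) = ph t (‖x‖ • e 0) ξ := fun ξ => by
      have : inner ℝ x (Q ξ) = inner ℝ (‖x‖ • e 0) ξ := by
        conv_lhs => rw [← hQ]
        exact Q.inner_map_map _ _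
      rw [ph, ph, this, Q.norm_map]
    have h := dispersive_axis hX t hG' hs' hA'
    rw [← hmp.integral_comp he, ← hmp.lintegral_comp_emb he]
    simpa only [hph, Q.symm_apply_apply, Function.comp_apply] using h

end

/-! ### Low and high frequency consequences of the dispersive estimate -/

section
variable {f g G : E3 → ℂ} {A c : ℝ} {p : ℤ}

/-- The coefficients tω_j + x_j have order 0 and size |t| + |x|. Dividing by the factor | |x|² - t²
| = d(|t| + |x|) of `integral_ph_confl` leaves a net gain of 1/(d|ξ|). -/
lemma exists_ord_confl (n : ℕ) : ∃ C, 0 ≤ C ∧ ∀ (t : ℝ) (x : E3) (p : ℤ) (A : ℝ) (f : E3 → ℂ),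
    0 ≤ A → Ord {0}ᶜ (n + 1) p A f →
      Ord {0}ᶜ n (p - 1) (C * (|t| + ‖x‖) * A) (confl t x f) := by
  obtain ⟨C₁, hC₁, h₁⟩ := exists_ord_rinv n
  obtain ⟨C₂, hC₂, h₂⟩ := exists_ord_om n
  have ho := isOpen_compl_zero
  have hz := zero_notMem_compl
  refine ⟨3 * (2 ^ n * (C₂ + 1)) + 2 * (2 ^ n * C₁), by positivity, fun t x p A f hA hf => ?_⟩
  have ha : ∀ j, Ord {0}ᶜ n 0 ((C₂ + 1) * (|t| + ‖x‖)) (fun ξ => (t : ℂ) * om j ξ + (x j : ℂ)) :=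
    fun j => by
      refine (((h₂ j).const_mul ho (t : ℂ)).add ho (Ord.const (x j : ℂ) le_rfl)).mono_const ?_
      rw [Complex.norm_real, Complex.norm_real, Real.norm_eq_abs, Real.norm_eq_abs]
      nlinarith [abs_apply_le x j, abs_nonneg t, norm_nonneg x,
        mul_nonneg hC₂ (norm_nonneg x)]
  have h1 := Ord.sum3 ho fun j => (ha j).mul ho hz (by positivity) hA (hf.2.2 j)
  have h2 := (h₁.mul ho hz hC₁ hA hf.of_succ).const_mul ho (2 * t : ℂ)
  rw [show 0 + (p - 1) = p - 1 by ring] at h1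
  rw [show -1 + p = p - 1 by ring] at h2
  refine (h1.add ho h2).mono_const ?_
  rw [norm_mul, Complex.norm_real, Complex.norm_ofNat, Real.norm_eq_abs]
  have : 0 ≤ 2 ^ n * C₁ * A * ‖x‖ := by positivity
  nlinarith

lemma exists_good_confl (n : ℕ) : ∃ C, 0 ≤ C ∧ ∀ (t : ℝ) (x : E3) (p : ℤ) (A : ℝ) (f : E3 → ℂ),
    0 ≤ A → Good {0}ᶜ (n + 1) p A f →
      Good {0}ᶜ n (p - 1) (C * (|t| + ‖x‖) * A) (confl t x f) := by
  obtain ⟨C₁, hC₁, h₁⟩ := exists_good_rinv n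
  obtain ⟨C₂, hC₂, h₂⟩ := exists_good_om n
  have ho := isOpen_compl_zero
  have hz := zero_notMem_compl
  refine ⟨9 * (2 ^ (n + 1) * (2 ^ (n + 1) * (C₂ + 1))) + 2 ^ (n + 1) * (2 * 2 ^ (n + 1) * C₁),
    by positivity, fun t x p A f hA hf => ?_⟩
  have hconst : ∀ c : ℂ, Good ({0}ᶜ : Set E3) n 0 ‖c‖ (fun _ => c) :=
    fun c => Good.const (norm_nonneg c) c le_rfl
  have ha : ∀ j, Good {0}ᶜ n 0 (2 ^ (n + 1) * (C₂ + 1) * (|t| + ‖x‖))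
      (fun ξ => (t : ℂ) * om j ξ + (x j : ℂ)) := fun j => by
    have h := ((hconst t).mul ho hz (norm_nonneg _) hC₂ (h₂ j))
    rw [zero_add] at h
    refine (h.add ho (hconst (x j))).mono_const ?_
    rw [Complex.norm_real, Complex.norm_real, Real.norm_eq_abs, Real.norm_eq_abs]
    have h1 : (1 : ℝ) ≤ 2 ^ (n + 1) := one_le_pow₀ (by norm_num)
    have h2 := abs_apply_le x j
    have h3 : 0 ≤ 2 ^ (n + 1) * C₂ * ‖x‖ := by positivity
    have h4 : 0 ≤ 2 ^ (n + 1) * |t| := by positivity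
    nlinarith [mul_le_mul_of_nonneg_right h1 (norm_nonneg x)]
  have h1 := Good.sum3 ho fun j => (ha j).mul ho hz (by positivity) (by positivity) (hf.pd ho hA j)
  have h2 := (hconst (2 * t : ℂ)).mul ho hz (norm_nonneg _) (by positivity)
    (h₁.mul ho hz hC₁ hA (hf.mono_order (Nat.le_succ n)))
  rw [show 0 + (p - 1) = p - 1 by ring] at h1
  rw [show 0 + (-1 + p) = p - 1 by ring] at h2
  refine (h1.add ho h2).mono_const ?_
  rw [norm_mul, Complex.norm_real, Complex.norm_ofNat, Real.norm_eq_abs]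
  have : 0 ≤ 2 ^ (n + 1) * (2 * 2 ^ (n + 1) * C₁) * A * ‖x‖ := by positivity
  nlinarith

/-- For v orthogonal to ξ one has |ξ|² v = (ξ × v) × ξ, so |ξ|² ∂_v f is the sum of (ξ × v)_i `rot
i` f over i. Each of the three cross product components is at most 2|ξ||v|, whence the factor 6. -/
lemma Good.tanBound (h : Good {0}ᶜ 0 p A f) : TanBound f (fun ξ => 6 * A * ‖ξ‖ ^ p) := by
  have hb : ∀ ξ ≠ 0, ‖f ξ‖ ≤ A * ‖ξ‖ ^ p := fun ξ hξ => h.ord ξ hξ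
  have hA : ∀ ξ : E3, ξ ≠ 0 → 0 ≤ A * ‖ξ‖ ^ p := fun ξ hξ => (norm_nonneg _).trans (hb ξ hξ)
  refine ⟨fun ξ hξ => (hb ξ hξ).trans (by nlinarith [hA ξ hξ]), fun ξ hξ v hv => ?_⟩
  have hr : 0 < ‖ξ‖ := norm_pos_iff.2 hξ
  have hv' : (ξ 0 : ℂ) * v 0 + ξ 1 * v 1 + ξ 2 * v 2 = 0 := by
    have : ξ 0 * v 0 + ξ 1 * v 1 + ξ 2 * v 2 = 0 := by
      rw [PiLp.inner_apply, Fin.sum_univ_three] at hv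
      simp only [RCLike.inner_apply, conj_trivial] at hv
      linarith
    simpa using congrArg Complex.ofReal this
  have hexp : v = v 0 • e 0 + v 1 • e 1 + v 2 • e 2 := by
    ext i; fin_cases i <;> simp [e_apply]
  have hfd : fderiv ℝ f ξ v
      = (v 0 : ℂ) * WaveDecay.pd 0 f ξ + (v 1 : ℂ) * WaveDecay.pd 1 f ξ
        + (v 2 : ℂ) * WaveDecay.pd 2 f ξ := by
    conv_lhs => rw [hexp]
    simp only [map_add, map_smul, Complex.real_smul, WaveDecay.pd]
  have hsq : (‖ξ‖ : ℂ) ^ 2 = (ξ 0 : ℂ) ^ 2 + (ξ 1 : ℂ) ^ 2 + (ξ 2 : ℂ) ^ 2 := by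
    rw [← sum_sq_eq, Fin.sum_univ_three]
  have h12 : (1 : Fin 3) + 2 = 0 := rfl
  have h11 : (1 : Fin 3) + 1 = 2 := rfl
  have h22 : (2 : Fin 3) + 2 = 1 := rfl
  have h21 : (2 : Fin 3) + 1 = 0 := rfl
  have hid : (‖ξ‖ : ℂ) ^ 2 * fderiv ℝ f ξ v = ((ξ 1 : ℂ) * v 2 - ξ 2 * v 1) * WaveDecay.rot 0 f ξ
      + ((ξ 2 : ℂ) * v 0 - ξ 0 * v 2) * WaveDecay.rot 1 f ξ + ((ξ 0 : ℂ) * v 1 - ξ 1 * v 0) * WaveDecay.rot 2 f ξ := by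
    rw [hfd, hsq]
    simp only [WaveDecay.rot, h12, h11, h22, h21, zero_add]
    linear_combination (ξ 0 * WaveDecay.pd 0 f ξ + ξ 1 * WaveDecay.pd 1 f ξ + ξ 2 * WaveDecay.pd 2 f ξ) * hv'
  have hterm : ∀ a b i, ‖((ξ a : ℂ) * v b - ξ b * v a) * WaveDecay.rot i f ξ‖
      ≤ 2 * (‖ξ‖ * ‖v‖) * (A * ‖ξ‖ ^ p) := fun a b i => by
    rw [norm_mul]
    have h1 : ∀ a b, ‖(ξ a : ℂ) * v b‖ ≤ ‖ξ‖ * ‖v‖ := fun a b => by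
      rw [norm_mul, Complex.norm_real, Complex.norm_real]
      exact mul_le_mul (abs_apply_le ξ a) (abs_apply_le v b) (norm_nonneg _) (norm_nonneg _)
    gcongr
    · calc _ ≤ _ := norm_sub_le _ _
        _ ≤ ‖ξ‖ * ‖v‖ + ‖ξ‖ * ‖v‖ := add_le_add (h1 _ _) (h1 _ _)
        _ = _ := by ring
    · exact h.rot i ξ hξ
  have hn : ‖ξ‖ ^ 2 * ‖fderiv ℝ f ξ v‖ ≤ 6 * (‖ξ‖ * ‖v‖) * (A * ‖ξ‖ ^ p) := by
    calc ‖ξ‖ ^ 2 * ‖fderiv ℝ f ξ v‖ = ‖(‖ξ‖ : ℂ) ^ 2 * fderiv ℝ f ξ v‖ := by simp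
      _ ≤ 2 * (‖ξ‖ * ‖v‖) * (A * ‖ξ‖ ^ p) + 2 * (‖ξ‖ * ‖v‖) * (A * ‖ξ‖ ^ p)
          + 2 * (‖ξ‖ * ‖v‖) * (A * ‖ξ‖ ^ p) := by
          rw [hid]
          exact norm_add₃_le.trans
            (add_le_add (add_le_add (hterm _ _ _) (hterm _ _ _)) (hterm _ _ _))
      _ = _ := by ring
  refine le_of_mul_le_mul_left ?_ hr
  calc ‖ξ‖ * (‖fderiv ℝ f ξ v‖ * ‖ξ‖) = ‖ξ‖ ^ 2 * ‖fderiv ℝ f ξ v‖ := by ring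
    _ ≤ _ := hn
    _ = _ := by ring

/-- On an open set where G vanishes its derivative vanishes too, so the bounding function may be set
to zero there. The support of G is thereby carried into the annular integrals. -/
lemma TanBound.indicator {A : E3 → ℝ} {V S : Set E3} (h : TanBound G A) (hV : IsOpen V)
    (hGV : ∀ ξ ∈ V, G ξ = 0) (hS : ∀ ξ ≠ 0, ξ ∉ V → ξ ∈ S) : TanBound G (S.indicator A) := by
  have h0 : ∀ ξ ≠ 0, 0 ≤ A ξ := fun ξ hξ => (norm_nonneg _).trans (h.bound ξ hξ)
  have hle : ∀ ξ ≠ 0, 0 ≤ S.indicator A ξ := fun ξ hξ => by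
    by_cases hs : ξ ∈ S
    · rw [Set.indicator_of_mem hs]; exact h0 ξ hξ
    · rw [Set.indicator_of_notMem hs]
  refine ⟨fun ξ hξ => ?_, fun ξ hξ v hv => ?_⟩
  · by_cases hm : ξ ∈ V
    · rw [hGV ξ hm, norm_zero]; exact hle ξ hξ
    · rw [Set.indicator_of_mem (hS ξ hξ hm)]; exact h.bound ξ hξ
  · by_cases hm : ξ ∈ V
    · have : G =ᶠ[𝓝 ξ] fun _ => 0 := Filter.eventually_of_mem (hV.mem_nhds hm) hGV
      rw [this.fderiv_eq]
      simpa using mul_nonneg (hle ξ hξ) (norm_nonneg v)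
    · rw [Set.indicator_of_mem (hS ξ hξ hm)]; exact h.tangential ξ hξ v hv

lemma lintegral_mul_indicator {w : E3 → ℝ≥0∞} {S : Set E3} (hS : MeasurableSet S) (c : ℝ)
    (hc : 0 ≤ c) (h : E3 → ℝ) :
    ∫⁻ ξ, w ξ * ENNReal.ofReal (S.indicator (fun ξ => c * h ξ) ξ)
      = ENNReal.ofReal c * ∫⁻ ξ in S, w ξ * ENNReal.ofReal (h ξ) := by
  rw [← lintegral_indicator hS, ← lintegral_const_mul' _ _ ENNReal.ofReal_ne_top]
  refine lintegral_congr fun ξ => ?_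
  by_cases hξ : ξ ∈ S
  · rw [Set.indicator_of_mem hξ, Set.indicator_of_mem hξ, ENNReal.ofReal_mul hc]; ring
  · rw [Set.indicator_of_notMem hξ, Set.indicator_of_notMem hξ]; simp

lemma measurableSet_low (ρ : ℝ) : MeasurableSet {ξ : E3 | ξ ≠ 0 ∧ ‖ξ‖ < ρ} :=
  (measurableSet_singleton (0 : E3)).compl.inter (measurableSet_lt measurable_norm measurable_const)

lemma measurableSet_high (ρ : ℝ) : MeasurableSet {ξ : E3 | ρ ≤ ‖ξ‖} :=
  measurableSet_le measurable_const measurable_norm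

lemma Ann.low_indicator {w : E3 → ℝ≥0∞} {C : ℝ≥0} (hw : Ann w C) {ρ : ℝ} (hρ : 0 < ρ)
    (hc : 0 ≤ c) : ∫⁻ ξ, w ξ * ENNReal.ofReal
      ({ξ : E3 | ξ ≠ 0 ∧ ‖ξ‖ < ρ}.indicator (fun ξ => c * ‖ξ‖ ^ (-1 : ℤ)) ξ)
      ≤ ENNReal.ofReal (C * (c * ρ)) := by
  rw [lintegral_mul_indicator (measurableSet_low ρ) c hc]
  calc _ ≤ ENNReal.ofReal c * (C * ENNReal.ofReal ρ) := by gcongr; exact hw.low hρ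
    _ = _ := by
      rw [ENNReal.ofReal_mul C.coe_nonneg, ENNReal.ofReal_mul hc, ENNReal.ofReal_coe_nnreal]; ring

lemma Ann.high_indicator {w : E3 → ℝ≥0∞} {C : ℝ≥0} (hw : Ann w C) {ρ : ℝ} (hρ : 0 < ρ)
    (hc : 0 ≤ c) : ∫⁻ ξ, w ξ * ENNReal.ofReal
      ({ξ : E3 | ρ ≤ ‖ξ‖}.indicator (fun ξ => c * ‖ξ‖ ^ (-3 : ℤ)) ξ)
      ≤ ENNReal.ofReal (C * (c * (2 / ρ))) := by
  rw [lintegral_mul_indicator (measurableSet_high ρ) c hc]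
  calc _ ≤ ENNReal.ofReal c * (C * ENNReal.ofReal (2 / ρ)) := by gcongr; exact hw.high hρ
    _ = _ := by
      rw [ENNReal.ofReal_mul C.coe_nonneg, ENNReal.ofReal_mul hc, ENNReal.ofReal_coe_nnreal]; ring

lemma real_of_enorm_le {X S : ℝ} (hX : 0 ≤ X) (hS : 0 ≤ S) {z : ℂ}
    (h : ENNReal.ofReal X * ‖z‖ₑ ≤ ENNReal.ofReal S) : X * ‖z‖ ≤ S := by
  rw [← ofReal_norm, ← ENNReal.ofReal_mul hX] at h
  exact (ENNReal.ofReal_le_ofReal_iff hS).1 h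

/-- The low frequency, high frequency and mixed consequences of the dispersive estimate. -/
theorem exists_dispersive_bounds : ∃ C, 0 ≤ C ∧ ∀ (t : ℝ) (x : E3), x ≠ 0 → ∀ (G : E3 → ℂ),
    Away G →
    (∀ A ρ, 0 ≤ A → 0 < ρ → Good {0}ᶜ 0 (-1) A G → (∀ ξ, 3 / 4 * ρ < ‖ξ‖ → G ξ = 0) →
      ‖x‖ * ‖∫ ξ, ph t x ξ * G ξ‖ ≤ C * (A * ρ)) ∧
    (∀ A ρ, 0 ≤ A → 0 < ρ → Good {0}ᶜ 0 (-3) A G → (∀ ξ, ‖ξ‖ < 5 / 4 * ρ → G ξ = 0) →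
      ‖x‖ * ‖∫ ξ, ph t x ξ * G ξ‖ ≤ C * (A * (1 / ρ))) ∧
    (∀ A, 0 ≤ A → Good {0}ᶜ 0 (-1) A G → Good {0}ᶜ 0 (-3) A G →
      ‖x‖ * ‖∫ ξ, ph t x ξ * G ξ‖ ≤ C * A) := by
  obtain ⟨C, hC⟩ := exists_dispersive
  have hC0 := C.coe_nonneg
  refine ⟨18 * C, by positivity, fun t x hx G hG => ?_⟩
  obtain ⟨w, hw, hd⟩ := hC t x hx
  have hX := norm_nonneg x
  refine ⟨fun A ρ hA hρ hgood hsupp => ?_, fun A ρ hA hρ hgood hsupp => ?_,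
    fun A hA hg1 hg3 => ?_⟩
  -- The numbers 3/4 and 5/4 fit the cutoff at radius R: it vanishes beyond 3/2·R = 3/4·(2R), so ρ =
  -- 2R serves for the low part, and it equals 1 up to 5/4·R, so ρ = R serves for the high part.
  · have hV : IsOpen {ξ : E3 | 3 / 4 * ρ < ‖ξ‖} := isOpen_lt continuous_const continuous_norm
    have hT := hgood.tanBound.indicator hV hsupp (S := {ξ : E3 | ξ ≠ 0 ∧ ‖ξ‖ < ρ})
      fun ξ h0 hξ => ⟨h0, by simp only [Set.mem_ofPred_eq, not_lt] at hξ; linarith⟩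
    have h := (hd G _ hG (by simpa using hgood.smooth) hT).trans
      (hw.low_indicator hρ (by positivity))
    refine (real_of_enorm_le hX (by positivity) h).trans ?_
    have : 0 ≤ C * A * ρ := by positivity
    nlinarith
  · have hV : IsOpen {ξ : E3 | ‖ξ‖ < 5 / 4 * ρ} := isOpen_lt continuous_norm continuous_const
    have hT := hgood.tanBound.indicator hV hsupp (S := {ξ : E3 | ρ ≤ ‖ξ‖})
      fun ξ h0 hξ => by simp only [Set.mem_ofPred_eq, not_lt] at hξ ⊢; linarith
    have h := (hd G _ hG (by simpa using hgood.smooth) hT).trans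
      (hw.high_indicator hρ (by positivity))
    refine (real_of_enorm_le hX (by positivity) h).trans ?_
    have : 0 ≤ C * A * (1 / ρ) := by positivity
    rw [show 2 / ρ = 2 * (1 / ρ) by ring]
    nlinarith
  · have h1 := hg1.tanBound
    have h3 := hg3.tanBound
    set S₁ := {ξ : E3 | ξ ≠ 0 ∧ ‖ξ‖ < 1}
    set S₂ := {ξ : E3 | 1 ≤ ‖ξ‖}
    have hT : TanBound G (fun ξ => S₁.indicator (fun ξ => 6 * A * ‖ξ‖ ^ (-1 : ℤ)) ξ
        + S₂.indicator (fun ξ => 6 * A * ‖ξ‖ ^ (-3 : ℤ)) ξ) := by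
      have hcase : ∀ ξ : E3, ξ ≠ 0 →
          (S₁.indicator (fun ξ => 6 * A * ‖ξ‖ ^ (-1 : ℤ)) ξ
            + S₂.indicator (fun ξ => 6 * A * ‖ξ‖ ^ (-3 : ℤ)) ξ = 6 * A * ‖ξ‖ ^ (-1 : ℤ)) ∨
          (S₁.indicator (fun ξ => 6 * A * ‖ξ‖ ^ (-1 : ℤ)) ξ
            + S₂.indicator (fun ξ => 6 * A * ‖ξ‖ ^ (-3 : ℤ)) ξ = 6 * A * ‖ξ‖ ^ (-3 : ℤ)) := by
        intro ξ hξ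
        by_cases h : ‖ξ‖ < 1
        · left
          rw [Set.indicator_of_mem (show ξ ∈ S₁ from ⟨hξ, h⟩),
            Set.indicator_of_notMem (show ξ ∉ S₂ from not_le.2 h), add_zero]
        · right
          rw [Set.indicator_of_notMem (show ξ ∉ S₁ from fun h' => h h'.2),
            Set.indicator_of_mem (show ξ ∈ S₂ from not_lt.1 h), zero_add]
      refine ⟨fun ξ hξ => ?_, fun ξ hξ v hv => ?_⟩
      · rcases hcase ξ hξ with h | h <;> rw [h]
        exacts [h1.bound ξ hξ, h3.bound ξ hξ]
      · rcases hcase ξ hξ with h | h <;> simp only [h]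
        exacts [h1.tangential ξ hξ v hv, h3.tangential ξ hξ v hv]
    have h := hd G _ hG (by simpa using hg1.smooth) hT
    have hnn : ∀ (S : Set E3) (p : ℤ) (ξ : E3),
        0 ≤ S.indicator (fun ξ : E3 => 6 * A * ‖ξ‖ ^ p) ξ :=
      fun S p ξ => Set.indicator_nonneg (fun ξ _ => by positivity) ξ
    have hsplit : ∫⁻ ξ, w ξ * ENNReal.ofReal (S₁.indicator (fun ξ => 6 * A * ‖ξ‖ ^ (-1 : ℤ)) ξ
        + S₂.indicator (fun ξ => 6 * A * ‖ξ‖ ^ (-3 : ℤ)) ξ)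
        ≤ ENNReal.ofReal (C * (6 * A * 1)) + ENNReal.ofReal (C * (6 * A * (2 / 1))) := by
      refine le_trans ?_ (add_le_add (hw.low_indicator one_pos (by positivity))
        (hw.high_indicator one_pos (by positivity)))
      rw [← lintegral_add_compl _ (measurableSet_low 1)]
      refine add_le_add ((setLIntegral_mono' (measurableSet_low 1) fun ξ hξ => ?_).trans
        (setLIntegral_le_lintegral _ _))
        ((setLIntegral_mono' (measurableSet_low 1).compl fun ξ hξ => ?_).trans
        (setLIntegral_le_lintegral _ _))
      · rw [Set.indicator_of_notMem (show ξ ∉ S₂ from not_le.2 hξ.2), add_zero]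
      · rw [Set.indicator_of_notMem (show ξ ∉ S₁ from hξ), zero_add]
    rw [← ENNReal.ofReal_add (by positivity) (by positivity)] at hsplit
    refine (real_of_enorm_le hX (by positivity) (h.trans hsplit)).trans (le_of_eq (by ring))

end

/-! ### Decay in the distance to the light cone -/

section
variable {f g G : E3 → ℂ} {A c : ℝ} {p : ℤ} {ψ : ℝ → ℝ}

/-- The radial cutoff to frequencies `≲ R`. -/
def cut (ψ : ℝ → ℝ) (R : ℝ) (ξ : E3) : ℂ := (ψ (‖ξ‖ / R) : ℂ)

lemma IsCutoff.cut_eq_one (hψ : IsCutoff ψ) {R : ℝ} (hR : 0 < R) {ξ : E3} (h : ‖ξ‖ ≤ 5 / 4 * R) :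
    cut ψ R ξ = 1 := by
  have h0 : 0 ≤ ‖ξ‖ / R := by positivity
  rw [cut, hψ.eq_one _ ⟨by linarith, (div_le_iff₀ hR).2 h⟩, Complex.ofReal_one]

lemma IsCutoff.cut_eq_zero (hψ : IsCutoff ψ) {R : ℝ} (hR : 0 < R) {ξ : E3}
    (h : 3 / 2 * R < ‖ξ‖) : cut ψ R ξ = 0 := by
  have : ψ (‖ξ‖ / R) = 0 := by
    by_contra h'
    have := (hψ.support h').2
    rw [div_le_iff₀ hR] at this
    linarith
  rw [cut, this, Complex.ofReal_zero]

lemma confl_eq_zero {V : Set E3} (hV : IsOpen V) (h : ∀ ξ ∈ V, f ξ = 0) (t : ℝ) (x : E3) :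
    ∀ ξ ∈ V, confl t x f ξ = 0 := fun ξ hξ => by
  have h1 : ∀ j, pd j f ξ = 0 := fun j => by
    rw [pd_eqOn hV (g := fun _ => 0) h j hξ]; simp [pd]
  simp [confl, h1, h ξ hξ]

lemma abs_sq_sub_sq (t : ℝ) (x : E3) :
    ‖(‖x‖ : ℂ) ^ 2 - (t : ℂ) ^ 2‖ = |(|t| - ‖x‖)| * (|t| + ‖x‖) := by
  have : (‖x‖ : ℂ) ^ 2 - (t : ℂ) ^ 2 = ((‖x‖ ^ 2 - t ^ 2 : ℝ) : ℂ) := by push_cast; ring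
  rw [this, Complex.norm_real, Real.norm_eq_abs, ← sq_abs t,
    show ‖x‖ ^ 2 - |t| ^ 2 = -((|t| - ‖x‖) * (|t| + ‖x‖)) by ring, abs_neg, abs_mul,
    abs_of_nonneg (by positivity : 0 ≤ |t| + ‖x‖)]

lemma norm_integral_confl (t : ℝ) (x : E3) (hf : Away f) (hs : ContDiffOn ℝ 1 f {0}ᶜ)
    (hs' : ContDiffOn ℝ 1 (confl t x f) {0}ᶜ) :
    (|(|t| - ‖x‖)| * (|t| + ‖x‖)) ^ 2 * ‖∫ ξ, ph t x ξ * f ξ‖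
      = ‖∫ ξ, ph t x ξ * confl t x (confl t x f) ξ‖ := by
  have h1 := congrArg norm (integral_ph_confl t x hf hs)
  have h2 := congrArg norm (integral_ph_confl t x (hf.confl t x) hs')
  rw [norm_mul, norm_mul, norm_neg, Complex.norm_I, one_mul, abs_sq_sub_sq] at h1 h2
  rw [← h2, ← h1]; ring

lemma IsCutoff.integral_split (hψ : IsCutoff ψ) (t : ℝ) (x : E3) (R : ℝ) (hf : Away f)
    (hs : ContDiffOn ℝ 1 f {0}ᶜ) :
    ∫ ξ, ph t x ξ * f ξ = (∫ ξ, ph t x ξ * (cut ψ R ξ * f ξ))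
      + ∫ ξ, ph t x ξ * ((1 - cut ψ R ξ) * f ξ) := by
  have hk : Continuous (cut ψ R) :=
    Complex.continuous_ofReal.comp (hψ.smooth.continuous.comp (continuous_norm.div_const R))
  have hc := (hf.contDiff hs).continuous
  have hi1 : Integrable (fun ξ => ph t x ξ * (cut ψ R ξ * f ξ)) :=
    ((continuous_ph t x).mul (hk.mul hc)).integrable_of_hasCompactSupport
      ((hf.mul_left _).mul_left _).compact
  have hi2 : Integrable (fun ξ => ph t x ξ * ((1 - cut ψ R ξ) * f ξ)) :=
    ((continuous_ph t x).mul ((continuous_const.sub hk).mul hc)).integrable_of_hasCompactSupport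
      ((hf.mul_left _).mul_left _).compact
  rw [← integral_add hi1 hi2]
  exact integral_congr_ae (Eventually.of_forall fun ξ => by ring)

/-- Split at |ξ| ~ 1/d. Below, the order |ξ|⁻¹ integrates against the dispersive weight to O(1/d).
Above, two conformal integrations by parts give d⁻²|ξ|⁻³, which integrates to d⁻²·d = 1/d. One of
them would leave |ξ|⁻², for which the dyadic sum diverges logarithmically. -/
theorem exists_decay_near (hψ : IsCutoff ψ) : ∃ C, 0 ≤ C ∧ ∀ (t : ℝ) (x : E3), x ≠ 0 →
    0 < |(|t| - ‖x‖)| → ∀ (A : ℝ) (f : E3 → ℂ), 0 ≤ A → Away f → Good {0}ᶜ 2 (-1) A f →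
    ‖x‖ * ‖∫ ξ, ph t x ξ * f ξ‖ ≤ C * (A / |(|t| - ‖x‖)|) := by
  obtain ⟨C₀, hC₀, h₀⟩ := exists_dispersive_bounds
  obtain ⟨K, hK, hκ⟩ := exists_good_cutoff hψ.smooth hψ.hasCompactSupport 2
  obtain ⟨N₁, hN₁, hn₁⟩ := exists_good_confl 1
  obtain ⟨N₀, hN₀, hn₀⟩ := exists_good_confl 0
  refine ⟨C₀ * (2 * K * 2) + C₀ * (N₀ * (N₁ * (8 * (1 + 8 * K)))), by positivity,
    fun t x hx hd A f hA hf hgood => ?_⟩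
  have ho := isOpen_compl_zero
  have hz := zero_notMem_compl
  set d := |(|t| - ‖x‖)| with hdd
  set T := |t| + ‖x‖ with hT
  have hX : 0 < ‖x‖ := norm_pos_iff.2 hx
  have hT0 : 0 < T := by positivity
  have hR : 0 < 1 / d := by positivity
  have hcut : Good {0}ᶜ 2 0 K (cut ψ (1 / d)) := hκ (1 / d) hR
  have hhi : Good {0}ᶜ 2 0 (1 + 8 * K) (fun ξ => 1 - cut ψ (1 / d) ξ) := by
    have h := (Good.const (U := {0}ᶜ) (n := 2) zero_le_one (1 : ℂ) (by simp)).add ho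
      (((Good.const (U := {0}ᶜ) (n := 2) zero_le_one (-1 : ℂ) (by simp)).mul ho hz zero_le_one hK
        hcut))
    refine (h.mono_const (by norm_num)).congr ho fun ξ _ => by ring
  have hl : Good {0}ᶜ 0 (-1) (2 * (K * A)) (fun ξ => cut ψ (1 / d) ξ * f ξ) := by
    simpa using (hcut.mono_order (Nat.zero_le 2)).mul ho hz hK hA
      (hgood.mono_order (Nat.zero_le 2))
  have hh : Good {0}ᶜ 2 (-1) (8 * ((1 + 8 * K) * A)) (fun ξ => (1 - cut ψ (1 / d) ξ) * f ξ) := by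
    have := hhi.mul ho hz (by positivity) hA hgood
    norm_num at this ⊢
    exact this
  have hh1 := hn₁ t x (-1) _ _ (by positivity) hh
  have hh0 := hn₀ t x _ _ _ (by positivity) hh1
  have hlow := (h₀ t x hx _ (hf.mul_left _)).1 _ (2 * (1 / d)) (by positivity) (by positivity) hl
    fun ξ hξ => by rw [hψ.cut_eq_zero hR (by linarith), zero_mul]
  have hV : IsOpen {ξ : E3 | ‖ξ‖ < 5 / 4 * (1 / d)} := isOpen_lt continuous_norm continuous_const
  have hhigh := (h₀ t x hx _ (((hf.mul_left _).confl t x).confl t x)).2.1 _ (1 / d) (by positivity)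
    hR hh0 (confl_eq_zero hV (confl_eq_zero hV (fun ξ hξ => by
      rw [hψ.cut_eq_one hR (le_of_lt hξ), sub_self, zero_mul]) t x) t x)
  rw [← norm_integral_confl t x (hf.mul_left _) (hh.smooth.of_le (by norm_cast))
    (hh1.smooth.of_le (by norm_cast)), ← hdd, ← hT] at hhigh
  rw [hψ.integral_split t x (1 / d) hf (hgood.smooth.of_le (by norm_cast))]
  have hhigh' : ‖x‖ * ‖∫ ξ, ph t x ξ * ((1 - cut ψ (1 / d) ξ) * f ξ)‖
      ≤ C₀ * (N₀ * (N₁ * (8 * (1 + 8 * K)))) * (A / d) := by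
    have hpos : 0 < (d * T) ^ 2 := by positivity
    refine le_of_mul_le_mul_left ?_ hpos
    calc _ = ‖x‖ * ((d * T) ^ 2 * ‖∫ ξ, ph t x ξ * ((1 - cut ψ (1 / d) ξ) * f ξ)‖) := by ring
      _ ≤ _ := hhigh
      _ = _ := by field_simp
  calc _ ≤ ‖x‖ * (‖∫ ξ, ph t x ξ * (cut ψ (1 / d) ξ * f ξ)‖
          + ‖∫ ξ, ph t x ξ * ((1 - cut ψ (1 / d) ξ) * f ξ)‖) := by gcongr; exact norm_add_le _ _
    _ ≤ C₀ * (2 * (K * A) * (2 * (1 / d))) + C₀ * (N₀ * (N₁ * (8 * (1 + 8 * K)))) * (A / d) := by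
        rw [mul_add]; exact add_le_add hlow hhigh'
    _ = _ := by field_simp

/-- With |ξ|⁻¹ as the annular weight, absolute values suffice; the admissible orders drop by one,
from -1 and -3 to -2 and -4. -/
theorem exists_absolute_bounds : ∃ C, 0 ≤ C ∧ ∀ (t : ℝ) (x : E3) (G : E3 → ℂ),
    (∀ A ρ, 0 ≤ A → 0 < ρ → Ord {0}ᶜ 0 (-2) A G → (∀ ξ, 3 / 4 * ρ < ‖ξ‖ → G ξ = 0) →
      ‖∫ ξ, ph t x ξ * G ξ‖ ≤ C * (A * ρ)) ∧
    (∀ A ρ, 0 ≤ A → 0 < ρ → Ord {0}ᶜ 0 (-4) A G → (∀ ξ, ‖ξ‖ < 5 / 4 * ρ → G ξ = 0) →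
      ‖∫ ξ, ph t x ξ * G ξ‖ ≤ C * (A * (1 / ρ))) := by
  obtain ⟨C, hw⟩ := exists_ann_rinv
  have hC0 := C.coe_nonneg
  have hle : ∀ (t : ℝ) (x : E3) (G : E3 → ℂ) (B : E3 → ℝ) (S : ℝ), 0 ≤ S →
      (∀ ξ ≠ 0, ‖G ξ‖ ≤ ‖ξ‖ ^ (-1 : ℤ) * B ξ) →
      ∫⁻ ξ : E3, ENNReal.ofReal (‖ξ‖ ^ (-1 : ℤ)) * ENNReal.ofReal (B ξ) ≤ ENNReal.ofReal S →
      ‖∫ ξ, ph t x ξ * G ξ‖ ≤ S := by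
    intro t x G B S hS hB hle
    have : ENNReal.ofReal 1 * ‖∫ ξ, ph t x ξ * G ξ‖ₑ ≤ ENNReal.ofReal S := by
      rw [ENNReal.ofReal_one, one_mul]
      refine (enorm_integral_le_lintegral_enorm _).trans (le_trans (lintegral_mono_ae ?_) hle)
      filter_upwards [ae_ne_zero] with ξ hξ
      rw [← ofReal_norm, norm_mul, norm_ph, one_mul, ← ENNReal.ofReal_mul (by positivity)]
      exact ENNReal.ofReal_le_ofReal (hB ξ hξ)
    simpa using real_of_enorm_le zero_le_one hS this
  refine ⟨2 * C, by positivity, fun t x G => ⟨fun A ρ hA hρ hG hsupp => ?_,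
    fun A ρ hA hρ hG hsupp => ?_⟩⟩
  · refine (hle t x G _ _ (by positivity) (fun ξ hξ => ?_) (hw.low_indicator hρ hA)).trans
      (by have : 0 ≤ C * (A * ρ) := by positivity
          nlinarith)
    by_cases h : ‖ξ‖ < ρ
    · rw [Set.indicator_of_mem (show ξ ∈ {ξ : E3 | ξ ≠ 0 ∧ ‖ξ‖ < ρ} from ⟨hξ, h⟩)]
      refine (hG ξ hξ).trans_eq ?_
      rw [mul_left_comm, ← zpow_add₀ (norm_ne_zero_iff.2 hξ)]; norm_num
    · rw [hsupp ξ (by linarith), norm_zero]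
      exact mul_nonneg (by positivity) (Set.indicator_nonneg (fun _ _ => by positivity) _)
  · refine (hle t x G _ _ (by positivity) (fun ξ hξ => ?_) (hw.high_indicator hρ hA)).trans_eq
      (by ring)
    by_cases h : ρ ≤ ‖ξ‖
    · rw [Set.indicator_of_mem (show ξ ∈ {ξ : E3 | ρ ≤ ‖ξ‖} from h)]
      refine (hG ξ hξ).trans_eq ?_
      rw [mul_left_comm, ← zpow_add₀ (norm_ne_zero_iff.2 hξ)]; norm_num
    · rw [hsupp ξ (by linarith), norm_zero]
      exact mul_nonneg (by positivity) (Set.indicator_nonneg (fun _ _ => by positivity) _)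

/-- The splitting of `exists_decay_near` without the rotations: the extra power |ξ|⁻¹ of the
amplitude plays the role of the dispersive weight, so neither the factor |x| nor bounds on rotation
derivatives are involved. -/
theorem exists_decay_away (hψ : IsCutoff ψ) : ∃ C, 0 ≤ C ∧ ∀ (t : ℝ) (x : E3),
    0 < |(|t| - ‖x‖)| → ∀ (A : ℝ) (f : E3 → ℂ), 0 ≤ A → Away f → ContDiffOn ℝ 2 f {0}ᶜ →
    Ord {0}ᶜ 2 (-2) A f → ‖∫ ξ, ph t x ξ * f ξ‖ ≤ C * (A / |(|t| - ‖x‖)|) := by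
  obtain ⟨C₀, hC₀, h₀⟩ := exists_absolute_bounds
  obtain ⟨K, hK, hκ⟩ := exists_ord_cutoff hψ.smooth hψ.hasCompactSupport 2
  obtain ⟨N₁, hN₁, hn₁⟩ := exists_ord_confl 1
  obtain ⟨N₀, hN₀, hn₀⟩ := exists_ord_confl 0
  refine ⟨C₀ * (K * 2) + C₀ * (N₀ * (N₁ * (4 * (1 + K)))), by positivity,
    fun t x hd A f hA hf hs hord => ?_⟩
  have ho := isOpen_compl_zero
  have hz := zero_notMem_compl
  set d := |(|t| - ‖x‖)| with hdd
  set T := |t| + ‖x‖ with hT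
  have hT0 : 0 < T := by
    refine hd.trans_le ((abs_sub _ _).trans_eq ?_)
    rw [abs_abs, abs_norm]
  have hR : 0 < 1 / d := by positivity
  have hcut : Ord {0}ᶜ 2 0 K (cut ψ (1 / d)) := hκ (1 / d) hR
  have hcs : ContDiffOn ℝ 2 (cut ψ (1 / d)) {0}ᶜ := contDiffOn_cutoff hψ.smooth (1 / d) 2
  have hhi : Ord {0}ᶜ 2 0 (1 + K) (fun ξ => 1 - cut ψ (1 / d) ξ) :=
    (Ord.const (1 : ℂ) (by simp)).sub ho hcut
  have hl : Ord {0}ᶜ 0 (-2) (K * A) (fun ξ => cut ψ (1 / d) ξ * f ξ) := by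
    simpa using (hcut.mono_order (Nat.zero_le 2)).mul ho hz hK hA
      (hord.mono_order (Nat.zero_le 2))
  have hh : Ord {0}ᶜ 2 (-2) (4 * ((1 + K) * A)) (fun ξ => (1 - cut ψ (1 / d) ξ) * f ξ) := by
    have := hhi.mul ho hz (by positivity) hA hord
    norm_num at this ⊢
    exact this
  have hhs : ContDiffOn ℝ 2 (fun ξ => (1 - cut ψ (1 / d) ξ) * f ξ) {0}ᶜ :=
    (contDiffOn_const.sub hcs).mul hs
  have hhs1 : ContDiffOn ℝ 1 (confl t x (fun ξ => (1 - cut ψ (1 / d) ξ) * f ξ)) {0}ᶜ :=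
    (ContDiffOn.sum fun j _ => ((contDiffOn_const.mul (contDiffOn_om j)).add contDiffOn_const).mul
      (contDiffOn_pd ho (k := 1) (by exact_mod_cast hhs) j)).add
      (contDiffOn_const.mul (contDiffOn_rinv.mul (hhs.of_le (by norm_cast))))
  have hh1 := hn₁ t x (-2) _ _ (by positivity) hh
  have hh0 := hn₀ t x _ _ _ (by positivity) hh1
  have hlow := (h₀ t x _).1 _ (2 * (1 / d)) (by positivity) (by positivity) hl
    fun ξ hξ => by rw [hψ.cut_eq_zero hR (by linarith), zero_mul]
  have hV : IsOpen {ξ : E3 | ‖ξ‖ < 5 / 4 * (1 / d)} := isOpen_lt continuous_norm continuous_const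
  have hhigh := (h₀ t x _).2 _ (1 / d) (by positivity)
    hR hh0 (confl_eq_zero hV (confl_eq_zero hV (fun ξ hξ => by
      rw [hψ.cut_eq_one hR (le_of_lt hξ), sub_self, zero_mul]) t x) t x)
  rw [← norm_integral_confl t x (hf.mul_left _) (hhs.of_le (by norm_cast)) hhs1,
    ← hdd, ← hT] at hhigh
  rw [hψ.integral_split t x (1 / d) hf (hs.of_le (by norm_cast))]
  have hhigh' : ‖∫ ξ, ph t x ξ * ((1 - cut ψ (1 / d) ξ) * f ξ)‖
      ≤ C₀ * (N₀ * (N₁ * (4 * (1 + K)))) * (A / d) := by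
    have hpos : 0 < (d * T) ^ 2 := by positivity
    refine le_of_mul_le_mul_left ?_ hpos
    refine hhigh.trans_eq ?_
    field_simp
  calc _ ≤ ‖∫ ξ, ph t x ξ * (cut ψ (1 / d) ξ * f ξ)‖
          + ‖∫ ξ, ph t x ξ * ((1 - cut ψ (1 / d) ξ) * f ξ)‖ := norm_add_le _ _
    _ ≤ C₀ * ((K * A) * (2 * (1 / d))) + C₀ * (N₀ * (N₁ * (4 * (1 + K)))) * (A / d) :=
        add_le_add hlow hhigh'
    _ = _ := by field_simp

end

/-! ### Radial mollification and weak derivatives away from the origin -/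

section
open scoped Convolution

variable {F H g χ : E3 → ℂ} {ε A : ℝ} {p : ℤ}

/-- An unnormalized radial bump supported in the ball of radius `ε`. -/
def preBump (ε : ℝ) (ξ : E3) : ℝ := expNegInvGlue (1 - ‖ξ‖ ^ 2 / ε ^ 2)

/-- A radial mollifier at scale `ε`. -/
def bumpR (ε : ℝ) (ξ : E3) : ℝ := preBump ε ξ / ∫ η, preBump ε η

/-- The radial mollifier, complex valued. -/
def bump (ε : ℝ) (ξ : E3) : ℂ := (bumpR ε ξ : ℂ)

lemma contDiff_preBump (ε : ℝ) : ContDiff ℝ ∞ (preBump ε) :=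
  expNegInvGlue.contDiff.comp (contDiff_const.sub ((contDiff_norm_sq ℝ).div_const _))

lemma preBump_nonneg (ξ : E3) : 0 ≤ preBump ε ξ := expNegInvGlue.nonneg _

lemma preBump_eq_zero (hε : 0 < ε) {ξ : E3} (h : ε ≤ ‖ξ‖) : preBump ε ξ = 0 := by
  refine expNegInvGlue.zero_of_nonpos ?_
  have : 1 ≤ ‖ξ‖ ^ 2 / ε ^ 2 := (one_le_div (by positivity)).2 (by gcongr)
  linarith

lemma support_preBump (hε : 0 < ε) : Function.support (preBump ε) ⊆ Metric.ball 0 ε := by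
  intro ξ hξ
  rw [mem_ball_zero_iff]
  by_contra h
  exact hξ (preBump_eq_zero hε (not_lt.1 h))

lemma hasCompactSupport_preBump (hε : 0 < ε) : HasCompactSupport (preBump ε) :=
  HasCompactSupport.of_support_subset_isCompact (isCompact_closedBall 0 ε)
    ((support_preBump hε).trans Metric.ball_subset_closedBall)

lemma integral_preBump_pos (hε : 0 < ε) : 0 < ∫ η, preBump ε η :=
  (contDiff_preBump ε).continuous.integral_pos_of_hasCompactSupport_nonneg_nonzero
    (hasCompactSupport_preBump hε) (fun ξ => preBump_nonneg ξ) (x := 0)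
    (by simp [preBump, (expNegInvGlue.pos_of_pos one_pos).ne'])

lemma bumpR_nonneg (hε : 0 < ε) (ξ : E3) : 0 ≤ bumpR ε ξ :=
  div_nonneg (preBump_nonneg ξ) (integral_preBump_pos hε).le

lemma integral_bumpR (hε : 0 < ε) : ∫ ξ, bumpR ε ξ = 1 := by
  simp only [bumpR]
  rw [integral_div, div_self (integral_preBump_pos hε).ne']

lemma bumpR_eq_zero (hε : 0 < ε) {ξ : E3} (h : ε ≤ ‖ξ‖) : bumpR ε ξ = 0 := by
  rw [bumpR, preBump_eq_zero hε h, zero_div]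

lemma bump_eq_zero (hε : 0 < ε) {ξ : E3} (h : ε ≤ ‖ξ‖) : bump ε ξ = 0 := by
  rw [bump, bumpR_eq_zero hε h, Complex.ofReal_zero]

lemma contDiff_bumpR (ε : ℝ) : ContDiff ℝ ∞ (bumpR ε) := (contDiff_preBump ε).div_const _

lemma contDiff_bump (ε : ℝ) : ContDiff ℝ ∞ (bump ε) :=
  Complex.ofRealCLM.contDiff.comp (contDiff_bumpR ε)

lemma hasCompactSupport_bump (hε : 0 < ε) : HasCompactSupport (bump ε) :=
  HasCompactSupport.of_support_subset_isCompact (isCompact_closedBall 0 ε) fun ξ hξ => by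
    rw [mem_closedBall_zero_iff]
    by_contra h
    exact hξ (bump_eq_zero hε (not_le.1 h).le)

lemma integrable_bumpR (hε : 0 < ε) : Integrable (bumpR ε) :=
  ((contDiff_preBump ε).continuous.integrable_of_hasCompactSupport
    (hasCompactSupport_preBump hε)).div_const _

lemma norm_bump (hε : 0 < ε) (ξ : E3) : ‖bump ε ξ‖ = bumpR ε ξ := by
  rw [bump, Complex.norm_real, Real.norm_of_nonneg (bumpR_nonneg hε ξ)]

/-- Radiality in the form needed later: the gradient of the bump is parallel to ξ, so rotations
about the origin annihilate it. -/
lemma pd_bump (ε : ℝ) (ξ : E3) : ∃ c : ℂ, ∀ j, pd j (bump ε) ξ = c * ξ j := by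
  have h1 : HasFDerivAt (fun ξ : E3 => 1 - ‖ξ‖ ^ 2 / ε ^ 2)
      (-((ε ^ 2)⁻¹ • (2 • innerSL ℝ ξ)) : E3 →L[ℝ] ℝ) ξ := by
    have h := (hasStrictFDerivAt_norm_sq ξ).hasFDerivAt
    simpa [div_eq_mul_inv, mul_comm] using (h.const_mul (ε ^ 2)⁻¹).const_sub 1
  have h2 : HasDerivAt (fun s => ((expNegInvGlue s / ∫ η, preBump ε η : ℝ) : ℂ))
      ((deriv expNegInvGlue (1 - ‖ξ‖ ^ 2 / ε ^ 2) / ∫ η, preBump ε η : ℝ) : ℂ)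
      (1 - ‖ξ‖ ^ 2 / ε ^ 2) :=
    (((expNegInvGlue.contDiff (n := 1)).differentiable one_ne_zero
      _).hasDerivAt.div_const _).ofReal_comp
  have h3 := h2.hasFDerivAt.comp ξ h1
  change HasFDerivAt (bump ε) _ ξ at h3
  refine ⟨-2 * (ε ^ 2 : ℂ)⁻¹ *
    ((deriv expNegInvGlue (1 - ‖ξ‖ ^ 2 / ε ^ 2) / ∫ η, preBump ε η : ℝ) : ℂ), fun j => ?_⟩
  rw [pd, h3.fderiv]
  simp [inner_e]
  ring

/-- The mollification of `F` at scale `ε`. -/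
def mol (ε : ℝ) (F : E3 → ℂ) : E3 → ℂ :=
  F ⋆[ContinuousLinearMap.mul ℝ ℂ, volume] bump ε

lemma mol_apply (F : E3 → ℂ) (ξ : E3) : mol ε F ξ = ∫ η, F η * bump ε (ξ - η) := rfl

lemma contDiff_mol (hε : 0 < ε) (hF : LocallyIntegrable F) : ContDiff ℝ ∞ (mol ε F) :=
  (hasCompactSupport_bump hε).contDiff_convolution_right _ hF (contDiff_bump ε)

lemma pd_convolution {b : E3 → ℂ} (hb : ContDiff ℝ 1 b) (hc : HasCompactSupport b)
    (hF : LocallyIntegrable F) (j : Fin 3) :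
    pd j (F ⋆[ContinuousLinearMap.mul ℝ ℂ, volume] b)
      = F ⋆[ContinuousLinearMap.mul ℝ ℂ, volume] (pd j b) := by
  ext ξ
  rw [pd, (hc.hasFDerivAt_convolution_right _ hF hb ξ).fderiv,
    convolution_precompR_apply _ hF (hc.fderiv (𝕜 := ℝ)) (hb.continuous_fderiv one_ne_zero)]
  rfl

lemma contDiff_pd {b : E3 → ℂ} (hb : ContDiff ℝ ∞ b) (j : Fin 3) : ContDiff ℝ ∞ (pd j b) :=
  (hb.fderiv_right (m := ∞) (by simp)).clm_apply contDiff_const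

lemma hasCompactSupport_pd {b : E3 → ℂ} (hc : HasCompactSupport b) (j : Fin 3) :
    HasCompactSupport (pd j b) :=
  hc.of_isClosed_subset (isClosed_tsupport _)
    (closure_minimal (support_pd_subset j) (isClosed_tsupport _))

lemma pd_comp_sub_left {b : E3 → ℂ} (ξ : E3) (hb : Differentiable ℝ b) (j : Fin 3) :
    pd j (fun η => b (ξ - η)) = fun η => -pd j b (ξ - η) := by
  ext η
  have h : HasFDerivAt (fun η => ξ - η) (-(ContinuousLinearMap.id ℝ E3)) η := by
    simpa using (hasFDerivAt_id η).const_sub ξ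
  have := ((hb (ξ - η)).hasFDerivAt.comp η h).fderiv
  simp only [Function.comp_def] at this
  rw [pd, this]
  simp [pd]

lemma isTest_bump_sub (hε : 0 < ε) {ξ : E3} (hξ : 2 * ε < ‖ξ‖) :
    IsTest (fun η => bump ε (ξ - η)) := by
  have hsub : tsupport (fun η => bump ε (ξ - η)) ⊆ Metric.closedBall ξ ε := by
    refine closure_minimal (fun η hη => ?_) Metric.isClosed_closedBall
    rw [Metric.mem_closedBall, dist_comm, dist_eq_norm]
    by_contra h
    exact hη (bump_eq_zero hε (not_le.1 h).le)
  refine ⟨(contDiff_bump ε).comp (contDiff_const.sub contDiff_id),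
    (isCompact_closedBall ξ ε).of_isClosed_subset (isClosed_tsupport _) hsub, fun h => ?_⟩
  have := hsub h
  rw [Metric.mem_closedBall, dist_zero_left] at this
  linarith

/-- For |ξ| > 2ε the average runs over |η| ≥ |ξ|/2, so a power bound with exponent p ≤ 0 survives
with the loss 2^(-p). -/
lemma norm_mol_le (hε : 0 < ε) (hp : p ≤ 0) (hA : 0 ≤ A)
    (hF : ∀ᵐ η, ‖F η‖ ≤ A * ‖η‖ ^ p) {ξ : E3} (hξ : 2 * ε < ‖ξ‖) :
    ‖mol ε F ξ‖ ≤ 2 ^ (-p) * A * ‖ξ‖ ^ p := by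
  have hpos : 0 < ‖ξ‖ := by linarith
  have hint : Integrable fun η => (2 ^ (-p) * A * ‖ξ‖ ^ p) * bumpR ε (ξ - η) :=
    ((integrable_bumpR hε).comp_sub_left ξ).const_mul _
  have hval : ∫ η, (2 ^ (-p) * A * ‖ξ‖ ^ p) * bumpR ε (ξ - η) = 2 ^ (-p) * A * ‖ξ‖ ^ p := by
    rw [integral_const_mul, integral_sub_left_eq_self (bumpR ε) volume ξ, integral_bumpR hε,
      mul_one]
  rw [mol_apply, ← hval]
  refine norm_integral_le_of_norm_le hint ?_
  filter_upwards [hF] with η hη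
  rw [norm_mul, norm_bump hε]
  by_cases h : ε ≤ ‖ξ - η‖
  · rw [bumpR_eq_zero hε h, mul_zero, mul_zero]
  · have hη2 : ‖ξ‖ / 2 ≤ ‖η‖ := by
      have := norm_sub_norm_le ξ η
      linarith [not_le.1 h]
    refine mul_le_mul_of_nonneg_right (hη.trans ?_) (bumpR_nonneg hε _)
    calc A * ‖η‖ ^ p ≤ A * (‖ξ‖ / 2) ^ p := by
          gcongr A * ?_
          obtain ⟨n, rfl⟩ := Int.exists_eq_neg_ofNat hp
          simp only [zpow_neg, zpow_natCast]
          gcongr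
      _ = _ := by
          rw [div_zpow, zpow_neg]; field_simp

lemma partials_succ {n : ℕ} {f : E3 → ℂ} {ξ : E3} (w : Fin (n + 1) → Fin 3)
    (hf : ContDiffAt ℝ (n + 1) f ξ) :
    partials w f ξ = pd (w 0) (partials (Fin.tail w) f) ξ := by
  have hd : DifferentiableAt ℝ (iteratedFDeriv ℝ n f) ξ :=
    hf.differentiableAt_iteratedFDeriv (by exact_mod_cast n.lt_succ_self)
  simp only [partials, pd, iteratedFDeriv_succ_apply_left]
  have := (hd.hasFDerivAt.continuousMultilinear_apply_const
    (fun i : Fin n => e (Fin.tail w i))).fderiv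
  change _ = fderiv ℝ (fun y => iteratedFDeriv ℝ n f y fun i => e (Fin.tail w i)) ξ (e (w 0))
  rw [this]
  rfl

lemma partials_succ_right {n : ℕ} {f : E3 → ℂ} {ξ : E3} (w : Fin n → Fin 3) (j : Fin 3)
    (hf : ContDiffAt ℝ (n + 1) f ξ) :
    partials (Fin.snoc w j : Fin (n + 1) → Fin 3) f ξ = partials w (pd j f) ξ := by
  have hd : ContDiffAt ℝ n (fderiv ℝ f) ξ := hf.fderiv_right le_rfl
  have h := (ContinuousLinearMap.apply ℝ ℂ (e j)).iteratedFDeriv_comp_left hd (i := n) le_rfl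
  simp only [partials, iteratedFDeriv_succ_apply_right]
  have h2 : pd j f = ContinuousLinearMap.apply ℝ ℂ (e j) ∘ fderiv ℝ f := rfl
  have h4 : (Fin.init fun i => e ((Fin.snoc w j : Fin (n + 1) → Fin 3) i)) = fun i => e (w i) := by
    ext i : 1
    simp [Fin.init]
  rw [h2, h, h4]
  simp

lemma partials_zero (w : Fin 0 → Fin 3) (f : E3 → ℂ) : partials w f = f := by
  ext ξ; simp [partials]

lemma contDiff_partials {n : ℕ} {f : E3 → ℂ} (w : Fin n → Fin 3) (hf : ContDiff ℝ ∞ f) :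
    ContDiff ℝ ∞ (partials w f) := by
  induction n with
  | zero => rwa [partials_zero]
  | succ n ih =>
    have : partials w f = pd (w 0) (partials (Fin.tail w) f) := by
      ext ξ; exact partials_succ w (hf.contDiffAt.of_le (by exact_mod_cast le_top))
    rw [this]
    exact contDiff_pd (ih _) _

lemma partials_succ_eq {n : ℕ} {f : E3 → ℂ} (w : Fin (n + 1) → Fin 3) (hf : ContDiff ℝ ∞ f) :
    partials w f = pd (w 0) (partials (Fin.tail w) f) := by
  ext ξ; exact partials_succ w (hf.contDiffAt.of_le (by exact_mod_cast le_top))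

lemma hasCompactSupport_partials {n : ℕ} {f : E3 → ℂ} (w : Fin n → Fin 3)
    (hf : ContDiff ℝ ∞ f) (hc : HasCompactSupport f) : HasCompactSupport (partials w f) := by
  induction n with
  | zero => rwa [partials_zero]
  | succ n ih =>
    rw [partials_succ_eq w hf]
    exact hasCompactSupport_pd (ih _) _

lemma partials_convolution {n : ℕ} {b : E3 → ℂ} (w : Fin n → Fin 3) (hb : ContDiff ℝ ∞ b)
    (hc : HasCompactSupport b) (hF : LocallyIntegrable F) :
    partials w (F ⋆[ContinuousLinearMap.mul ℝ ℂ, volume] b)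
      = F ⋆[ContinuousLinearMap.mul ℝ ℂ, volume] (partials w b) := by
  induction n with
  | zero => simp only [partials_zero]
  | succ n ih =>
    rw [partials_succ_eq w (hc.contDiff_convolution_right _ hF hb), ih, partials_succ_eq w hb,
      pd_convolution ((contDiff_partials _ hb).of_le (by simp))
        (hasCompactSupport_partials _ hb hc) hF]

lemma partials_comp_sub_left {n : ℕ} {b : E3 → ℂ} (w : Fin n → Fin 3) (ξ : E3)
    (hb : ContDiff ℝ ∞ b) :
    partials w (fun η => b (ξ - η)) = fun η => (-1 : ℂ) ^ n * partials w b (ξ - η) := by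
  induction n with
  | zero => simp only [partials_zero, pow_zero, one_mul]
  | succ n ih =>
    have h1 : ContDiff ℝ ∞ (fun η => b (ξ - η)) := hb.comp (contDiff_const.sub contDiff_id)
    have h2 := contDiff_partials (Fin.tail w) hb
    have hd : Differentiable ℝ (partials (Fin.tail w) b) := h2.differentiable (by simp)
    have h3 := pd_comp_sub_left ξ hd (w 0)
    rw [partials_succ_eq w h1, ih, partials_succ_eq w hb]
    ext η
    rw [pd_const_mul, h3]
    swap
    · exact (hd _).comp _ (differentiableAt_id.const_sub ξ)
    ring

/-- For |ξ| > 2ε the translated bump is supported away from 0 and is an admissible test function.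
Its reflection in the integration variable cancels the sign (-1)^n. -/
lemma IsWeakDeriv.partials_mol {n : ℕ} {w : Fin n → Fin 3} {D : E3 → ℂ} (h : IsWeakDeriv w F D)
    (hε : 0 < ε) (hF : LocallyIntegrable F) {ξ : E3} (hξ : 2 * ε < ‖ξ‖) :
    partials w (mol ε F) ξ = mol ε D ξ := by
  have h1 := h.pairing _ (isTest_bump_sub hε hξ)
  rw [partials_comp_sub_left w ξ (contDiff_bump ε)] at h1
  rw [mol, partials_convolution w (contDiff_bump ε) (hasCompactSupport_bump hε) hF, mol_apply]
  change ∫ η, F η * partials w (bump ε) (ξ - η) = _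
  simp only [mul_left_comm (F _)] at h1
  rw [integral_const_mul] at h1
  exact mul_left_cancel₀ (pow_ne_zero n (by norm_num)) h1

/-- `H` is the weak derivative of `F` along the rotation field `rot i` away from the origin. -/
def WeakRot (i : Fin 3) (F H : E3 → ℂ) : Prop :=
  ∀ χ, IsTest χ → ∫ ξ, F ξ * rot i χ ξ = -∫ ξ, H ξ * χ ξ

/-- Rotations have variable coefficients, so a general mollifier would leave a commutator with
coefficients (ξ - η)_a. It is the rotation of the bump at ξ - η, which vanishes by `pd_bump`. -/
lemma WeakRot.rot_mol {i : Fin 3} (h : WeakRot i F H)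
    (hε : 0 < ε) (hF : LocallyIntegrable F) {ξ : E3} (hξ : 2 * ε < ‖ξ‖) :
    WaveDecay.rot i (mol ε F) ξ = mol ε H ξ := by
  have h1 := h _ (isTest_bump_sub hε hξ)
  have hcl : ∀ j, Integrable fun η => F η * pd j (bump ε) (ξ - η) := fun j =>
    (hasCompactSupport_pd (hasCompactSupport_bump hε) j).convolutionExists_right
      (ContinuousLinearMap.mul ℝ ℂ) hF (contDiff_pd (contDiff_bump ε) j).continuous ξ
  have hp : ∀ j, pd j (mol ε F) ξ = ∫ η, F η * pd j (bump ε) (ξ - η) := fun j => by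
    rw [mol, pd_convolution ((contDiff_bump ε).of_le (by simp)) (hasCompactSupport_bump hε) hF]
    rfl
  rw [rot, hp, hp, ← integral_const_mul, ← integral_const_mul,
    ← integral_sub ((hcl _).const_mul _) ((hcl _).const_mul _), mol_apply, ← neg_inj, ← h1,
    ← integral_neg]
  congr 1
  ext η
  obtain ⟨c, hc⟩ := pd_bump ε (ξ - η)
  have hd : Differentiable ℝ (bump ε) := (contDiff_bump ε).differentiable (by simp)
  simp only [rot, pd_comp_sub_left ξ hd, hc, PiLp.sub_apply, Complex.ofReal_sub]
  ring

lemma ord_of_partials {U : Set E3} (hU : IsOpen U) {n : ℕ} {p : ℤ} {A : ℝ} {f : E3 → ℂ}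
    (hf : ContDiffOn ℝ n f U)
    (h : ∀ k ≤ n, ∀ w : Fin k → Fin 3, ∀ ξ ∈ U, ‖partials w f ξ‖ ≤ A * ‖ξ‖ ^ (p - k)) :
    Ord U n p A f := by
  induction n generalizing p f with
  | zero => exact fun ξ hξ => by simpa [partials_zero] using! h 0 le_rfl Fin.elim0 ξ hξ
  | succ n ih =>
    have hat : ∀ ξ ∈ U, ContDiffAt ℝ (n + 1) f ξ := fun ξ hξ => by
      exact_mod_cast hf.contDiffAt (hU.mem_nhds hξ)
    refine ⟨fun ξ hξ => (hat ξ hξ).differentiableAt (by simp),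
      fun ξ hξ => by simpa [partials_zero] using! h 0 (Nat.zero_le _) Fin.elim0 ξ hξ, fun j => ?_⟩
    refine ih (contDiffOn_pd hU (by exact_mod_cast hf) j) fun k hk w ξ hξ => ?_
    rw [← partials_succ_right w j ((hat ξ hξ).of_le (by exact_mod_cast Nat.succ_le_succ hk))]
    convert h (k + 1) (Nat.succ_le_succ hk) (Fin.snoc w j) ξ hξ using 3
    push_cast; ring

end

/-! ### Removing the mollification: decay for weakly differentiable profiles -/

section
open scoped Convolution

variable {F M g : E3 → ℂ} {H : Fin 3 → E3 → ℂ} {ε A B ρ : ℝ} {n : ℕ} {p q : ℤ} {t : ℝ} {x : E3}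

lemma bump_neg (ξ : E3) : bump ε (-ξ) = bump ε ξ := by
  simp [bump, bumpR, preBump]

/-- Fubini and the evenness of the bump. As F is only locally integrable, it is first cut off to the
ε-neighbourhood of the support of g, which does not change the integrand. -/
lemma integral_mul_mol (hε : 0 < ε) (hF : LocallyIntegrable F) (hg : Continuous g)
    (hc : HasCompactSupport g) : ∫ ξ, g ξ * mol ε F ξ = ∫ η, mol ε g η * F η := by
  set K : Set E3 := Metric.cthickening ε (tsupport g)
  have hKc : IsCompact K := hc.cthickening
  have hFK : Integrable (K.indicator F) :=
    (hF.integrableOn_isCompact hKc).integrable_indicator hKc.measurableSet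
  have heq : ∀ ξ η, g ξ * (F η * bump ε (ξ - η)) = bump ε (ξ - η) * (g ξ * K.indicator F η) := by
    intro ξ η
    by_cases hη : η ∈ K
    · rw [Set.indicator_of_mem hη]; ring
    · rw [Set.indicator_of_notMem hη]
      by_cases hξ : g ξ = 0
      · simp [hξ]
      · rw [bump_eq_zero hε (ξ := ξ - η)]
        · simp
        · by_contra h
          refine hη (Metric.mem_cthickening_of_dist_le η ξ ε _ (subset_tsupport _ hξ) ?_)
          rw [dist_comm, dist_eq_norm]; exact (not_le.1 h).le
  have hint : Integrable (Function.uncurry fun ξ η => g ξ * (F η * bump ε (ξ - η)))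
      (volume.prod volume) := by
    obtain ⟨b, hb⟩ := (contDiff_bump ε).continuous.bounded_above_of_compact_support
      (hasCompactSupport_bump hε)
    have h1 := (hg.integrable_of_hasCompactSupport hc (μ := volume)).mul_prod hFK
    have h2 := h1.bdd_mul (f := fun z : E3 × E3 => bump ε (z.1 - z.2)) (c := b)
      ((contDiff_bump ε).continuous.comp
        (continuous_fst.sub continuous_snd)).aestronglyMeasurable (Eventually.of_forall fun z => hb _)
    exact h2.congr (Eventually.of_forall fun z => (heq z.1 z.2).symm)
  calc ∫ ξ, g ξ * mol ε F ξ = ∫ ξ, ∫ η, g ξ * (F η * bump ε (ξ - η)) := by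
        simp only [mol_apply, integral_const_mul]
    _ = ∫ η, ∫ ξ, g ξ * (F η * bump ε (ξ - η)) := integral_integral_swap hint
    _ = ∫ η, mol ε g η * F η := by
        congr 1; ext η
        rw [mol_apply, ← integral_mul_const]
        congr 1; ext ξ
        rw [← neg_sub η ξ, bump_neg]; ring

lemma tendsto_mol (hg : Continuous g) (ξ : E3) :
    Tendsto (fun ε => mol ε g ξ) (𝓝[>] 0) (𝓝 (g ξ)) := by
  have h := convolution_tendsto_right (μ := (volume : Measure E3)) (φ := fun ε : ℝ => bumpR ε)
    (g := fun _ : ℝ => g) (k := fun _ => ξ) (x₀ := ξ) (z₀ := g ξ) (l := 𝓝[>] (0 : ℝ))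
    (by filter_upwards [self_mem_nhdsWithin] with ε hε using bumpR_nonneg hε)
    (by filter_upwards [self_mem_nhdsWithin] with ε hε using integral_bumpR hε) ?_
    (Eventually.of_forall fun _ => hg.aestronglyMeasurable)
    ((hg.tendsto ξ).comp tendsto_snd) tendsto_const_nhds
  · refine h.congr' (Eventually.of_forall fun ε => ?_)
    dsimp only
    rw [mol_apply, ← integral_sub_left_eq_self _ volume ξ]
    simp [convolution, bump, mul_comm]
  · refine tendsto_smallSets_iff.2 fun s hs => ?_
    obtain ⟨δ, hδ, hs⟩ := Metric.mem_nhds_iff.1 hs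
    filter_upwards [Ioo_mem_nhdsGT hδ] with ε hε
    refine fun η hη => hs ?_
    rw [mem_ball_zero_iff]
    by_contra h
    exact hη (bumpR_eq_zero hε.1 (hε.2.le.trans (not_lt.1 h)))

lemma norm_mol_le_of_bound {b : ℝ} (hε : 0 < ε) (hb : ∀ ξ, ‖g ξ‖ ≤ b) (ξ : E3) :
    ‖mol ε g ξ‖ ≤ b := by
  have hint : Integrable fun η => b * bumpR ε (ξ - η) :=
    ((integrable_bumpR hε).comp_sub_left ξ).const_mul _
  have hval : ∫ η, b * bumpR ε (ξ - η) = b := by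
    rw [integral_const_mul, integral_sub_left_eq_self (bumpR ε) volume ξ, integral_bumpR hε,
      mul_one]
  rw [mol_apply, ← hval]
  refine norm_integral_le_of_norm_le hint (Eventually.of_forall fun η => ?_)
  rw [norm_mul, norm_bump hε]
  exact mul_le_mul_of_nonneg_right (hb η) (bumpR_nonneg hε _)

/-- The mollifier is moved onto the continuous factor g, where convergence is pointwise and
uniformly bounded; F then only has to be integrable on a fixed compact set. -/
theorem tendsto_integral_mul_mol (hF : LocallyIntegrable F) (hg : Continuous g)
    (hc : HasCompactSupport g) :
    Tendsto (fun ε => ∫ ξ, g ξ * mol ε F ξ) (𝓝[>] 0) (𝓝 (∫ ξ, g ξ * F ξ)) := by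
  set K : Set E3 := Metric.cthickening 1 (tsupport g)
  have hKc : IsCompact K := hc.cthickening
  have hFK : Integrable (K.indicator F) :=
    (hF.integrableOn_isCompact hKc).integrable_indicator hKc.measurableSet
  obtain ⟨b, hb⟩ := hg.bounded_above_of_compact_support hc
  have h : Tendsto (fun ε => ∫ ξ, mol ε g ξ * F ξ) (𝓝[>] 0) (𝓝 (∫ ξ, g ξ * F ξ)) := by
    refine tendsto_integral_filter_of_dominated_convergence (fun ξ => b * ‖K.indicator F ξ‖)
      ?_ ?_ (hFK.norm.const_mul b)
      (Eventually.of_forall fun ξ => (tendsto_mol hg ξ).mul_const _)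
    · filter_upwards [self_mem_nhdsWithin] with ε hε
      exact (contDiff_mol hε hg.locallyIntegrable).continuous.aestronglyMeasurable.mul
        hF.aestronglyMeasurable
    · filter_upwards [Ioo_mem_nhdsGT one_pos] with ε hε
      refine Eventually.of_forall fun ξ => ?_
      rw [norm_mul]
      by_cases hξ : ξ ∈ K
      · rw [Set.indicator_of_mem hξ]
        gcongr
        exact norm_mol_le_of_bound hε.1 hb ξ
      · have : mol ε g ξ = 0 := by
          rw [mol_apply]
          refine integral_eq_zero_of_ae (Eventually.of_forall fun η => ?_)
          by_cases hη : g η = 0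
          · simp [hη]
          · dsimp only
            rw [bump_eq_zero hε.1 (ξ := ξ - η)]
            · simp
            · by_contra h
              refine hξ (Metric.mem_cthickening_of_dist_le ξ η 1 _ (subset_tsupport _ hη) ?_)
              rw [dist_eq_norm]; linarith [hε.2, not_le.1 h]
        have hb0 : 0 ≤ b := (norm_nonneg _).trans (hb 0)
        rw [this, norm_zero, zero_mul]; positivity
  refine h.congr' ?_
  filter_upwards [self_mem_nhdsWithin] with ε hε
  exact (integral_mul_mol hε hF hg hc).symm

/-- All weak derivatives of `F` of order `k ≤ n` exist and are bounded by `A |ξ|^(p-k)`. -/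
def WeakOrd (n : ℕ) (p : ℤ) (A : ℝ) (F : E3 → ℂ) : Prop :=
  ∀ k ≤ n, ∀ w : Fin k → Fin 3, ∃ D, IsWeakDeriv w F D ∧ ∀ᵐ ξ, ‖D ξ‖ ≤ A * ‖ξ‖ ^ (p - k)

lemma WeakOrd.mono_const (hAB : A ≤ B) (h : WeakOrd n p A F) : WeakOrd n p B F :=
  fun k hk w => (h k hk w).imp fun _ hD => ⟨hD.1, hD.2.mono fun _ hξ => hξ.trans (by gcongr)⟩

lemma isOpen_lt_norm (c : ℝ) : IsOpen {ξ : E3 | c < ‖ξ‖} := isOpen_lt continuous_const continuous_norm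

lemma WeakOrd.ord_mol (hε : 0 < ε) (hA : 0 ≤ A) (hp : p ≤ 0) (hF : LocallyIntegrable F)
    (h : WeakOrd n p A F) :
    Ord {ξ | 2 * ε < ‖ξ‖} n p (2 ^ ((n : ℤ) - p) * A) (mol ε F) := by
  refine ord_of_partials (isOpen_lt_norm _) ((contDiff_mol hε hF).of_le
    (by exact_mod_cast le_top)).contDiffOn fun k hk w ξ hξ => ?_
  obtain ⟨D, hD, hb⟩ := h k hk w
  rw [hD.partials_mol hε hF hξ]
  refine (norm_mol_le hε (by omega) hA hb hξ).trans ?_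
  gcongr
  · norm_num
  · omega

lemma WeakOrd.good_mol (hε : 0 < ε) (hA : 0 ≤ A) (hp : p ≤ 0) (hF : LocallyIntegrable F)
    (h : WeakOrd n p A F) (hr : ∀ i, WeakRot i F (H i)) (hH : ∀ i, LocallyIntegrable (H i))
    (hHo : ∀ i, WeakOrd n p A (H i)) :
    Good {ξ | 2 * ε < ‖ξ‖} n p (2 ^ ((n : ℤ) - p) * A) (mol ε F) :=
  ⟨((contDiff_mol hε hF).of_le (by exact_mod_cast le_top)).contDiffOn, h.ord_mol hε hA hp hF,
    fun i => ((hHo i).ord_mol hε hA hp (hH i)).congr (isOpen_lt_norm _)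
      fun _ hξ => ((hr i).rot_mol hε hF hξ).symm⟩

lemma Away.exists_radius (hM : Away M) : ∃ ρ > 0, ∀ ξ, ‖ξ‖ < ρ → M ξ = 0 := by
  obtain ⟨ρ, hρ, h⟩ := Metric.eventually_nhds_iff.1 hM.eventually_eq_zero
  exact ⟨ρ, hρ, fun ξ hξ => h (by simpa using hξ)⟩

lemma compl_zero_eq (h2 : 2 * ε < ρ) (hε : 0 < ε) :
    ({0}ᶜ : Set E3) = {ξ | 2 * ε < ‖ξ‖} ∪ ({ξ | ‖ξ‖ < ρ} ∩ {0}ᶜ) := by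
  ext ξ
  simp only [Set.mem_compl_iff, Set.mem_singleton_iff, Set.mem_union, Set.mem_ofPred_eq,
    Set.mem_inter_iff]
  constructor
  · intro h
    rcases lt_or_ge (2 * ε) ‖ξ‖ with h' | h'
    · exact Or.inl h'
    · exact Or.inr ⟨by linarith, h⟩
  · rintro (h | h)
    · exact norm_pos_iff.1 (by linarith)
    · exact h.2

/-- Mollified profiles are controlled only for |ξ| > 2ε. A symbol vanishing for |ξ| < ρ with ρ > 2ε
makes the product zero on the remaining region, and the two open sets cover ℝ³ ∖ {0}. -/
lemma Ord.mul_of_vanish (hB : 0 ≤ B) (hA : 0 ≤ A) (hM : Ord {0}ᶜ n p B M)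
    (hz : ∀ ξ, ‖ξ‖ < ρ → M ξ = 0) (hε : 0 < ε) (h2 : 2 * ε < ρ)
    (hg : Ord {ξ | 2 * ε < ‖ξ‖} n q A g) :
    Ord {0}ᶜ n (p + q) (2 ^ n * (B * A)) (fun ξ => M ξ * g ξ) := by
  have hs : {ξ : E3 | 2 * ε < ‖ξ‖} ⊆ {0}ᶜ := fun ξ hξ => by
    have : 0 < ‖ξ‖ := lt_trans (by positivity) hξ
    simpa using this
  have ho : IsOpen ({ξ : E3 | ‖ξ‖ < ρ} ∩ {0}ᶜ) :=
    (isOpen_lt continuous_norm continuous_const).inter isOpen_compl_zero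
  rw [compl_zero_eq h2 hε]
  refine ((hM.mono_set hs).mul (isOpen_lt_norm _) (fun h => hs h rfl) hB hA hg).union ?_
  exact (Ord.zero (by positivity)).congr ho fun ξ hξ => by simp [hz ξ hξ.1]

lemma Good.mul_of_vanish (hB : 0 ≤ B) (hA : 0 ≤ A) (hM : Good {0}ᶜ n p B M)
    (hz : ∀ ξ, ‖ξ‖ < ρ → M ξ = 0) (hε : 0 < ε) (h2 : 2 * ε < ρ)
    (hg : Good {ξ | 2 * ε < ‖ξ‖} n q A g) :
    Good {0}ᶜ n (p + q) (2 ^ (n + 1) * (B * A)) (fun ξ => M ξ * g ξ) := by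
  have hs : {ξ : E3 | 2 * ε < ‖ξ‖} ⊆ {0}ᶜ := fun ξ hξ => by
    have : 0 < ‖ξ‖ := lt_trans (by positivity) hξ
    simpa using this
  have ho : IsOpen ({ξ : E3 | ‖ξ‖ < ρ} ∩ {0}ᶜ) :=
    (isOpen_lt continuous_norm continuous_const).inter isOpen_compl_zero
  have h1 : Good {ξ | 2 * ε < ‖ξ‖} n p B M :=
    ⟨hM.smooth.mono hs, hM.ord.mono_set hs, fun i => (hM.rot i).mono_set hs⟩
  have h3 := h1.mul (isOpen_lt_norm _) (fun h => hs h rfl) hB hA hg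
  have h4 : Good ({ξ : E3 | ‖ξ‖ < ρ} ∩ {0}ᶜ) n (p + q) (2 ^ (n + 1) * (B * A))
      (fun ξ => M ξ * g ξ) := by
    have : Good ({ξ : E3 | ‖ξ‖ < ρ} ∩ {0}ᶜ) n (p + q) (2 ^ (n + 1) * (B * A)) (fun _ => 0) := by
      refine ⟨contDiffOn_const, Ord.zero (by positivity), fun i => ?_⟩
      have : WaveDecay.rot i (fun _ => (0 : ℂ)) = fun _ => 0 := by
        ext ξ; simp [WaveDecay.rot, WaveDecay.pd]
      rw [this]; exact Ord.zero (by positivity)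
    exact this.congr ho fun ξ hξ => by simp [hz ξ hξ.1]
  rw [compl_zero_eq h2 hε]
  exact ⟨h3.smooth.union_of_isOpen h4.smooth (isOpen_lt_norm _) ho, h3.ord.union h4.ord,
    fun i => (h3.rot i).union (h4.rot i)⟩

lemma norm_integral_le_of_mol (hM : Away M) (hMc : ContDiffOn ℝ 0 M {0}ᶜ)
    (hF : LocallyIntegrable F) {c b : ℝ}
    (h : ∀ᶠ ε in 𝓝[>] 0, c * ‖∫ ξ, ph t x ξ * (M ξ * mol ε F ξ)‖ ≤ b) :
    c * ‖∫ ξ, ph t x ξ * (M ξ * F ξ)‖ ≤ b := by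
  have hMc := (hM.contDiff hMc).continuous
  have := tendsto_integral_mul_mol hF ((continuous_ph t x).mul hMc) (hM.mul_left _).compact
  simp only [Pi.mul_apply, mul_assoc] at this
  exact le_of_tendsto (this.norm.const_mul c) h

variable {ψ : ℝ → ℝ}

/-- Decay with weight `|x|`, for weakly differentiable profiles. -/
theorem exists_weak_decay_near (hψ : IsCutoff ψ) : ∃ C, 0 ≤ C ∧ ∀ (t : ℝ) (x : E3), x ≠ 0 →
    0 < |(|t| - ‖x‖)| → ∀ (A B : ℝ) (M F : E3 → ℂ) (H : Fin 3 → E3 → ℂ), 0 ≤ A → 0 ≤ B →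
    Away M → Good {0}ᶜ 2 0 B M → LocallyIntegrable F → (∀ i, LocallyIntegrable (H i)) →
    WeakOrd 2 (-1) A F → (∀ i, WeakRot i F (H i)) → (∀ i, WeakOrd 2 (-1) A (H i)) →
    ‖x‖ * ‖∫ ξ, ph t x ξ * (M ξ * F ξ)‖ ≤ C * (B * A / |(|t| - ‖x‖)|) := by
  obtain ⟨C, hC, h⟩ := exists_decay_near hψ
  refine ⟨C * 64, by positivity, fun t x hx hd A B M F H hA hB hM hMg hF hH hFo hr hHo => ?_⟩
  obtain ⟨ρ, hρ, hz⟩ := hM.exists_radius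
  refine norm_integral_le_of_mol hM (hMg.smooth.of_le (by simp)) hF ?_
  filter_upwards [Ioo_mem_nhdsGT (by positivity : 0 < ρ / 2)] with ε hε
  have hg := hMg.mul_of_vanish hB (by positivity) hz hε.1 (by linarith [hε.2])
    (hFo.good_mol hε.1 hA (by norm_num) hF hr hH hHo)
  -- 64 = 2³·2³: the product rule in `Good.mul_of_vanish` and the mollification loss 2^(2-(-1)). The
  -- constant is independent of ε, so the limit can be taken.
  refine (h t x hx hd (64 * (B * A)) _ (by positivity) (hM.mul_right _) ?_).trans (le_of_eq ?_)
  · convert! hg using 1; norm_num; ring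
  ring

/-- Decay for weakly differentiable profiles. -/
theorem exists_weak_decay_away (hψ : IsCutoff ψ) : ∃ C, 0 ≤ C ∧ ∀ (t : ℝ) (x : E3),
    0 < |(|t| - ‖x‖)| → ∀ (A B : ℝ) (M F : E3 → ℂ), 0 ≤ A → 0 ≤ B →
    Away M → ContDiffOn ℝ 2 M {0}ᶜ → Ord {0}ᶜ 2 (-1) B M → LocallyIntegrable F →
    WeakOrd 2 (-1) A F → ‖∫ ξ, ph t x ξ * (M ξ * F ξ)‖ ≤ C * (B * A / |(|t| - ‖x‖)|) := by
  obtain ⟨C, hC, h⟩ := exists_decay_away hψ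
  refine ⟨C * 32, by positivity, fun t x hd A B M F hA hB hM hMs hMo hF hFo => ?_⟩
  obtain ⟨ρ, hρ, hz⟩ := hM.exists_radius
  rw [← one_mul ‖_‖]
  refine norm_integral_le_of_mol hM (hMs.of_le (by simp)) hF ?_
  filter_upwards [Ioo_mem_nhdsGT (by positivity : 0 < ρ / 2)] with ε hε
  have hg := hMo.mul_of_vanish hB (by positivity) hz hε.1 (by linarith [hε.2])
    (hFo.ord_mol hε.1 hA (by norm_num) hF)
  rw [one_mul]
  refine (h t x hd (32 * (B * A)) _ (by positivity) (hM.mul_right _)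
    (hMs.mul ((contDiff_mol hε.1 hF).of_le ENat.LEInfty.out).contDiffOn) ?_).trans (le_of_eq ?_)
  · convert! hg using 1; norm_num; ring
  ring

/-- Boundedness with weight `|x|`, for profiles with one weak rotation derivative. -/
theorem exists_weak_dispersive : ∃ C, 0 ≤ C ∧ ∀ (t : ℝ) (x : E3), x ≠ 0 →
    ∀ (A B : ℝ) (M F : E3 → ℂ) (H : Fin 3 → E3 → ℂ), 0 ≤ A → 0 ≤ B →
    Away M → Good {0}ᶜ 0 0 B M → LocallyIntegrable F → (∀ i, LocallyIntegrable (H i)) →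
    (∀ i, WeakRot i F (H i)) →
    WeakOrd 0 (-1) A F → (∀ i, WeakOrd 0 (-1) A (H i)) →
    WeakOrd 0 (-3) A F → (∀ i, WeakOrd 0 (-3) A (H i)) →
    ‖x‖ * ‖∫ ξ, ph t x ξ * (M ξ * F ξ)‖ ≤ C * (B * A) := by
  obtain ⟨C, hC, h⟩ := exists_dispersive_bounds
  refine ⟨C * 16, by positivity, fun t x hx A B M F H hA hB hM hMg hF hH hr h1 h1' h3 h3' => ?_⟩
  obtain ⟨ρ, hρ, hz⟩ := hM.exists_radius
  refine norm_integral_le_of_mol hM (hMg.smooth.of_le (by simp)) hF ?_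
  filter_upwards [Ioo_mem_nhdsGT (by positivity : 0 < ρ / 2)] with ε hε
  have hg1 := hMg.mul_of_vanish hB (by positivity) hz hε.1 (by linarith [hε.2])
    (h1.good_mol hε.1 hA (by norm_num) hF hr hH h1')
  have hg3 := hMg.mul_of_vanish hB (by positivity) hz hε.1 (by linarith [hε.2])
    (h3.good_mol hε.1 hA (by norm_num) hF hr hH h3')
  have hBA : 0 ≤ B * A := by positivity
  refine ((h t x hx _ (hM.mul_right _)).2.2 (16 * (B * A)) (by positivity) ?_ ?_).trans
    (le_of_eq (by ring))
  · simpa using hg1.mono_const (B := 16 * (B * A)) (by norm_num; linarith)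
  · simpa using hg3.mono_const (B := 16 * (B * A)) (by norm_num; linarith)

end

/-! ### From the X_n norms to pointwise bounds -/

section
open scoped FourierTransform

variable {ψ : ℝ → ℝ} {F f m : E3 → ℂ} {E S : ℝ} {n : ℕ} {p q : ℤ}

/-- The sum telescopes to ψ(|ξ|/2^(k+1)) - ψ(|ξ|/2^(k-1)). The first argument is below 1, the second
at least 2, beyond the support. -/
lemma IsCutoff.dyadic_add_dyadic (hψ : IsCutoff ψ) {ξ : E3} {k : ℤ} (h1 : (2 : ℝ) ^ k ≤ ‖ξ‖)
    (h2 : ‖ξ‖ < 2 ^ (k + 1)) : dyadic ψ k ξ + dyadic ψ (k + 1) ξ = 1 := by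
  have hk : (0 : ℝ) < 2 ^ k := by positivity
  have hs : ψ (‖ξ‖ / 2 ^ (k - 1)) = 0 := by
    by_contra h
    have := (hψ.support h).2
    rw [div_le_iff₀ (by positivity), zpow_sub_one₀ two_ne_zero] at this
    linarith
  have ho : ψ (‖ξ‖ / 2 ^ (k + 1)) = 1 := by
    refine hψ.eq_one _ ⟨(by norm_num : (-(5 / 4) : ℝ) ≤ 0).trans (by positivity), ?_⟩
    rw [div_le_iff₀ (by positivity)]
    linarith [show (0 : ℝ) < 2 ^ (k + 1) by positivity]
  rw [dyadic, dyadic, hs, ho, add_sub_cancel_right]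
  ring

/-- A function all of whose dyadic pieces are bounded by powers of the dyadic frequency. -/
lemma IsCutoff.norm_le_of_dyadic (hψ : IsCutoff ψ) (hE : 0 ≤ E) (hq : q ≤ 0) {ξ : E3} (hξ : ξ ≠ 0)
    {z : ℂ} (h : ∀ k : ℤ, ‖z * (dyadic ψ k ξ : ℂ)‖ ≤ E * 2 ^ (q * k)) :
    ‖z‖ ≤ 2 * 2 ^ (-q) * E * ‖ξ‖ ^ q := by
  have hpos : 0 < ‖ξ‖ := norm_pos_iff.2 hξ
  obtain ⟨k, hk1, hk2⟩ := exists_mem_Ico_zpow hpos (one_lt_two)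
  have hz : z = z * (dyadic ψ k ξ : ℂ) + z * (dyadic ψ (k + 1) ξ : ℂ) := by
    rw [← mul_add, ← Complex.ofReal_add, hψ.dyadic_add_dyadic hk1 hk2]; simp
  have h1 : (2 : ℝ) ^ (q * (k + 1)) ≤ 2 ^ (q * k) :=
    zpow_le_zpow_right₀ one_le_two (by nlinarith)
  have h2 : (2 : ℝ) ^ (q * k) ≤ 2 ^ (-q) * ‖ξ‖ ^ q := by
    have : ‖ξ‖ / 2 ≤ 2 ^ k := by
      rw [zpow_add_one₀ two_ne_zero] at hk2; linarith
    obtain ⟨j, rfl⟩ := Int.exists_eq_neg_ofNat hq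
    rw [mul_comm, zpow_mul]
    calc ((2 : ℝ) ^ k) ^ (-(j : ℤ)) ≤ (‖ξ‖ / 2) ^ (-(j : ℤ)) := by
          simp only [zpow_neg, zpow_natCast]; gcongr
      _ = _ := by rw [div_zpow, zpow_neg, zpow_neg, neg_neg]; field_simp
  calc ‖z‖ ≤ ‖z * (dyadic ψ k ξ : ℂ)‖ + ‖z * (dyadic ψ (k + 1) ξ : ℂ)‖ := by
        conv_lhs => rw [hz]
        exact norm_add_le _ _
    _ ≤ E * 2 ^ (q * k) + E * 2 ^ (q * (k + 1)) := add_le_add (h _) (by exact_mod_cast h (k + 1))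
    _ ≤ E * (2 ^ (-q) * ‖ξ‖ ^ q) + E * (2 ^ (-q) * ‖ξ‖ ^ q) := by gcongr; exact h1.trans h2
    _ = _ := by ring

lemma zpow_mul_le_of_enorm {a : ℝ≥0∞} {r : ℝ} (k : ℤ) (hE : 0 ≤ E)
    (h : ENNReal.ofReal ((2 : ℝ) ^ k) * a ≤ ENNReal.ofReal E) (hr : ENNReal.ofReal r ≤ a) :
    r ≤ E * 2 ^ (-k) := by
  have h1 := (mul_le_mul_right hr (ENNReal.ofReal ((2 : ℝ) ^ k))).trans h
  rw [← ENNReal.ofReal_mul (by positivity), ENNReal.ofReal_le_ofReal_iff hE] at h1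
  rw [zpow_neg, ← div_eq_mul_inv, le_div_iff₀ (by positivity), mul_comm]
  exact h1

/-- The strict inequality is what extracts actual weak derivatives from the infimum defining
`xNorm`; the dyadic bounds are then reassembled by `IsCutoff.norm_le_of_dyadic`, for all dyadic
indices off a single null set. -/
lemma weakOrd_of_xNorm (hψ : IsCutoff ψ) (hE : 0 ≤ E)
    (h : ∀ k ≤ n, xNorm ψ k F < ENNReal.ofReal E) : WeakOrd n (-1) (2 ^ (n + 2) * E) F := by
  intro k hk w
  have h1 := h k hk
  rw [xNorm, iInf_lt_iff] at h1
  obtain ⟨D, h1⟩ := h1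
  rw [iInf_lt_iff] at h1
  obtain ⟨hD, h1⟩ := h1
  refine ⟨D w, hD w, ?_⟩
  have h2 : ∀ᵐ ξ, ∀ j : ℤ, ‖D w ξ * (dyadic ψ j ξ : ℂ)‖ ≤ E * 2 ^ ((-1 - k : ℤ) * j) := by
    rw [ae_all_iff]
    intro j
    have h3 := (le_iSup (fun j : ℤ => ENNReal.ofReal ((2 : ℝ) ^ (((k : ℤ) + 1) * j)) *
      ∑ w, eLpNorm (fun ξ => D w ξ * (dyadic ψ j ξ : ℂ)) ⊤ volume) j).trans h1.le
    filter_upwards [ae_le_eLpNormEssSup (f := fun ξ => D w ξ * (dyadic ψ j ξ : ℂ))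
      (μ := volume)] with ξ hξ
    have h4 := zpow_mul_le_of_enorm (((k : ℤ) + 1) * j) hE h3 (r := ‖D w ξ * (dyadic ψ j ξ : ℂ)‖) ?_
    · convert h4 using 3; ring
    · rw [ofReal_norm]
      refine hξ.trans ?_
      rw [← eLpNorm_exponent_top]
      exact Finset.single_le_sum (f := fun w => eLpNorm (fun ξ => D w ξ * (dyadic ψ j ξ : ℂ)) ⊤
        volume) (fun _ _ => bot_le) (Finset.mem_univ w)
  filter_upwards [h2, ae_ne_zero] with ξ hξ h0
  refine (hψ.norm_le_of_dyadic hE (by omega) h0 hξ).trans ?_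
  gcongr
  rw [← zpow_natCast, ← zpow_one_add₀ two_ne_zero]
  refine zpow_le_zpow_right₀ one_le_two ?_
  push_cast; omega

lemma Away.integrable_mul {G χ : E3 → ℂ} (hχ : Away χ) (hc : Continuous χ)
    (hG : LocallyIntegrableOn G {0}ᶜ) : Integrable fun ξ => G ξ * χ ξ := by
  have hs : tsupport χ ⊆ {0}ᶜ := fun ξ hξ h0 => hχ.away (h0 ▸ hξ)
  obtain ⟨b, hb⟩ := hc.bounded_above_of_compact_support hχ.compact
  have h1 := ((hG.integrableOn_compact_subset hs hχ.compact).integrable_indicator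
    (isClosed_tsupport χ).measurableSet).bdd_mul (f := χ) hc.aestronglyMeasurable
    (Eventually.of_forall hb)
  refine h1.congr (Eventually.of_forall fun ξ => ?_)
  by_cases hξ : ξ ∈ tsupport χ
  · simp [hξ, mul_comm]
  · simp [hξ, image_eq_zero_of_notMem_tsupport hξ]

lemma IsTest.toAway {χ : E3 → ℂ} (hχ : IsTest χ) : Away χ := ⟨hχ.compact, hχ.away⟩

lemma IsTest.integrable_mul {G χ : E3 → ℂ} (hχ : IsTest χ) (hG : LocallyIntegrableOn G {0}ᶜ) :
    Integrable fun ξ => G ξ * χ ξ := hχ.toAway.integrable_mul hχ.smooth.continuous hG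

lemma ae_eq_of_isWeakDeriv_zero {D : E3 → ℂ} {w : Fin 0 → Fin 3} (h : IsWeakDeriv w F D) :
    F =ᵐ[volume] D := by
  have h1 := isOpen_compl_zero.ae_eq_zero_of_integral_contDiff_smul_eq_zero (μ := volume)
    (h.left.sub h.right) (fun g hg hc hs => ?_)
  · filter_upwards [h1, ae_ne_zero] with ξ h1 h2
    simpa [sub_eq_zero] using h1 (by simpa using h2)
  · have hT : IsTest (fun ξ => (g ξ : ℂ)) := by
      have hs' : tsupport (fun ξ => (g ξ : ℂ)) ⊆ tsupport g :=
        closure_minimal (fun ξ hξ => subset_tsupport _ (by simpa using hξ)) (isClosed_tsupport _)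
      exact ⟨Complex.ofRealCLM.contDiff.comp hg, hc.of_isClosed_subset (isClosed_tsupport _) hs',
        fun h0 => hs (hs' h0) rfl⟩
    have h2 := h.pairing _ hT
    simp only [partials_zero, pow_zero, one_mul] at h2
    simp only [Pi.sub_apply, Complex.real_smul, mul_sub]
    rw [integral_sub]
    · simp only [mul_comm (Complex.ofReal _)]; rw [h2, sub_self]
    · simpa only [mul_comm] using hT.integrable_mul h.left
    · simpa only [mul_comm] using hT.integrable_mul h.right

lemma WeakOrd.ae_bound {A : ℝ} (h : WeakOrd n p A F) : ∀ᵐ ξ, ‖F ξ‖ ≤ A * ‖ξ‖ ^ p := by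
  obtain ⟨D, hD, hb⟩ := h 0 (Nat.zero_le _) Fin.elim0
  filter_upwards [ae_eq_of_isWeakDeriv_zero hD, hb] with ξ h1 h2
  simpa [h1] using h2

lemma weakOrd_of_ae_bound {A : ℝ} (hF : LocallyIntegrable F) (h : ∀ᵐ ξ, ‖F ξ‖ ≤ A * ‖ξ‖ ^ p) :
    WeakOrd 0 p A F := by
  intro k hk w
  obtain rfl : k = 0 := by omega
  exact ⟨F, ⟨hF.locallyIntegrableOn _, hF.locallyIntegrableOn _,
    fun χ _ => by simp [partials_zero]⟩, by simpa using h⟩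

/-! ### Pointwise bounds for symbols -/

lemma fourierInvInt_eq (f : E3 → ℂ) (x : E3) :
    fourierInvInt f x = (((2 * Real.pi) ^ 3 : ℝ) : ℂ)⁻¹ * 𝓕⁻ f ((2 * Real.pi)⁻¹ • x) := by
  rw [fourierInvInt, Real.fourierInv_eq']
  congr 2
  ext ξ
  rw [smul_eq_mul, inner_smul_right, real_inner_comm, mul_inv_cancel_left₀ (by positivity), mul_comm Complex.I]

lemma fourierInv_eq_fourierInvInt (f : E3 → ℂ) (v : E3) :
    𝓕⁻ f v = (((2 * Real.pi) ^ 3 : ℝ) : ℂ) * fourierInvInt f ((2 * Real.pi) • v) := by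
  have h : (((2 * Real.pi) ^ 3 : ℝ) : ℂ) ≠ 0 := by
    exact_mod_cast (by positivity : (2 * Real.pi) ^ 3 ≠ 0)
  rw [fourierInvInt_eq, mul_inv_cancel_left₀ h, smul_smul, inv_mul_cancel₀ (by positivity),
    one_smul]

/-- Fourier inversion bounds the supremum by the L¹ norm of the inverse transform. The factor (2π)⁻³
is cancelled by the change of variables between the two normalizations. -/
lemma norm_le_of_fourierInvInt (hf : Continuous f) (hc : HasCompactSupport f) (hS : 0 ≤ S)
    (h : ∫⁻ x, ‖fourierInvInt f x‖ₑ ≤ ENNReal.ofReal S) (ξ : E3) : ‖f ξ‖ ≤ S := by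
  have hfi := hf.integrable_of_hasCompactSupport hc (μ := volume)
  have hcont : Continuous (𝓕⁻ f) := by
    rw [Real.fourierInv_eq_fourier_comp_neg]
    exact VectorFourier.fourierIntegral_continuous Real.continuous_fourierChar
      (by exact continuous_inner) hfi.comp_neg
  have hgi : Integrable (fourierInvInt f) := by
    refine ⟨?_, h.trans_lt ENNReal.ofReal_lt_top⟩
    simp only [funext (fourierInvInt_eq f)]
    exact ((hcont.comp (continuous_const_smul _)).const_mul _).aestronglyMeasurable
  have hFi : Integrable (𝓕⁻ f) := by
    simp only [funext (fourierInv_eq_fourierInvInt f)]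
    exact (hgi.comp_smul (by positivity)).const_mul _
  have hFi' : Integrable (𝓕 f) := by
    have : 𝓕 f = fun v => 𝓕⁻ f (-v) := by ext v; simp [Real.fourierInv_eq_fourier_neg]
    rw [this]; exact hFi.comp_neg
  have h1 : ‖f ξ‖ ≤ ∫ v, ‖𝓕⁻ f v‖ := by
    rw [← hf.fourier_fourierInv_eq hfi hFi', Real.fourier_eq']
    refine (norm_integral_le_integral_norm _).trans (le_of_eq ?_)
    rw [hf.fourier_fourierInv_eq hfi hFi']
    congr 1; ext v
    rw [norm_smul, Complex.norm_exp_ofReal_mul_I, one_mul]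
  refine h1.trans ?_
  have h2 : ∫ v, ‖𝓕⁻ f v‖ = ∫ x, ‖fourierInvInt f x‖ := by
    simp only [fourierInv_eq_fourierInvInt f, norm_mul, integral_const_mul]
    rw [Measure.integral_comp_smul volume (fun x => ‖fourierInvInt f x‖)]
    simp
    try field_simp
  rw [h2, ← ENNReal.ofReal_le_ofReal_iff hS, ofReal_integral_norm_eq_lintegral_enorm hgi]
  exact h

end

/-! ### Pointwise bounds and truncation of symbols -/

section
variable {ψ : ℝ → ℝ} {m : E3 → ℂ} {n : ℕ}

lemma IsCutoff.dyadic_eq_cut (k : ℤ) (ξ : E3) :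
    (dyadic ψ k ξ : ℂ) = cut ψ (2 ^ k) ξ - cut ψ (2 ^ (k - 1)) ξ := by
  simp [dyadic, cut]

lemma IsCutoff.away_cut_sub_cut (hψ : IsCutoff ψ) {R r : ℝ} (hr : 0 < r) (hR : 0 < R) :
    Away (fun ξ => cut ψ R ξ - cut ψ r ξ) := by
  have h1 : ∀ ξ : E3, ‖ξ‖ < min r R → cut ψ R ξ - cut ψ r ξ = 0 := fun ξ hξ => by
    have := lt_min_iff.1 hξ
    rw [hψ.cut_eq_one hR (by linarith), hψ.cut_eq_one hr (by linarith), sub_self]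
  constructor
  · refine HasCompactSupport.of_support_subset_isCompact
      (isCompact_closedBall 0 (3 / 2 * max r R)) fun ξ hξ => ?_
    rw [mem_closedBall_zero_iff]
    by_contra h
    have h2 : ∀ s, 0 < s → s ≤ max r R → cut ψ s ξ = 0 := fun s hs hle =>
      hψ.cut_eq_zero hs (by linarith [not_le.1 h])
    exact hξ (by dsimp only; rw [h2 r hr (le_max_left _ _), h2 R hR (le_max_right _ _), sub_self])
  · rw [notMem_tsupport_iff_eventuallyEq]
    filter_upwards [Metric.ball_mem_nhds (0 : E3) (lt_min hr hR)] with ξ hξ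
    exact h1 ξ (by simpa using hξ)

lemma contDiffOn_partials (hm : ContDiffOn ℝ 10 m {0}ᶜ) (hn : n ≤ 10) (w : Fin n → Fin 3) :
    ContDiffOn ℝ 0 (partials w m) {0}ᶜ := by
  intro ξ hξ
  have h := (hm.contDiffAt (isOpen_compl_zero.mem_nhds hξ)).iteratedFDeriv_right (i := n) (m := 0)
    (by simpa using! (by exact_mod_cast hn : (n : WithTop ℕ∞) ≤ 10))
  exact ((ContinuousMultilinearMap.apply ℝ (fun _ : Fin n => E3) ℂ
    (fun i => e (w i))).contDiff.contDiffAt.comp ξ h).contDiffWithinAt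

/-- Symbols in `S^∞` satisfy pointwise bounds. -/
theorem IsSymbol.ord (hψ : IsCutoff ψ) (hm : IsSymbol ψ m) :
    Ord {0}ᶜ 3 0 (16 * (symbolNorm ψ m).toReal) m := by
  set S := (symbolNorm ψ m).toReal
  have hS : 0 ≤ S := ENNReal.toReal_nonneg
  refine ord_of_partials isOpen_compl_zero (hm.1.of_le (by norm_num)) fun n hn w ξ hξ => ?_
  have key : ∀ k : ℤ, ‖partials w m ξ * (dyadic ψ k ξ : ℂ)‖ ≤ S * 2 ^ (-(n : ℤ) * k) := by
    intro k
    have haw : Away (fun ξ => partials w m ξ * (dyadic ψ k ξ : ℂ)) := by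
      simp only [IsCutoff.dyadic_eq_cut]
      exact (hψ.away_cut_sub_cut (by positivity) (by positivity)).mul_left _
    have hcd : ContDiffOn ℝ 0 (fun ξ => partials w m ξ * (dyadic ψ k ξ : ℂ)) {0}ᶜ := by
      refine (contDiffOn_partials hm.1 (by omega) w).mul (contDiff_zero.2 ?_).contDiffOn
      have := hψ.smooth.continuous
      unfold dyadic
      fun_prop
    refine norm_le_of_fourierInvInt (haw.contDiff hcd).continuous haw.compact (by positivity) ?_ ξ
    have h1 : ENNReal.ofReal ((2 : ℝ) ^ ((n : ℤ) * k)) *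
        ∫⁻ x, ‖fourierInvInt (fun ξ => partials w m ξ * (dyadic ψ k ξ : ℂ)) x‖ₑ
        ≤ ENNReal.ofReal S := by
      rw [ENNReal.ofReal_toReal hm.2.ne]
      refine le_trans ?_ (le_iSup (fun k : ℤ => symbolNormAt ψ k m) k)
      refine le_trans ?_ (Finset.single_le_sum (f := fun n => ∑ w : Fin n → Fin 3,
        ENNReal.ofReal ((2 : ℝ) ^ ((n : ℤ) * k)) *
          ∫⁻ x, ‖fourierInvInt (fun ξ => partials w m ξ * (dyadic ψ k ξ : ℂ)) x‖ₑ)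
        (fun _ _ => bot_le) (Finset.mem_range.2 (by omega : n < 11)))
      exact Finset.single_le_sum (f := fun w : Fin n → Fin 3 =>
        ENNReal.ofReal ((2 : ℝ) ^ ((n : ℤ) * k)) *
          ∫⁻ x, ‖fourierInvInt (fun ξ => partials w m ξ * (dyadic ψ k ξ : ℂ)) x‖ₑ)
        (fun _ _ => bot_le) (Finset.mem_univ w)
    rw [neg_mul, zpow_neg, ← div_eq_mul_inv, ENNReal.ofReal_div_of_pos (by positivity),
      ENNReal.le_div_iff_mul_le (by simp; left; positivity) (by simp), mul_comm]
    exact h1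
  refine (hψ.norm_le_of_dyadic hS (by omega) hξ key).trans ?_
  rw [zero_sub]
  gcongr
  -- The 16 is 2·2³: two dyadic pieces meet at each ξ, and at most three derivatives are taken.
  have : (2 : ℝ) ^ (- -(n : ℤ)) ≤ 2 ^ (3 : ℤ) := zpow_le_zpow_right₀ one_le_two (by omega)
  norm_num at this ⊢
  linarith

/-- The symbol `m`, truncated to frequencies in `[1/R, R]`. -/
def trunc (ψ : ℝ → ℝ) (R : ℝ) (m : E3 → ℂ) (ξ : E3) : ℂ := m ξ * (cut ψ R ξ - cut ψ R⁻¹ ξ)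

/-- Symbols which vanish near zero and infinity, with three derivatives of order zero. -/
structure IsTruncated (B : ℝ) (M : E3 → ℂ) : Prop where
  away : Away M
  smooth : ContDiffOn ℝ 3 M {0}ᶜ
  ord : Ord {0}ᶜ 3 0 B M

/-- The cutoffs satisfy scale-invariant bounds, so truncation costs a factor independent of R; 256 K
= 2³·16·(K + K). -/
lemma exists_isTruncated_trunc (hψ : IsCutoff ψ) : ∃ C, 0 ≤ C ∧ ∀ m, IsSymbol ψ m → ∀ R > 0,
    IsTruncated (C * (symbolNorm ψ m).toReal) (trunc ψ R m) := by
  obtain ⟨K, hK, hκ⟩ := exists_ord_cutoff hψ.smooth hψ.hasCompactSupport 3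
  refine ⟨256 * K, by positivity, fun m hm R hR => ?_⟩
  have hS : 0 ≤ (symbolNorm ψ m).toReal := ENNReal.toReal_nonneg
  have hs : ∀ R, 0 < R → ContDiffOn ℝ 3 (cut ψ R) {0}ᶜ := fun R hR =>
    by exact_mod_cast contDiffOn_cutoff hψ.smooth R 3
  refine ⟨(hψ.away_cut_sub_cut (by positivity) hR).mul_left _, (hm.1.of_le (by norm_num)).mul
    ((hs R hR).sub (hs R⁻¹ (by positivity))), ?_⟩
  have := (hm.ord hψ).mul isOpen_compl_zero zero_notMem_compl (by positivity) (by positivity)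
    ((hκ R hR).sub isOpen_compl_zero (hκ R⁻¹ (by positivity)))
  convert! this using 1
  ring

lemma IsCutoff.norm_cut_sub_cut_le (hψ : IsCutoff ψ) (R r : ℝ) (ξ : E3) :
    ‖cut ψ R ξ - cut ψ r ξ‖ ≤ 1 := by
  rw [cut, cut, ← Complex.ofReal_sub, Complex.norm_real, Real.norm_eq_abs, abs_le]
  have h1 := hψ.mem_Icc (‖ξ‖ / R)
  have h2 := hψ.mem_Icc (‖ξ‖ / r)
  exact ⟨by linarith [h1.1, h2.2], by linarith [h1.2, h2.1]⟩

lemma IsCutoff.tendsto_cut_sub_cut (hψ : IsCutoff ψ) {ξ : E3} (hξ : ξ ≠ 0) :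
    Tendsto (fun R => cut ψ R ξ - cut ψ R⁻¹ ξ) atTop (𝓝 1) := by
  have hpos : 0 < ‖ξ‖ := norm_pos_iff.2 hξ
  refine tendsto_const_nhds.congr' ?_
  filter_upwards [eventually_ge_atTop ‖ξ‖, eventually_gt_atTop (3 / 2 * ‖ξ‖⁻¹),
    eventually_gt_atTop 0] with R h1 h2 h3
  rw [hψ.cut_eq_one h3 (by linarith), hψ.cut_eq_zero (by positivity), sub_zero]
  rw [← div_eq_mul_inv, div_lt_iff₀ h3]
  rwa [← div_eq_mul_inv, div_lt_iff₀ hpos, mul_comm] at h2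

lemma tendsto_integral_trunc (hψ : IsCutoff ψ) {u v : E3 → ℂ}
    (hi : Integrable (fun ξ => v ξ * (m ξ * u ξ))) :
    Tendsto (fun R => ∫ ξ, v ξ * (trunc ψ R m ξ * u ξ)) atTop (𝓝 (∫ ξ, v ξ * (m ξ * u ξ))) := by
  have heq : ∀ R ξ, v ξ * (trunc ψ R m ξ * u ξ)
      = (cut ψ R ξ - cut ψ R⁻¹ ξ) * (v ξ * (m ξ * u ξ)) := fun R ξ => by rw [trunc]; ring
  simp only [heq]
  refine tendsto_integral_filter_of_dominated_convergence (fun ξ => ‖v ξ * (m ξ * u ξ)‖)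
    (Eventually.of_forall fun R => ?_) (Eventually.of_forall fun R => Eventually.of_forall
      fun ξ => ?_) hi.norm ?_
  · refine AEStronglyMeasurable.mul (Continuous.aestronglyMeasurable ?_) hi.1
    have := hψ.smooth.continuous
    unfold cut
    fun_prop
  · rw [norm_mul]
    exact mul_le_of_le_one_left (norm_nonneg _) (hψ.norm_cut_sub_cut_le _ _ _)
  · filter_upwards [ae_ne_zero] with ξ hξ
    simpa using (hψ.tendsto_cut_sub_cut hξ).mul_const (v ξ * (m ξ * u ξ))

end

/-! ### Fourier transforms of tempered functions and multiplication by coordinates -/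

section
open scoped FourierTransform LineDeriv Convolution

variable {f g g' F χ : E3 → ℂ} {ε : ℝ}

/-- The Fourier integral of a Schwartz function, as a Schwartz function. -/
def schwartzFourier (χ : 𝓢(E3, ℂ)) : 𝓢(E3, ℂ) :=
  SchwartzMap.compCLMOfContinuousLinearEquiv ℂ
    (ContinuousLinearEquiv.smulLeft (Units.mk0 (2 * Real.pi)⁻¹ (by positivity)) : E3 ≃L[ℝ] E3) (𝓕 χ)

lemma fourierInt_eq (f : E3 → ℂ) (x : E3) : fourierInt f x = 𝓕 f ((2 * Real.pi)⁻¹ • x) := by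
  rw [fourierInt, Real.fourier_eq']
  congr 1; ext y
  rw [smul_eq_mul, inner_smul_right, real_inner_comm]
  congr 2
  push_cast
  field_simp

lemma schwartzFourier_apply (χ : 𝓢(E3, ℂ)) (x : E3) :
    schwartzFourier χ x = 𝓕 χ ((2 * Real.pi)⁻¹ • x) := rfl

lemma coe_schwartzFourier (χ : 𝓢(E3, ℂ)) : ⇑(schwartzFourier χ) = fourierInt χ := by
  ext x
  rw [fourierInt_eq, schwartzFourier_apply, SchwartzMap.fourier_coe]

/-- Multiplication of a Schwartz function by a coordinate. -/
def schwartzCoord (j : Fin 3) (χ : 𝓢(E3, ℂ)) : 𝓢(E3, ℂ) :=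
  SchwartzMap.smulLeftCLM ℂ (fun x : E3 => inner ℝ x (e j)) χ

lemma schwartzCoord_apply (j : Fin 3) (χ : 𝓢(E3, ℂ)) (x : E3) :
    schwartzCoord j χ x = (x j : ℂ) * χ x := by
  have h : (fun x : E3 => inner ℝ x (e j)).HasTemperateGrowth :=
    ((innerSL ℝ).flip (e j)).hasTemperateGrowth
  rw [schwartzCoord, SchwartzMap.smulLeftCLM_apply_apply h, inner_e, Complex.real_smul]

lemma fourierInt_lineDeriv (j : Fin 3) (χ : 𝓢(E3, ℂ)) (x : E3) :
    fourierInt (∂_{e j} χ : 𝓢(E3, ℂ)) x = Complex.I * x j * fourierInt χ x := by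
  have h : (fun x : E3 => inner ℝ x (e j)).HasTemperateGrowth :=
    ((innerSL ℝ).flip (e j)).hasTemperateGrowth
  rw [← coe_schwartzFourier, ← coe_schwartzFourier, schwartzFourier_apply, schwartzFourier_apply,
    SchwartzMap.fourier_lineDerivOp_eq, _root_.smul_apply,
    SchwartzMap.smulLeftCLM_apply_apply h, inner_e]
  simp
  field_simp

lemma pd_fourierInt (j : Fin 3) (χ : 𝓢(E3, ℂ)) (x : E3) :
    pd j (fourierInt χ) x = -(Complex.I * fourierInt (schwartzCoord j χ) x) := by
  have hd : HasFDerivAt (fun x : E3 => (2 * Real.pi)⁻¹ • x)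
      ((2 * Real.pi)⁻¹ • ContinuousLinearMap.id ℝ E3) x :=
    ((2 * Real.pi)⁻¹ • ContinuousLinearMap.id ℝ E3).hasFDerivAt
  have h1 := (((𝓕 χ : 𝓢(E3, ℂ)).hasFDerivAt ((2 * Real.pi)⁻¹ • x)).comp x hd).fderiv
  have h2 : fourierInt χ = (⇑(𝓕 χ : 𝓢(E3, ℂ))) ∘ fun x : E3 => (2 * Real.pi)⁻¹ • x := by
    ext y; rw [fourierInt_eq]; rfl
  have h3 := congrArg (fun F : 𝓢(E3, ℂ) => F ((2 * Real.pi)⁻¹ • x))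
    (SchwartzMap.lineDerivOp_fourier_eq χ (e j))
  rw [SchwartzMap.lineDerivOp_apply_eq_fderiv] at h3
  rw [pd, h2, h1, ContinuousLinearMap.comp_apply, _root_.smul_apply, map_smul,
    ContinuousLinearMap.id_apply, h3, ← coe_schwartzFourier, schwartzFourier_apply]
  change _ • 𝓕 (-(2 * Real.pi * Complex.I) • schwartzCoord j χ) _ = _
  rw [FourierTransform.fourier_smul]
  simp
  field_simp

lemma exists_schwartz_eq_one (R : ℝ) : ∃ χ : 𝓢(E3, ℂ), ∀ ξ, ‖ξ‖ ≤ R → χ ξ = 1 := by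
  let b : ContDiffBump (0 : E3) := ⟨max R 1, max R 1 + 1, by positivity, by linarith⟩
  have h1 : HasCompactSupport fun ξ => (b ξ : ℂ) :=
    b.hasCompactSupport.comp_left (g := fun r : ℝ => (r : ℂ)) (by simp)
  have h2 : ContDiff ℝ ∞ fun ξ => (b ξ : ℂ) := Complex.ofRealCLM.contDiff.comp b.contDiff
  refine ⟨h1.toSchwartzMap h2, fun ξ hξ => ?_⟩
  have : b ξ = 1 := b.one_of_mem_closedBall
    (mem_closedBall_zero_iff.2 (hξ.trans (le_max_left R 1)))
  simp [this]

lemma locallyIntegrable_of_schwartz (h : ∀ χ : 𝓢(E3, ℂ), Integrable (fun x => f x * χ x)) :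
    LocallyIntegrable f := by
  rw [locallyIntegrable_iff]
  intro K hK
  obtain ⟨R, hR⟩ := hK.isBounded.exists_norm_le
  obtain ⟨χ, hχ⟩ := exists_schwartz_eq_one R
  refine (h χ).integrableOn.congr_fun (fun x hx => ?_) hK.measurableSet
  simp [hχ x (hR x hx)]

lemma IsFourierTransform.locallyIntegrable_right (h : IsFourierTransform f g) :
    LocallyIntegrable g := locallyIntegrable_of_schwartz h.integrable_right

lemma ae_eq_of_forall_schwartz (hg : LocallyIntegrable g) (hg' : LocallyIntegrable g')
    (h : ∀ χ : 𝓢(E3, ℂ), HasCompactSupport χ → ∫ ξ, g ξ * χ ξ = ∫ ξ, g' ξ * χ ξ) :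
    g =ᵐ[volume] g' := by
  refine ae_eq_of_integral_contDiff_smul_eq hg hg' fun b hb hc => ?_
  have h1 : HasCompactSupport fun ξ => (b ξ : ℂ) :=
    hc.comp_left (g := fun r : ℝ => (r : ℂ)) (by simp)
  have h2 := h (h1.toSchwartzMap (Complex.ofRealCLM.contDiff.comp hb)) h1
  simpa [mul_comm] using! h2

lemma isFourierTransform_fourierFun (h : HasFourierTransform f) :
    IsFourierTransform f (fourierFun f) := by
  rw [fourierFun, dif_pos h]; exact h.choose_spec

lemma isFourierTransform_zero : IsFourierTransform (fun _ => 0) (fun _ => 0) :=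
  ⟨fun χ => by simp, fun χ => by simp, fun χ => by simp⟩

lemma IsFourierTransform.neg (h : IsFourierTransform f g) :
    IsFourierTransform (fun x => -f x) (fun x => -g x) :=
  ⟨fun χ => by simpa using (h.integrable_left χ).neg,
    fun χ => by simpa using (h.integrable_right χ).neg,
    fun χ => by simpa [integral_neg] using h.pairing χ⟩

lemma mol_comm_convolution (ε : ℝ) (F : E3 → ℂ) :
    mol ε F = bump ε ⋆[ContinuousLinearMap.mul ℝ ℂ, volume] F := by
  have : (ContinuousLinearMap.mul ℝ ℂ).flip = ContinuousLinearMap.mul ℝ ℂ := by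
    ext x y; simp
  rw [mol, ← convolution_flip, this]

lemma pd_mol_eq_mol_pd (hχ : ContDiff ℝ 1 χ) (hc : HasCompactSupport χ) (j : Fin 3) :
    pd j (mol ε χ) = mol ε (pd j χ) := by
  rw [mol_comm_convolution, mol_comm_convolution,
    pd_convolution hχ hc (contDiff_bump ε).continuous.locallyIntegrable]

/-- The Fourier transform of `τ v₀ + ∑ x_j v_j`, tested against compactly supported `C¹`
functions. -/
theorem integral_fourier_coord {v₀ p₀ : E3 → ℂ} {v p : Fin 3 → E3 → ℂ} (τ : ℂ)
    (hf : IsFourierTransform f g) (h₀ : IsFourierTransform v₀ p₀)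
    (h : ∀ j, IsFourierTransform (v j) (p j))
    (heq : ∀ x, f x = τ * v₀ x + ∑ j, (x j : ℂ) * v j x)
    (hχ : ContDiff ℝ 1 χ) (hc : HasCompactSupport χ) :
    ∫ ξ, g ξ * χ ξ = τ * (∫ ξ, p₀ ξ * χ ξ) - Complex.I * ∑ j, ∫ ξ, p j ξ * pd j χ ξ := by
  have schwartz : ∀ χ : 𝓢(E3, ℂ), ∫ ξ, g ξ * χ ξ
      = τ * (∫ ξ, p₀ ξ * χ ξ) - Complex.I * ∑ j, ∫ ξ, p j ξ * pd j χ ξ := by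
    intro χ
    have hj : ∀ j, (fun x => (x j : ℂ) * v j x * fourierInt χ x)
        = fun x => -Complex.I * (v j x * fourierInt (∂_{e j} χ : 𝓢(E3, ℂ)) x) := fun j => by
      ext x
      rw [fourierInt_lineDeriv]
      linear_combination ((x j : ℂ) * v j x * fourierInt χ x) * Complex.I_mul_I
    have hi : ∀ j, Integrable fun x => (x j : ℂ) * v j x * fourierInt χ x := fun j => by
      rw [hj, ← coe_schwartzFourier]
      exact ((h j).integrable_left _).const_mul _
    have hi₀ : Integrable fun x => τ * (v₀ x * fourierInt χ x) := by
      rw [← coe_schwartzFourier]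
      exact (h₀.integrable_left _).const_mul _
    have hs : (fun x => f x * fourierInt χ x) = fun x => τ * (v₀ x * fourierInt χ x)
        + ∑ j, (x j : ℂ) * v j x * fourierInt χ x := by
      ext x; rw [heq, add_mul, Finset.sum_mul, mul_assoc]
    rw [← hf.pairing, hs, integral_add hi₀ (integrable_finsetSum _ fun j _ => hi j),
      integral_finsetSum _ fun j _ => hi j, integral_const_mul, h₀.pairing]
    simp only [hj, integral_const_mul, (h _).pairing, ← Finset.mul_sum]
    rw [neg_mul, ← sub_eq_add_neg]
    rfl
  -- The identity just proved concerns Schwartz functions. It will be applied to the phase times a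
  -- symbol of finite smoothness, so it is extended to C¹ test functions by mollifying χ; the
  -- derivative of χ is mollified along with it.
  have lim : ∀ {G : E3 → ℂ}, LocallyIntegrable G → ∀ {b : E3 → ℂ}, Continuous b →
      HasCompactSupport b →
      Tendsto (fun ε => ∫ ξ, G ξ * mol ε b ξ) (𝓝[>] 0) (𝓝 (∫ ξ, G ξ * b ξ)) := by
    intro G hG b hb hbc
    have := tendsto_integral_mul_mol hG hb hbc
    simp only [mul_comm (b _)] at this
    refine this.congr' ?_
    filter_upwards [self_mem_nhdsWithin] with ε hε
    simp only [integral_mul_mol hε hG hb hbc, mul_comm]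
  refine tendsto_nhds_unique (lim hf.locallyIntegrable_right hχ.continuous hc) ?_
  refine Tendsto.congr' ?_ (((lim h₀.locallyIntegrable_right hχ.continuous hc).const_mul τ).sub
    ((tendsto_finsetSum Finset.univ fun j _ => lim (h j).locallyIntegrable_right
      (continuous_pd hχ j) (hasCompactSupport_pd hc j)).const_mul Complex.I))
  filter_upwards [self_mem_nhdsWithin] with ε hε
  have hsm : HasCompactSupport (mol ε χ) := hc.convolution _ (hasCompactSupport_bump hε)
  have := schwartz (hsm.toSchwartzMap (contDiff_mol hε hχ.continuous.locallyIntegrable))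
  have hcoe : ⇑(hsm.toSchwartzMap (contDiff_mol hε hχ.continuous.locallyIntegrable)) = mol ε χ :=
    rfl
  simp only [hcoe, pd_mol_eq_mol_pd hχ hc] at this
  exact this.symm

end

section
open scoped FourierTransform LineDeriv ComplexConjugate

variable {f : E3 → ℝ} {g g' : E3 → ℂ}

/-! ### Fourier transforms of derivatives and of real functions -/

lemma pd_toC {x : E3} (hf : DifferentiableAt ℝ f x) (j : Fin 3) :
    pd j (toC f) x = (fderiv ℝ f x (e j) : ℂ) := by
  have h := (Complex.ofRealCLM.hasFDerivAt.comp x hf.hasFDerivAt).fderiv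
  have h' : toC f = Complex.ofRealCLM ∘ f := rfl
  rw [pd, h', h]
  rfl

lemma integrable_coord_mul (h : ∀ χ : 𝓢(E3, ℂ), Integrable (fun ξ => g ξ * χ ξ)) (j : Fin 3)
    (χ : 𝓢(E3, ℂ)) : Integrable (fun ξ => (ξ j : ℂ) * g ξ * χ ξ) := by
  refine (h (schwartzCoord j χ)).congr (Eventually.of_forall fun ξ => ?_)
  simp only [schwartzCoord_apply]; ring

/-- Integration by parts against the transform of a Schwartz function. No decay of f is needed:
temperedness of f and of its derivative makes the three products integrable, and no boundary term
arises. -/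
theorem IsFourierTransform.fderiv {j : Fin 3} (hf : Differentiable ℝ f)
    (h : IsFourierTransform (toC f) g)
    (h' : IsFourierTransform (toC fun x => _root_.fderiv ℝ f x (e j)) g') :
    g' =ᵐ[volume] fun ξ => Complex.I * ξ j * g ξ := by
  have hi : ∀ χ : 𝓢(E3, ℂ), Integrable (fun ξ => Complex.I * ξ j * g ξ * χ ξ) := fun χ => by
    simpa only [mul_assoc] using (integrable_coord_mul h.integrable_right j χ).const_mul Complex.I
  refine ae_eq_of_forall_schwartz h'.locallyIntegrable_right (locallyIntegrable_of_schwartz hi)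
    fun χ _ => ?_
  have hpd : ∀ x, (toC fun x => _root_.fderiv ℝ f x (e j)) x = _root_.fderiv ℝ (toC f) x (e j) :=
    fun x => (pd_toC (hf x) j).symm
  have hpF : ∀ x, _root_.fderiv ℝ (fourierInt χ) x (e j)
      = -(Complex.I * fourierInt (schwartzCoord j χ) x) := pd_fourierInt j χ
  have hdC : Differentiable ℝ (toC f) := fun x =>
    (Complex.ofRealCLM.hasFDerivAt.comp x (hf x).hasFDerivAt).differentiableAt
  have ibp := integral_mul_fderiv_eq_neg_fderiv_mul_of_integrable (μ := volume) (f := toC f)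
    (g := fourierInt χ) (v := e j) ?_ ?_ ?_ (fun x _ => hdC x)
    (fun x _ => by rw [← coe_schwartzFourier]; exact (schwartzFourier χ).differentiableAt)
  · simp only [← hpd, hpF] at ibp
    rw [← h'.pairing]
    have h1 : ∫ x, toC f x * -(Complex.I * fourierInt (schwartzCoord j χ) x)
        = -(Complex.I * ∫ ξ, g ξ * schwartzCoord j χ ξ) := by
      rw [← h.pairing, ← integral_const_mul, ← integral_neg]
      congr 1; ext x; ring
    rw [h1, neg_inj] at ibp
    rw [← ibp, ← integral_const_mul]
    congr 1; ext ξ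
    rw [schwartzCoord_apply]; ring
  · simp only [← hpd, ← coe_schwartzFourier]
    exact h'.integrable_left _
  · simp only [hpF]
    rw [← coe_schwartzFourier]
    refine ((h.integrable_left (schwartzFourier (schwartzCoord j χ))).const_mul
      (-Complex.I)).congr (Eventually.of_forall fun x => ?_)
    dsimp only; ring
  · rw [← coe_schwartzFourier]; exact h.integrable_left _

lemma fourierInt_conj_neg (χ : E3 → ℂ) (x : E3) :
    fourierInt (fun ξ => conj (χ (-ξ))) x = conj (fourierInt χ x) := by
  rw [fourierInt, fourierInt, ← integral_conj, ← integral_neg_eq_self]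
  congr 1; ext ξ
  simp [← Complex.exp_conj]

/-- The Hermitian symmetry expresses that the field is real. It is what allows ∂_t φ^α and |∇|φ^α to
be separated from the single half wave carrying the sign -i. -/
theorem IsFourierTransform.conj_neg (h : IsFourierTransform (toC f) g) :
    g =ᵐ[volume] fun ξ => conj (g (-ξ)) := by
  have hloc : LocallyIntegrable fun ξ => conj (g (-ξ)) := by
    have h1 := h.locallyIntegrable_right
    rw [locallyIntegrable_iff] at h1 ⊢
    intro K hK
    have h2 := (h1 _ hK.neg).integrable_indicator hK.neg.measurableSet
    have h3 := h2.comp_neg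
    have h4 : Integrable (fun ξ => conj ((-K).indicator g (-ξ))) :=
      (Complex.conjLIE.toContinuousLinearEquiv.toContinuousLinearMap).integrable_comp h3
    refine h4.integrableOn.congr_fun (fun ξ hξ => ?_) hK.measurableSet
    simp [Set.indicator_of_mem (show -ξ ∈ -K by simpa using hξ)]
  refine ae_eq_of_forall_schwartz h.locallyIntegrable_right hloc fun χ hχ => ?_
  have hc : HasCompactSupport fun ξ => conj (χ (-ξ)) :=
    (hχ.comp_homeomorph (Homeomorph.neg E3)).comp_left (g := conj) (by simp)
  have hs : ContDiff ℝ ∞ fun ξ => conj (χ (-ξ)) :=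
    Complex.conjCLE.contDiff.comp (χ.smooth'.comp contDiff_neg)
  have h1 := h.pairing (hc.toSchwartzMap hs)
  have hcoe : ⇑(hc.toSchwartzMap hs) = fun ξ => conj (χ (-ξ)) := rfl
  simp only [hcoe, fourierInt_conj_neg] at h1
  have h2 := congrArg conj h1
  rw [← integral_conj, ← integral_conj] at h2
  simp only [map_mul, Complex.conj_conj] at h2
  have h3 : ∀ x, conj (toC f x) = toC f x := fun x => Complex.conj_ofReal _
  simp only [h3] at h2
  rw [← h.pairing, h2, ← integral_neg_eq_self]
  simp

/-! ### Regularity of the vector field derivatives -/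

variable {J : Set ℝ} {φ : ℝ → E3 → ℝ} {n l : ℕ} {t : ℝ}

/-- `φ` is `n` times continuously differentiable on `J × ℝ³`. -/
def Reg (J : Set ℝ) (n : ℕ) (φ : ℝ → E3 → ℝ) : Prop :=
  ContDiffOn ℝ n (fun p : ℝ × E3 => φ p.1 p.2) (J ×ˢ Set.univ)

lemma isOpen_slab (hJ : IsOpen J) : IsOpen (J ×ˢ (Set.univ : Set E3)) := hJ.prod isOpen_univ

lemma Reg.mono {k : ℕ} (hk : k ≤ n) (h : Reg J n φ) : Reg J k φ :=
  ContDiffOn.of_le h (by exact_mod_cast hk)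

lemma Reg.contDiffAt (hJ : IsOpen J) (h : Reg J n φ) (ht : t ∈ J) (x : E3) :
    ContDiffAt ℝ n (fun p : ℝ × E3 => φ p.1 p.2) (t, x) :=
  ContDiffOn.contDiffAt h ((isOpen_slab hJ).mem_nhds ⟨ht, trivial⟩)

lemma Reg.dt_eq (hJ : IsOpen J) (h : Reg J (n + 1) φ) (ht : t ∈ J) (x : E3) :
    dt φ t x = fderiv ℝ (fun p : ℝ × E3 => φ p.1 p.2) (t, x) (1, 0) := by
  have h1 := ((h.contDiffAt hJ ht x).differentiableAt (by simp)).hasFDerivAt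
  have h2 : HasDerivAt (fun s : ℝ => (s, x)) ((1 : ℝ), (0 : E3)) t :=
    (hasDerivAt_id t).prodMk (hasDerivAt_const t x)
  exact (h1.comp_hasDerivAt t h2).deriv

lemma Reg.differentiable (hJ : IsOpen J) (h : Reg J (n + 1) φ) (ht : t ∈ J) :
    Differentiable ℝ (φ t) := fun x =>
  ((h.contDiffAt hJ ht x).differentiableAt (by simp)).comp x
    ((differentiableAt_const t).prodMk differentiableAt_id)

lemma Reg.dx_eq (hJ : IsOpen J) (h : Reg J (n + 1) φ) (ht : t ∈ J) (x : E3) (j : Fin 3) :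
    dx j φ t x = fderiv ℝ (fun p : ℝ × E3 => φ p.1 p.2) (t, x) (0, e j) := by
  have h1 := ((h.contDiffAt hJ ht x).differentiableAt (by simp)).hasFDerivAt
  have h2 : HasFDerivAt (fun y : E3 => (t, y)) (ContinuousLinearMap.inr ℝ ℝ E3) x := by
    exact (hasFDerivAt_const t x).prodMk (hasFDerivAt_id x)
  have h3 := (h1.comp x h2).fderiv
  change fderiv ℝ (φ t) x (e j) = _
  have h4 : φ t = (fun p : ℝ × E3 => φ p.1 p.2) ∘ fun y : E3 => (t, y) := rfl
  rw [h4, h3]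
  rfl

lemma contDiffOn_fderiv_const (hJ : IsOpen J) (h : Reg J (n + 1) φ) (v : ℝ × E3) :
    ContDiffOn ℝ n (fun p => fderiv ℝ (fun p : ℝ × E3 => φ p.1 p.2) p v) (J ×ˢ Set.univ) :=
  (ContDiffOn.fderiv_of_isOpen h (isOpen_slab hJ) (m := n) (by norm_cast)).clm_apply
    contDiffOn_const

lemma Reg.dt (hJ : IsOpen J) (h : Reg J (n + 1) φ) : Reg J n (dt φ) :=
  (contDiffOn_fderiv_const hJ h (1, 0)).congr fun p hp => h.dt_eq hJ hp.1 p.2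

lemma Reg.dx (hJ : IsOpen J) (h : Reg J (n + 1) φ) (j : Fin 3) : Reg J n (dx j φ) :=
  (contDiffOn_fderiv_const hJ h (0, e j)).congr fun p hp => h.dx_eq hJ hp.1 p.2 j

lemma Reg.dt_dx (hJ : IsOpen J) (h : Reg J 2 φ) (ht : t ∈ J) (x : E3) (j : Fin 3) :
    WaveDecay.dt (WaveDecay.dx j φ) t x = WaveDecay.dx j (WaveDecay.dt φ) t x := by
  set Φ := fun p : ℝ × E3 => φ p.1 p.2
  have hat := h.contDiffAt hJ ht x
  have hd : DifferentiableAt ℝ (fderiv ℝ Φ) (t, x) :=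
    (hat.fderiv_right (m := 1) (by norm_num)).differentiableAt (by norm_num)
  have hnhds := (isOpen_slab hJ).mem_nhds (show (t, x) ∈ J ×ˢ (Set.univ : Set E3) from ⟨ht, trivial⟩)
  have key : ∀ (F : ℝ → E3 → ℝ) (v w : ℝ × E3), (∀ s ∈ J, ∀ y, F s y = fderiv ℝ Φ (s, y) v) →
      fderiv ℝ (fun p : ℝ × E3 => F p.1 p.2) (t, x) w = fderiv ℝ (fderiv ℝ Φ) (t, x) w v := by
    intro F v w hF
    have h1 : (fun p : ℝ × E3 => F p.1 p.2) =ᶠ[𝓝 (t, x)] fun p => fderiv ℝ Φ p v := by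
      filter_upwards [hnhds] with p hp using hF p.1 hp.1 p.2
    rw [h1.fderiv_eq]
    have := (hd.hasFDerivAt.clm_apply (hasFDerivAt_const v _)).fderiv
    rw [this]
    simp
  have h1 : Reg J (1 + 1) φ := h
  rw [(h1.dx hJ j).dt_eq (n := 0) hJ ht, (h1.dt hJ).dx_eq (n := 0) hJ ht,
    key _ (0, e j) _ fun s hs y => h1.dx_eq hJ hs y j,
    key _ (1, 0) _ fun s hs y => h1.dt_eq hJ hs y]
  exact hat.isSymmSndFDerivAt (by simp) _ _

lemma gam_cons (Z : VF) (α : Fin l → VF) (φ : ℝ → E3 → ℝ) :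
    gam (Fin.cons Z α : Fin (l + 1) → VF) φ = applyVF (gam α φ) Z := by
  simp [gam]

lemma contDiff_time {k : WithTop ℕ∞} : ContDiff ℝ k (fun p : ℝ × E3 => p.1) := contDiff_fst

lemma contDiff_space {k : WithTop ℕ∞} (j : Fin 3) : ContDiff ℝ k (fun p : ℝ × E3 => p.2 j) :=
  (EuclideanSpace.proj j : E3 →L[ℝ] ℝ).contDiff.comp contDiff_snd

lemma Reg.applyVF (hJ : IsOpen J) (h : Reg J (n + 1) φ) (Z : VF) : Reg J n (applyVF φ Z) := by
  have ht := h.dt hJ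
  have hx := h.dx hJ
  rcases Z with _ | i | i | i
  · exact (contDiff_time.contDiffOn.mul ht).add
      (ContDiffOn.sum fun j _ => (contDiff_space j).contDiffOn.mul (hx j))
  · exact hx i
  · exact ((contDiff_space _).contDiffOn.mul (hx _)).sub ((contDiff_space _).contDiffOn.mul (hx _))
  · exact (contDiff_time.contDiffOn.mul (hx i)).add ((contDiff_space i).contDiffOn.mul ht)

lemma reg_gam (hJ : IsOpen J) (h : Reg J (n + l) φ) (α : Fin l → VF) : Reg J n (gam α φ) := by
  induction l generalizing n with
  | zero => simpa [gam] using h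
  | succ l ih =>
    rw [← Fin.cons_self_tail α, gam_cons]
    exact (ih (n := n + 1) (by rwa [add_assoc, add_comm 1 l]) (Fin.tail α)).applyVF hJ (α 0)

lemma IsScalarField.reg (h : IsScalarField J φ) (hJ : IsOpen J) (α : Fin l → VF)
    (hl : n + l ≤ 21) : Reg J n (gam α φ) :=
  reg_gam hJ (Reg.mono hl (by exact_mod_cast h.contDiffOn)) α

end

/-! ### Vector fields on the Fourier side and rotations of profiles -/

section
open scoped ComplexConjugate

variable {J : Set ℝ} {φ : ℝ → E3 → ℝ} {l : ℕ} {t : ℝ} {α : Fin l → VF} {χ : E3 → ℂ}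

/-- The Fourier transform of `φ^α` at time `t`. -/
def ft0 (α : Fin l → VF) (φ : ℝ → E3 → ℝ) (t : ℝ) : E3 → ℂ := fourierFun (toC (gam α φ t))

/-- The Fourier transform of `∂_t φ^α` at time `t`. -/
def ft1 (α : Fin l → VF) (φ : ℝ → E3 → ℝ) (t : ℝ) : E3 → ℂ := fourierFun (toC (dt (gam α φ) t))

/-- The word `∂_j α`. -/
def trW (j : Fin 3) (α : Fin l → VF) : Fin (l + 1) → VF := Fin.cons (.inr (.inl j)) α

/-- The word `Ω_i α`. -/
def rotW (i : Fin 3) (α : Fin l → VF) : Fin (l + 1) → VF := Fin.cons (.inr (.inr (.inl i))) α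

/-- The word `L_j α`. -/
def boostW (j : Fin 3) (α : Fin l → VF) : Fin (l + 1) → VF := Fin.cons (.inr (.inr (.inr j))) α

/-- The word `S α`. -/
def scalW (α : Fin l → VF) : Fin (l + 1) → VF := Fin.cons (.inl ()) α

lemma gam_trW (j : Fin 3) : gam (trW j α) φ = dx j (gam α φ) := gam_cons _ _ _

lemma IsScalarField.isFT0 (h : IsScalarField J φ) (ht : t ∈ J) (hl : l ≤ 20) (α : Fin l → VF) :
    IsFourierTransform (toC (gam α φ t)) (ft0 α φ t) :=
  isFourierTransform_fourierFun (h.fourier l hl α t ht).1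

lemma IsScalarField.isFT1 (h : IsScalarField J φ) (ht : t ∈ J) (hl : l ≤ 20) (α : Fin l → VF) :
    IsFourierTransform (toC (dt (gam α φ) t)) (ft1 α φ t) :=
  isFourierTransform_fourierFun (h.fourier l hl α t ht).2

lemma IsScalarField.ft0_trW (h : IsScalarField J φ) (hJ : IsOpen J) (ht : t ∈ J) (hl : l + 1 ≤ 20)
    (α : Fin l → VF) (j : Fin 3) :
    ft0 (trW j α) φ t =ᵐ[volume] fun ξ => Complex.I * ξ j * ft0 α φ t ξ := by
  have h1 := h.isFT0 ht hl (trW j α)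
  rw [gam_trW] at h1
  exact (h.isFT0 ht (by omega) α).fderiv
    ((h.reg (n := 0 + 1) hJ α (by omega)).differentiable hJ ht) h1

lemma IsScalarField.ft1_trW (h : IsScalarField J φ) (hJ : IsOpen J) (ht : t ∈ J) (hl : l + 1 ≤ 20)
    (α : Fin l → VF) (j : Fin 3) :
    ft1 (trW j α) φ t =ᵐ[volume] fun ξ => Complex.I * ξ j * ft1 α φ t ξ := by
  have hr : Reg J (1 + 1) (gam α φ) := h.reg hJ α (by omega)
  have h1 := h.isFT1 ht hl (trW j α)
  rw [gam_trW, show dt (dx j (gam α φ)) t = dx j (dt (gam α φ)) t from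
    funext fun x => hr.dt_dx hJ ht x j] at h1
  exact (h.isFT1 ht (by omega) α).fderiv ((hr.dt hJ).differentiable (n := 0) hJ ht) h1

lemma integral_fourier_rot {f v₁ v₂ g p₁ p₂ : E3 → ℂ} (i : Fin 3)
    (hf : IsFourierTransform f g) (h₁ : IsFourierTransform v₁ p₁) (h₂ : IsFourierTransform v₂ p₂)
    (heq : ∀ x, f x = (x (i + 1) : ℂ) * v₂ x - (x (i + 2) : ℂ) * v₁ x)
    (hχ : ContDiff ℝ 1 χ) (hc : HasCompactSupport χ) :
    ∫ ξ, g ξ * χ ξ = -Complex.I * ((∫ ξ, p₂ ξ * pd (i + 1) χ ξ) - ∫ ξ, p₁ ξ * pd (i + 2) χ ξ) := by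
  have key := integral_fourier_coord (g := g) (v₀ := fun _ => 0) (p₀ := fun _ => 0)
    (v := fun k => if k = i + 1 then v₂ else if k = i + 2 then fun x => -v₁ x else fun _ => 0)
    (p := fun k => if k = i + 1 then p₂ else if k = i + 2 then fun x => -p₁ x else fun _ => 0)
    0 hf isFourierTransform_zero (fun k => by
      split_ifs
      exacts [h₂, h₁.neg, isFourierTransform_zero]) (fun x => by
      rw [heq]; fin_cases i <;> simp [Fin.sum_univ_three] <;> ring) hχ hc
  rw [key]
  fin_cases i <;> simp [Fin.sum_univ_three, integral_neg] <;> ring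

lemma IsScalarField.integral_boost (h : IsScalarField J φ) (ht : t ∈ J)
    (hl : l + 1 ≤ 20) (α : Fin l → VF) (j : Fin 3) (hχ : ContDiff ℝ 1 χ)
    (hc : HasCompactSupport χ) :
    ∫ ξ, ft0 (boostW j α) φ t ξ * χ ξ = t * (∫ ξ, ft0 (trW j α) φ t ξ * χ ξ)
      - Complex.I * ∫ ξ, ft1 α φ t ξ * pd j χ ξ := by
  have key := integral_fourier_coord
    (v := fun k => if k = j then toC (dt (gam α φ) t) else fun _ => 0)
    (p := fun k => if k = j then ft1 α φ t else fun _ => 0)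
    (t : ℂ) (h.isFT0 ht hl (boostW j α)) (h.isFT0 ht hl (trW j α)) (fun k => by
      split_ifs
      exacts [h.isFT1 ht (by omega) α, isFourierTransform_zero]) (fun x => by
      rw [boostW, gam_cons, gam_trW]
      fin_cases j <;> simp [toC, applyVF, Fin.sum_univ_three]) hχ hc
  rw [key]
  fin_cases j <;> simp [Fin.sum_univ_three]

lemma IsScalarField.integral_scal (h : IsScalarField J φ) (ht : t ∈ J)
    (hl : l + 1 ≤ 20) (α : Fin l → VF) (hχ : ContDiff ℝ 1 χ) (hc : HasCompactSupport χ) :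
    ∫ ξ, ft0 (scalW α) φ t ξ * χ ξ = t * (∫ ξ, ft1 α φ t ξ * χ ξ)
      - Complex.I * ∑ j, ∫ ξ, ft0 (trW j α) φ t ξ * pd j χ ξ := by
  refine integral_fourier_coord (t : ℂ) (h.isFT0 ht hl (scalW α)) (h.isFT1 ht (by omega) α)
    (fun j => h.isFT0 ht hl (trW j α)) (fun x => ?_) hχ hc
  simp only [scalW, gam_cons, gam_trW]
  simp [toC, applyVF]

lemma IsScalarField.integral_rot0 (h : IsScalarField J φ) (ht : t ∈ J)
    (hl : l + 1 ≤ 20) (α : Fin l → VF) (i : Fin 3) (hχ : ContDiff ℝ 1 χ)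
    (hc : HasCompactSupport χ) :
    ∫ ξ, ft0 (rotW i α) φ t ξ * χ ξ = -Complex.I *
      ((∫ ξ, ft0 (trW (i + 2) α) φ t ξ * pd (i + 1) χ ξ)
        - ∫ ξ, ft0 (trW (i + 1) α) φ t ξ * pd (i + 2) χ ξ) := by
  refine integral_fourier_rot i (h.isFT0 ht hl (rotW i α)) (h.isFT0 ht hl _) (h.isFT0 ht hl _)
    (fun x => ?_) hχ hc
  simp only [rotW, gam_cons, gam_trW]
  simp [toC, applyVF]

lemma IsScalarField.integral_rot1 (h : IsScalarField J φ) (hJ : IsOpen J) (ht : t ∈ J)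
    (hl : l + 1 ≤ 20) (α : Fin l → VF) (i : Fin 3) (hχ : ContDiff ℝ 1 χ)
    (hc : HasCompactSupport χ) :
    ∫ ξ, ft1 (rotW i α) φ t ξ * χ ξ = -Complex.I *
      ((∫ ξ, ft1 (trW (i + 2) α) φ t ξ * pd (i + 1) χ ξ)
        - ∫ ξ, ft1 (trW (i + 1) α) φ t ξ * pd (i + 2) χ ξ) := by
  refine integral_fourier_rot i (h.isFT1 ht hl (rotW i α)) (h.isFT1 ht hl _) (h.isFT1 ht hl _)
    (fun x => ?_) hχ hc
  have hr : ∀ j, Reg J (0 + 1) (dx j (gam α φ)) :=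
    (h.reg (n := 0 + 1 + 1) hJ α (by omega)).dx hJ
  have hd : ∀ j, DifferentiableAt ℝ (fun s => dx j (gam α φ) s x) t := fun j =>
    DifferentiableAt.comp (g := fun p : ℝ × E3 => dx j (gam α φ) p.1 p.2) (f := fun s => (s, x)) t
      (((hr j).contDiffAt hJ ht x).differentiableAt (by simp))
      (differentiableAt_id.prodMk (differentiableAt_const x))
  simp only [rotW, gam_cons, gam_trW, toC, applyVF, dt]
  rw [deriv_fun_sub ((hd _).const_mul _) ((hd _).const_mul _), deriv_const_mul _ (hd _),
    deriv_const_mul _ (hd _)]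
  push_cast
  rfl

/-- If `g_j = i ξ_j g`, the transform of the rotation field is the rotation field. -/
lemma integral_coord_rot {g g₁ g₂ : E3 → ℂ} (hg : LocallyIntegrable g) (i : Fin 3)
    (h₁ : g₁ =ᵐ[volume] fun ξ => Complex.I * ξ (i + 1) * g ξ)
    (h₂ : g₂ =ᵐ[volume] fun ξ => Complex.I * ξ (i + 2) * g ξ)
    (hχ : ContDiff ℝ 1 χ) (hc : HasCompactSupport χ) :
    -Complex.I * ((∫ ξ, g₂ ξ * pd (i + 1) χ ξ) - ∫ ξ, g₁ ξ * pd (i + 2) χ ξ)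
      = -∫ ξ, g ξ * rot i χ ξ := by
  have hi : ∀ a j, Integrable (fun ξ : E3 => g ξ * ((ξ a : ℂ) * pd j χ ξ)) := fun a j => by
    simpa [mul_comm] using hg.integrable_smul_left_of_hasCompactSupport
      ((contDiff_coord (k := 1) a).continuous.mul (continuous_pd hχ j))
      (hasCompactSupport_pd hc j).mul_left
  have e₁ : ∫ ξ, g₁ ξ * pd (i + 2) χ ξ
      = Complex.I * ∫ ξ, g ξ * ((ξ (i + 1) : ℂ) * pd (i + 2) χ ξ) := by
    rw [← integral_const_mul]
    refine integral_congr_ae ?_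
    filter_upwards [h₁] with ξ hξ
    rw [hξ]; ring
  have e₂ : ∫ ξ, g₂ ξ * pd (i + 1) χ ξ
      = Complex.I * ∫ ξ, g ξ * ((ξ (i + 2) : ℂ) * pd (i + 1) χ ξ) := by
    rw [← integral_const_mul]
    refine integral_congr_ae ?_
    filter_upwards [h₂] with ξ hξ
    rw [hξ]; ring
  have e₃ : ∫ ξ, g ξ * rot i χ ξ = (∫ ξ, g ξ * ((ξ (i + 1) : ℂ) * pd (i + 2) χ ξ))
      - ∫ ξ, g ξ * ((ξ (i + 2) : ℂ) * pd (i + 1) χ ξ) := by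
    rw [← integral_sub (hi _ _) (hi _ _)]
    simp only [rot, mul_sub]
  rw [e₁, e₂, e₃]
  linear_combination (-(∫ ξ, g ξ * ((ξ (i + 2) : ℂ) * pd (i + 1) χ ξ))
    + ∫ ξ, g ξ * ((ξ (i + 1) : ℂ) * pd (i + 2) χ ξ)) * Complex.I_mul_I

/-- The phase `e^{i t |ξ|}`. -/
def ez (t : ℝ) (ξ : E3) : ℂ := Complex.exp (Complex.I * (t * ‖ξ‖ : ℝ))

lemma profileHat_eq (α : Fin l → VF) (φ : ℝ → E3 → ℝ) (t : ℝ) :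
    profileHat α φ t = fun ξ => ez t ξ * (ft1 α φ t ξ - Complex.I * ‖ξ‖ * ft0 α φ t ξ) := rfl

lemma norm_ez (t : ℝ) (ξ : E3) : ‖ez t ξ‖ = 1 := by
  rw [ez, mul_comm, Complex.norm_exp_ofReal_mul_I]

lemma continuous_ez (t : ℝ) : Continuous (ez t) := by
  unfold ez; fun_prop

lemma contDiffOn_ez {k : WithTop ℕ∞} (t : ℝ) : ContDiffOn ℝ k (ez t) {0}ᶜ := by
  refine Complex.contDiff_exp.comp_contDiffOn (contDiffOn_const.mul
    (Complex.ofRealCLM.contDiff.comp_contDiffOn (contDiffOn_const.mul contDiffOn_norm)))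

lemma IsScalarField.locallyIntegrable_profileHat (h : IsScalarField J φ) (ht : t ∈ J)
    (hl : l ≤ 20) (α : Fin l → VF) : LocallyIntegrable (profileHat α φ t) := by
  rw [profileHat_eq]
  exact ((h.isFT1 ht hl α).locallyIntegrable_right.sub
    ((h.isFT0 ht hl α).locallyIntegrable_right.continuous_mul (by fun_prop))).continuous_mul
    (continuous_ez t)

lemma IsScalarField.profileHat_trW (h : IsScalarField J φ) (hJ : IsOpen J) (ht : t ∈ J)
    (hl : l + 1 ≤ 20) (α : Fin l → VF) (j : Fin 3) :
    profileHat (trW j α) φ t =ᵐ[volume] fun ξ => Complex.I * ξ j * profileHat α φ t ξ := by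
  filter_upwards [h.ft0_trW hJ ht hl α j, h.ft1_trW hJ ht hl α j] with ξ h0 h1
  simp only [profileHat_eq, h0, h1]
  ring

/-- Rotations commute with the half-wave operator and its flow: the factors e^{it|ξ|} and |ξ| are
radial, so a rotation passes through them and falls on the transforms of φ^α and ∂_t φ^α. -/
lemma IsScalarField.weakRot_profileHat (h : IsScalarField J φ) (hJ : IsOpen J) (ht : t ∈ J)
    (hl : l + 1 ≤ 20) (α : Fin l → VF) (i : Fin 3) :
    WeakRot i (profileHat α φ t) (profileHat (rotW i α) φ t) := by
  intro χ hχ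
  have key : ∀ {g G : E3 → ℂ} {b : ℝ → ℂ}, LocallyIntegrable g →
      ContDiffOn ℝ 1 (fun ξ : E3 => b ‖ξ‖) {0}ᶜ → Differentiable ℝ b →
      (∀ {χ : E3 → ℂ}, ContDiff ℝ 1 χ → HasCompactSupport χ →
        ∫ ξ, G ξ * χ ξ = -∫ ξ, g ξ * rot i χ ξ) →
      ∫ ξ, g ξ * (b ‖ξ‖ * rot i χ ξ) = -∫ ξ, G ξ * (b ‖ξ‖ * χ ξ) := by
    intro g G b hg hb hbd hG
    have haw : Away (fun ξ => b ‖ξ‖ * χ ξ) := hχ.toAway.mul_left _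
    rw [hG (haw.contDiff (hb.mul (hχ.smooth.of_le ENat.LEInfty.out).contDiffOn)) haw.compact,
      neg_neg]
    refine integral_congr_ae ?_
    filter_upwards [ae_ne_zero] with ξ hξ
    have hz := rot_radial hξ (hbd ‖ξ‖).hasDerivAt i
    rw [rot_mul ((hb.contDiffAt (isOpen_compl_zero.mem_nhds hξ)).differentiableAt (by simp))
      (hχ.smooth.differentiable (by simp) ξ), hz]
    ring
  have hb1 : Differentiable ℝ fun r : ℝ => Complex.exp (Complex.I * (t * r : ℝ)) := by fun_prop
  have hb0 : Differentiable ℝ fun r : ℝ => Complex.exp (Complex.I * (t * r : ℝ)) * r := by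
    fun_prop
  have hn : ContDiffOn ℝ 1 (fun ξ : E3 => (‖ξ‖ : ℂ)) {0}ᶜ :=
    Complex.ofRealCLM.contDiff.comp_contDiffOn contDiffOn_norm
  have g0 := (h.isFT0 ht (by omega) α).locallyIntegrable_right
  have g1 := (h.isFT1 ht (by omega) α).locallyIntegrable_right
  have k1 := key (b := fun r => Complex.exp (Complex.I * (t * r : ℝ))) g1 (contDiffOn_ez t) hb1
    fun hχ hc => (h.integral_rot1 hJ ht hl α i hχ hc).trans
      (integral_coord_rot g1 i (h.ft1_trW hJ ht hl α _) (h.ft1_trW hJ ht hl α _) hχ hc)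
  have k0 := key (b := fun r => Complex.exp (Complex.I * (t * r : ℝ)) * r) g0
    ((contDiffOn_ez t).mul hn) hb0
    fun hχ hc => (h.integral_rot0 ht hl α i hχ hc).trans
      (integral_coord_rot g0 i (h.ft0_trW hJ ht hl α _) (h.ft0_trW hJ ht hl α _) hχ hc)
  have split : ∀ {m : ℕ} (β : Fin m → VF), m ≤ 20 → ∀ {χ : E3 → ℂ}, Away χ → Continuous χ →
      ∫ ξ, profileHat β φ t ξ * χ ξ
        = (∫ ξ, ft1 β φ t ξ * (Complex.exp (Complex.I * (t * ‖ξ‖ : ℝ)) * χ ξ)) - Complex.I *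
          ∫ ξ, ft0 β φ t ξ * (Complex.exp (Complex.I * (t * ‖ξ‖ : ℝ)) * ‖ξ‖ * χ ξ) := by
    intro m β hm χ hχ hc
    have hc' : Continuous fun ξ : E3 => Complex.exp (Complex.I * (t * ‖ξ‖ : ℝ)) := continuous_ez t
    rw [← integral_const_mul, ← integral_sub]
    · refine integral_congr_ae (Eventually.of_forall fun ξ => ?_)
      simp only [profileHat_eq, ez]; ring
    · exact (hχ.mul_left _).integrable_mul (hc'.mul hc)
        ((h.isFT1 ht hm β).locallyIntegrable_right.locallyIntegrableOn _)
    · exact ((hχ.mul_left _).integrable_mul ((hc'.mul (by fun_prop)).mul hc)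
        ((h.isFT0 ht hm β).locallyIntegrable_right.locallyIntegrableOn _)).const_mul _
  rw [split α (by omega) (hχ.toAway.rot i) (continuous_rot (hχ.smooth.of_le ENat.LEInfty.out) i),
    split (rotW i α) hl hχ.toAway hχ.smooth.continuous, k1, k0]
  ring

end

section
open scoped ComplexConjugate

variable {ψ : ℝ → ℝ} {J : Set ℝ} {φ : ℝ → E3 → ℝ} {l n k : ℕ} {t A B E : ℝ} {α : Fin l → VF}
  {M f : E3 → ℂ} {U : Set E3} {p : ℤ}

/-! ### Pointwise bounds for the profiles -/

lemma xNorm_le_energyLow (α : Fin l → VF) (hn : n ≤ 3) (hl : l + 3 * n ≤ 20) :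
    xNorm ψ n (profileHat α φ t) ≤ energyLow ψ φ t := by
  unfold energyLow
  refine le_trans ?_ (Finset.single_le_sum (fun _ _ => bot_le)
    (Finset.mem_range.2 (by omega : n < 4)))
  refine le_trans ?_ (Finset.single_le_sum (fun _ _ => bot_le)
    (Finset.mem_range.2 (by omega : l < 20 - 3 * n + 1)))
  refine le_trans ?_ (Finset.single_le_sum (fun _ _ => bot_le) (Finset.mem_univ α))
  exact le_trans le_self_add le_self_add

lemma weakOrd_profileHat (hψ : IsCutoff ψ) (hE : 0 ≤ E)
    (h : energyLow ψ φ t < ENNReal.ofReal E) (α : Fin l → VF) (hn : n ≤ 2)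
    (hl : l + 3 * n ≤ 20) : WeakOrd n (-1) (16 * E) (profileHat α φ t) := by
  refine (weakOrd_of_xNorm hψ hE fun k hk =>
    (xNorm_le_energyLow α (by omega) (by omega)).trans_lt h).mono_const ?_
  gcongr
  exact (pow_le_pow_right₀ one_le_two (by omega : n + 2 ≤ 4)).trans (by norm_num)

lemma norm_le_sum_abs (ξ : E3) : ‖ξ‖ ≤ ∑ j, ‖(ξ j : ℂ)‖ := by
  have h : ξ = ∑ j, ξ j • e j := by
    ext k
    fin_cases k <;> simp [Fin.sum_univ_three, e_apply]
  conv_lhs => rw [h]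
  refine (norm_sum_le _ _).trans (Finset.sum_le_sum fun j _ => ?_)
  rw [norm_smul, norm_e, mul_one, Complex.norm_real]

/-- A translation field multiplies the profile by iξ_j, so each unused letter of the word buys a
power |ξ|⁻¹. The factor 3 per letter comes from |ξ| ≤ ∑_j |ξ_j|. -/
lemma ae_norm_profileHat_le (hψ : IsCutoff ψ) (hφ : IsScalarField J φ) (hJ : IsOpen J) (ht : t ∈ J)
    (hE : 0 ≤ E) (h : energyLow ψ φ t < ENNReal.ofReal E) (α : Fin l → VF)
    (hl : l + k ≤ 20) :
    ∀ᵐ ξ, ‖profileHat α φ t ξ‖ ≤ 3 ^ k * (16 * E) * ‖ξ‖ ^ (-1 - k : ℤ) := by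
  induction k generalizing l with
  | zero => simpa using (weakOrd_profileHat (n := 0) hψ hE h α (by omega) (by omega)).ae_bound
  | succ k ih =>
    have h1 : ∀ᵐ ξ, ∀ j, ‖profileHat (trW j α) φ t ξ‖ ≤ 3 ^ k * (16 * E) * ‖ξ‖ ^ (-1 - k : ℤ) :=
      ae_all_iff.2 fun j => ih (trW j α) (by omega)
    have h2 : ∀ᵐ ξ, ∀ j, profileHat (trW j α) φ t ξ = Complex.I * ξ j * profileHat α φ t ξ :=
      ae_all_iff.2 fun j => hφ.profileHat_trW hJ ht (by omega) α j
    filter_upwards [h1, h2, ae_ne_zero] with ξ h1 h2 h0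
    have hpos : 0 < ‖ξ‖ := norm_pos_iff.2 h0
    have h3 : ‖ξ‖ * ‖profileHat α φ t ξ‖ ≤ 3 * (3 ^ k * (16 * E) * ‖ξ‖ ^ (-1 - k : ℤ)) := by
      calc ‖ξ‖ * ‖profileHat α φ t ξ‖ ≤ (∑ j, ‖(ξ j : ℂ)‖) * ‖profileHat α φ t ξ‖ := by
            gcongr; exact norm_le_sum_abs ξ
        _ = ∑ j, ‖profileHat (trW j α) φ t ξ‖ := by
            rw [Finset.sum_mul]
            refine Finset.sum_congr rfl fun j _ => ?_
            rw [h2, norm_mul, norm_mul, Complex.norm_I, one_mul]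
        _ ≤ ∑ _j : Fin 3, 3 ^ k * (16 * E) * ‖ξ‖ ^ (-1 - k : ℤ) := Finset.sum_le_sum fun j _ => h1 j
        _ = _ := by simp
    rw [mul_comm, ← le_div_iff₀ hpos] at h3
    refine h3.trans (le_of_eq ?_)
    rw [show (-1 - (k + 1 : ℕ) : ℤ) = (-1 - k) - 1 by push_cast; ring, zpow_sub_one₀ hpos.ne']
    ring

lemma weakOrd_profileHat_three (hψ : IsCutoff ψ) (hφ : IsScalarField J φ) (hJ : IsOpen J)
    (ht : t ∈ J) (hE : 0 ≤ E) (h : energyLow ψ φ t < ENNReal.ofReal E) (α : Fin l → VF)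
    (hl : l ≤ 18) : WeakOrd 0 (-3) (144 * E) (profileHat α φ t) := by
  refine weakOrd_of_ae_bound (hφ.locallyIntegrable_profileHat ht (by omega) α) ?_
  filter_upwards [ae_norm_profileHat_le (k := 2) hψ hφ hJ ht hE h α (by omega)] with ξ hξ
  rw [show (-1 - (2 : ℕ) : ℤ) = -3 by norm_num] at hξ
  linarith

/-! ### Reflected symbols -/

/-- The symbol `ξ ↦ conj (M (-ξ))`. -/
def reflect (M : E3 → ℂ) (ξ : E3) : ℂ := conj (M (-ξ))

lemma Away.reflect (h : Away M) : Away (reflect M) := by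
  refine ⟨(h.compact.comp_homeomorph (Homeomorph.neg E3)).comp_left (g := conj) (by simp), ?_⟩
  rw [notMem_tsupport_iff_eventuallyEq]
  have h1 : Tendsto (fun ξ : E3 => -ξ) (𝓝 0) (𝓝 0) := by simpa using (continuous_neg.tendsto (0 : E3))
  filter_upwards [h1.eventually h.eventually_eq_zero] with ξ hξ
  simp [WaveDecay.reflect, hξ]

lemma contDiffOn_reflect {s : WithTop ℕ∞} (h : ContDiffOn ℝ s M {0}ᶜ) :
    ContDiffOn ℝ s (reflect M) {0}ᶜ :=
  Complex.conjCLE.contDiff.comp_contDiffOn (h.comp contDiff_neg.contDiffOn fun ξ hξ => by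
    simpa using hξ)

lemma hasFDerivAt_reflect {ξ : E3} (h : DifferentiableAt ℝ M (-ξ)) :
    HasFDerivAt (reflect M) ((Complex.conjCLE : ℂ →L[ℝ] ℂ).comp ((fderiv ℝ M (-ξ)).comp
      (-(ContinuousLinearMap.id ℝ E3)))) ξ := by
  have h1 : HasFDerivAt (fun ξ : E3 => -ξ) (-(ContinuousLinearMap.id ℝ E3)) ξ :=
    (hasFDerivAt_id ξ).neg
  exact (Complex.conjCLE : ℂ →L[ℝ] ℂ).hasFDerivAt.comp ξ (h.hasFDerivAt.comp ξ h1)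

lemma pd_reflect {ξ : E3} (h : DifferentiableAt ℝ M (-ξ)) (j : Fin 3) :
    pd j (reflect M) ξ = -reflect (pd j M) ξ := by
  rw [pd, (hasFDerivAt_reflect h).fderiv]
  simp [reflect, pd]

lemma Ord.reflect (h : Ord {0}ᶜ n p B M) : Ord {0}ᶜ n p B (reflect M) := by
  have key : ∀ {p : ℤ} {M : E3 → ℂ}, (∀ ξ ∈ ({0}ᶜ : Set E3), ‖M ξ‖ ≤ B * ‖ξ‖ ^ p) →
      ∀ ξ ∈ ({0}ᶜ : Set E3), ‖WaveDecay.reflect M ξ‖ ≤ B * ‖ξ‖ ^ p := fun h ξ hξ => by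
    simpa [WaveDecay.reflect] using h (-ξ) (by simpa using hξ)
  induction n generalizing p M with
  | zero => exact key h
  | succ n ih =>
    have hd : ∀ ξ ∈ ({0}ᶜ : Set E3), DifferentiableAt ℝ M (-ξ) := fun ξ hξ =>
      h.1 (-ξ) (by simpa using hξ)
    exact ⟨fun ξ hξ => (hasFDerivAt_reflect (hd ξ hξ)).differentiableAt, key h.2.1, fun j =>
      ((ih (h.2.2 j)).neg isOpen_compl_zero).congr isOpen_compl_zero fun ξ hξ =>
        (pd_reflect (hd ξ hξ) j).symm⟩

lemma IsTruncated.reflect (h : IsTruncated B M) : IsTruncated B (reflect M) :=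
  ⟨h.away.reflect, contDiffOn_reflect h.smooth, h.ord.reflect⟩

/-! ### Recovering the field from its half waves -/

lemma ez_mul_ph (t : ℝ) (x ξ : E3) : ph t x ξ * ez t ξ = ph 0 x ξ := by
  rw [ph, ez, ph, ← Complex.exp_add]
  congr 1
  push_cast; ring

lemma ph_neg (x ξ : E3) : ph 0 x (-ξ) = conj (ph 0 x ξ) := by
  simp [ph, ← Complex.exp_conj]

/-- The operator with symbol `M` applied to the half wave, at the point `x`. -/
def halfWave (M : E3 → ℂ) (α : Fin l → VF) (φ : ℝ → E3 → ℝ) (t : ℝ) (x : E3) : ℂ :=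
  ∫ ξ, ph t x ξ * (M ξ * profileHat α φ t ξ)

lemma integrable_ph_mul (hM : Away M) (hc : Continuous M) (hf : LocallyIntegrable f) (x : E3) :
    Integrable fun ξ => ph 0 x ξ * (M ξ * f ξ) := by
  have := (hM.mul_left (ph 0 x)).integrable_mul ((continuous_ph 0 x).mul hc)
    (hf.locallyIntegrableOn _)
  exact this.congr (Eventually.of_forall fun ξ => by dsimp only; ring)

lemma locallyIntegrable_norm_mul (hf : LocallyIntegrable f) :
    LocallyIntegrable fun ξ : E3 => (‖ξ‖ : ℂ) * f ξ := hf.continuous_mul (by fun_prop)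

lemma halfWave_eq (hφ : IsScalarField J φ) (ht : t ∈ J) (hl : l ≤ 20) (α : Fin l → VF)
    (hM : Away M) (hc : Continuous M) (x : E3) :
    halfWave M α φ t x = (∫ ξ, ph 0 x ξ * (M ξ * ft1 α φ t ξ))
      - Complex.I * ∫ ξ, ph 0 x ξ * (M ξ * (‖ξ‖ * ft0 α φ t ξ)) := by
  rw [← integral_const_mul, ← integral_sub
    (integrable_ph_mul hM hc (hφ.isFT1 ht hl α).locallyIntegrable_right x)
    ((integrable_ph_mul hM hc (locallyIntegrable_norm_mul
      (hφ.isFT0 ht hl α).locallyIntegrable_right) x).const_mul _)]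
  refine integral_congr_ae (Eventually.of_forall fun ξ => ?_)
  simp only [profileHat_eq, ← ez_mul_ph t x ξ]
  ring

lemma conj_integral_reflect (hf : f =ᵐ[volume] fun ξ => conj (f (-ξ))) (x : E3) :
    conj (∫ ξ, ph 0 x ξ * (reflect M ξ * f ξ)) = ∫ ξ, ph 0 x ξ * (M ξ * f ξ) := by
  rw [← integral_conj, ← integral_neg_eq_self]
  refine integral_congr_ae ?_
  filter_upwards [hf] with ξ hξ
  simp only [map_mul, ph_neg, Complex.conj_conj, reflect, neg_neg]
  rw [← hξ]

/-- By Hermitian symmetry, conjugating the half wave with symbol `reflect M` yields M applied to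
(∂_t + i|∇|)φ^α. The sum and the difference with the half wave of M isolate the two terms. -/
lemma norm_le_of_halfWave {b : ℝ} (hφ : IsScalarField J φ) (ht : t ∈ J) (hl : l ≤ 20)
    (α : Fin l → VF) (hM : Away M) (hc : ContDiffOn ℝ 0 M {0}ᶜ) (x : E3)
    (h1 : ‖halfWave M α φ t x‖ ≤ b) (h2 : ‖halfWave (reflect M) α φ t x‖ ≤ b) :
    ‖∫ ξ, ph 0 x ξ * (M ξ * ft1 α φ t ξ)‖ ≤ b ∧
      ‖∫ ξ, ph 0 x ξ * (M ξ * (‖ξ‖ * ft0 α φ t ξ))‖ ≤ b := by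
  have e1 := halfWave_eq hφ ht hl α hM (hM.contDiff hc).continuous x
  have e2 := congrArg conj (halfWave_eq hφ ht hl α hM.reflect
    (hM.reflect.contDiff (contDiffOn_reflect hc)).continuous x)
  have s0 : (fun ξ : E3 => (‖ξ‖ : ℂ) * ft0 α φ t ξ)
      =ᵐ[volume] fun ξ => conj ((‖-ξ‖ : ℂ) * ft0 α φ t (-ξ)) := by
    filter_upwards [(hφ.isFT0 ht hl α).conj_neg] with ξ hξ
    rw [hξ]; simp
  rw [map_sub, map_mul, conj_integral_reflect (hφ.isFT1 ht hl α).conj_neg,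
    conj_integral_reflect s0, Complex.conj_I] at e2
  set a := ∫ ξ, ph 0 x ξ * (M ξ * ft1 α φ t ξ)
  set c := ∫ ξ, ph 0 x ξ * (M ξ * (‖ξ‖ * ft0 α φ t ξ))
  have h2' : ‖conj (halfWave (reflect M) α φ t x)‖ ≤ b := by rwa [RCLike.norm_conj]
  have ea : 2 * a = halfWave M α φ t x + conj (halfWave (reflect M) α φ t x) := by
    rw [e1, e2]; ring
  have ec : 2 * Complex.I * c
      = conj (halfWave (reflect M) α φ t x) - halfWave M α φ t x := by
    rw [e1, e2]; ring
  have na := congrArg norm ea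
  have nc := congrArg norm ec
  rw [norm_mul, Complex.norm_two] at na
  rw [norm_mul, norm_mul, Complex.norm_two, Complex.norm_I] at nc
  have := norm_add_le (halfWave M α φ t x) (conj (halfWave (reflect M) α φ t x))
  have := norm_sub_le (conj (halfWave (reflect M) α φ t x)) (halfWave M α φ t x)
  constructor <;> linarith

end

/-! ### Decay of half waves and absolute convergence -/

section
open scoped ComplexConjugate

variable {ψ : ℝ → ℝ} {J : Set ℝ} {φ : ℝ → E3 → ℝ} {l n k : ℕ} {t A B E : ℝ} {α : Fin l → VF}
  {M f : E3 → ℂ} {U : Set E3} {p : ℤ}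

/-- A scalar field whose low order energy at time `t` is less than `E`. -/
structure LowEnergy (ψ : ℝ → ℝ) (J : Set ℝ) (φ : ℝ → E3 → ℝ) (t E : ℝ) : Prop where
  cutoff : IsCutoff ψ
  field : IsScalarField J φ
  isOpen : IsOpen J
  mem : t ∈ J
  nonneg : 0 ≤ E
  energy : energyLow ψ φ t < ENNReal.ofReal E

/-- Decay with weight `|x|` for half waves. -/
theorem exists_halfWave_near (hψ : IsCutoff ψ) : ∃ C, 0 ≤ C ∧ ∀ {J : Set ℝ} {φ : ℝ → E3 → ℝ}
    {t E B : ℝ} {l : ℕ} {α : Fin l → VF} {M : E3 → ℂ} {x : E3}, LowEnergy ψ J φ t E → l ≤ 13 →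
    0 ≤ B → IsTruncated B M → x ≠ 0 → 0 < |(|t| - ‖x‖)| →
    ‖x‖ * ‖halfWave M α φ t x‖ ≤ C * (B * E / |(|t| - ‖x‖)|) := by
  obtain ⟨C, hC, h⟩ := exists_weak_decay_near hψ
  refine ⟨C * 128, by positivity, fun {J φ t E B l α M x} he hl hB hM hx hd => ?_⟩
  -- The number 13 in the theorem arises here: the rotated words have up to 14 letters and two
  -- ξ-derivatives are needed, and 14 + 3·2 = 20.
  refine (h t x hx hd (16 * E) (8 * B) M (profileHat α φ t)
    (fun i => profileHat (rotW i α) φ t) (by linarith [he.nonneg]) (by positivity) hM.away ?_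
    (he.field.locallyIntegrable_profileHat he.mem (by omega) α)
    (fun i => he.field.locallyIntegrable_profileHat he.mem (by omega) _)
    (weakOrd_profileHat hψ he.nonneg he.energy α le_rfl (by omega))
    (fun i => he.field.weakRot_profileHat he.isOpen he.mem (by omega) α i)
    (fun i => weakOrd_profileHat hψ he.nonneg he.energy _ le_rfl (by omega))).trans
    (le_of_eq (by ring))
  -- The third derivative of M pays for its rotation derivative, with constant 2³ = 8.
  have := hM.ord.good isOpen_compl_zero zero_notMem_compl hB
    (hM.smooth.of_le (by norm_num))
  norm_num at this
  exact this

/-- Decay for half waves. -/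
theorem exists_halfWave_away (hψ : IsCutoff ψ) : ∃ C, 0 ≤ C ∧ ∀ {J : Set ℝ} {φ : ℝ → E3 → ℝ}
    {t E B : ℝ} {l : ℕ} {α : Fin l → VF} {M : E3 → ℂ} {x : E3}, LowEnergy ψ J φ t E → l ≤ 14 →
    0 ≤ B → Away M → ContDiffOn ℝ 2 M {0}ᶜ → Ord {0}ᶜ 2 (-1) B M → 0 < |(|t| - ‖x‖)| →
    ‖halfWave M α φ t x‖ ≤ C * (B * E / |(|t| - ‖x‖)|) := by
  obtain ⟨C, hC, h⟩ := exists_weak_decay_away hψ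
  refine ⟨C * 16, by positivity, fun {J φ t E B l α M x} he hl hB hM hs ho hd => ?_⟩
  exact (h t x hd (16 * E) B M (profileHat α φ t) (by linarith [he.nonneg]) hB hM hs ho
    (he.field.locallyIntegrable_profileHat he.mem (by omega) α)
    (weakOrd_profileHat hψ he.nonneg he.energy α le_rfl (by omega))).trans (le_of_eq (by ring))

/-- Boundedness with weight `|x|` for half waves. -/
theorem exists_halfWave_dispersive : ∃ C, 0 ≤ C ∧ ∀ {ψ : ℝ → ℝ} {J : Set ℝ} {φ : ℝ → E3 → ℝ}
    {t E B : ℝ} {l : ℕ} {α : Fin l → VF} {M : E3 → ℂ} {x : E3}, LowEnergy ψ J φ t E → l ≤ 13 →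
    0 ≤ B → IsTruncated B M → x ≠ 0 → ‖x‖ * ‖halfWave M α φ t x‖ ≤ C * (B * E) := by
  obtain ⟨C, hC, h⟩ := exists_weak_dispersive
  refine ⟨C * 288, by positivity, fun {ψ J φ t E B l α M x} he hl hB hM hx => ?_⟩
  have hE := he.nonneg
  have h1 : ∀ {m : ℕ} (β : Fin m → VF), m ≤ 18 → WeakOrd 0 (-1) (144 * E) (profileHat β φ t) :=
    fun β hm => (weakOrd_profileHat he.cutoff hE he.energy β (by omega) (by omega)).mono_const
      (by linarith)
  have h3 : ∀ {m : ℕ} (β : Fin m → VF), m ≤ 18 → WeakOrd 0 (-3) (144 * E) (profileHat β φ t) :=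
    fun β hm => weakOrd_profileHat_three he.cutoff he.field he.isOpen he.mem hE he.energy β hm
  refine (h t x hx (144 * E) (2 * B) M (profileHat α φ t)
    (fun i => profileHat (rotW i α) φ t) (by positivity) (by positivity) hM.away ?_
    (he.field.locallyIntegrable_profileHat he.mem (by omega) α)
    (fun i => he.field.locallyIntegrable_profileHat he.mem (by omega) _)
    (fun i => he.field.weakRot_profileHat he.isOpen he.mem (by omega) α i)
    (h1 α (by omega)) (fun i => h1 _ (by omega)) (h3 α (by omega))
    (fun i => h3 _ (by omega))).trans (le_of_eq (by ring))
  have := (hM.ord.mono_order (m := 1) (by norm_num)).good (n := 0) isOpen_compl_zero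
    zero_notMem_compl hB (hM.smooth.of_le (by norm_num))
  norm_num at this
  exact this

/-! ### Absolute convergence -/

/-- The weight `min(|ξ|⁻¹, |ξ|⁻⁴)`. -/
def wt4 (ξ : E3) : ℝ := min (‖ξ‖ ^ (-1 : ℤ)) (‖ξ‖ ^ (-4 : ℤ))

lemma wt4_nonneg (ξ : E3) : 0 ≤ wt4 ξ := le_min (by positivity) (by positivity)

/-- The weight is at most |ξ|⁻¹ times |ξ|⁻¹ inside the unit ball, and |ξ|⁻¹ times |ξ|⁻³ outside, so
the low and high sums for the annular weight |ξ|⁻¹ apply. -/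
lemma integrable_wt4 : Integrable wt4 := by
  have hm : Measurable wt4 := by unfold wt4; fun_prop
  refine ⟨hm.aestronglyMeasurable, ?_⟩
  obtain ⟨C, hw⟩ := exists_ann_rinv
  have h1 := hw.low_indicator one_pos zero_le_one
  have h2 := hw.high_indicator one_pos zero_le_one
  have hle : ∫⁻ ξ, ‖wt4 ξ‖ₑ ≤ (∫⁻ ξ : E3, ENNReal.ofReal (‖ξ‖ ^ (-1 : ℤ)) * ENNReal.ofReal
      ({ξ : E3 | ξ ≠ 0 ∧ ‖ξ‖ < 1}.indicator (fun ξ => 1 * ‖ξ‖ ^ (-1 : ℤ)) ξ))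
      + ∫⁻ ξ : E3, ENNReal.ofReal (‖ξ‖ ^ (-1 : ℤ)) * ENNReal.ofReal
      ({ξ : E3 | 1 ≤ ‖ξ‖}.indicator (fun ξ => 1 * ‖ξ‖ ^ (-3 : ℤ)) ξ) := by
    rw [← lintegral_add_left]
    · refine lintegral_mono_ae ?_
      filter_upwards [ae_ne_zero] with ξ h0
      have hpos : 0 < ‖ξ‖ := norm_pos_iff.2 h0
      rw [← ofReal_norm, Real.norm_of_nonneg (wt4_nonneg ξ)]
      rcases lt_or_ge ‖ξ‖ 1 with h | h
      · refine le_trans ?_ le_self_add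
        rw [Set.indicator_of_mem (show ξ ∈ {ξ : E3 | ξ ≠ 0 ∧ ‖ξ‖ < 1} from ⟨h0, h⟩),
          ← ENNReal.ofReal_mul (by positivity), one_mul]
        refine ENNReal.ofReal_le_ofReal ((min_le_left _ _).trans ?_)
        refine le_mul_of_one_le_right (by positivity) ?_
        rw [zpow_neg, zpow_one]; exact (one_le_inv₀ hpos).2 h.le
      · refine le_trans ?_ le_add_self
        rw [Set.indicator_of_mem (show ξ ∈ {ξ : E3 | 1 ≤ ‖ξ‖} from h),
          ← ENNReal.ofReal_mul (by positivity), one_mul, ← zpow_add₀ hpos.ne']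
        exact ENNReal.ofReal_le_ofReal (min_le_right _ _)
    · exact Measurable.mul (by fun_prop)
        (ENNReal.measurable_ofReal.comp (Measurable.indicator (by fun_prop) (measurableSet_low 1)))
  exact (hle.trans (add_le_add h1 h2)).trans_lt
    (ENNReal.add_lt_top.2 ⟨ENNReal.ofReal_lt_top, ENNReal.ofReal_lt_top⟩)

/-- At ξ and -ξ the profile has modulus |ft1 - i|ξ| ft0| and |ft1 + i|ξ| ft0|, so both terms are
bounded by its values at these two points. The decay |ξ|⁻⁴ uses three translations, hence words of
at most 17 letters and 432 = 3³·16. -/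
lemma LowEnergy.ae_norm_le (he : LowEnergy ψ J φ t E) (hl : l ≤ 17) (α : Fin l → VF) :
    ∀ᵐ ξ, ‖ft1 α φ t ξ‖ ≤ 432 * E * wt4 ξ ∧ ‖ξ‖ * ‖ft0 α φ t ξ‖ ≤ 432 * E * wt4 ξ := by
  have hE := he.nonneg
  have h1 : ∀ᵐ ξ, ‖profileHat α φ t ξ‖ ≤ 432 * E * wt4 ξ := by
    filter_upwards [ae_norm_profileHat_le (k := 0) he.cutoff he.field he.isOpen he.mem hE
      he.energy α (by omega), ae_norm_profileHat_le (k := 3) he.cutoff he.field he.isOpen he.mem hE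
      he.energy α (by omega)] with ξ h0 h3
    rw [wt4, mul_min_of_nonneg _ _ (by positivity : 0 ≤ 432 * E), le_min_iff]
    rw [show (-1 - (0 : ℕ) : ℤ) = -1 by norm_num] at h0
    rw [show (-1 - (3 : ℕ) : ℤ) = -4 by norm_num] at h3
    have : 0 ≤ E * ‖ξ‖ ^ (-1 : ℤ) := by positivity
    constructor <;> linarith
  have h2 : ∀ᵐ ξ : E3, ‖profileHat α φ t (-ξ)‖ ≤ 432 * E * wt4 (-ξ) :=
    (Measure.measurePreserving_neg (volume : Measure E3)).quasiMeasurePreserving.ae h1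
  filter_upwards [h1, h2, (he.field.isFT0 he.mem (by omega) α).conj_neg,
    (he.field.isFT1 he.mem (by omega) α).conj_neg] with ξ h1 h2 c0 c1
  have hw : wt4 (-ξ) = wt4 ξ := by simp [wt4]
  have e1 : ∀ ξ, ‖profileHat α φ t ξ‖ = ‖ft1 α φ t ξ - Complex.I * ‖ξ‖ * ft0 α φ t ξ‖ := fun ξ => by
    rw [profileHat_eq, norm_mul, norm_ez, one_mul]
  have e2 : ‖profileHat α φ t (-ξ)‖ = ‖ft1 α φ t ξ + Complex.I * ‖ξ‖ * ft0 α φ t ξ‖ := by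
    rw [e1, ← RCLike.norm_conj, c0, c1]
    simp
  rw [hw, e2] at h2
  rw [e1] at h1
  have na := norm_add_le (ft1 α φ t ξ - Complex.I * ‖ξ‖ * ft0 α φ t ξ)
    (ft1 α φ t ξ + Complex.I * ‖ξ‖ * ft0 α φ t ξ)
  have nb := norm_sub_le (ft1 α φ t ξ - Complex.I * ‖ξ‖ * ft0 α φ t ξ)
    (ft1 α φ t ξ + Complex.I * ‖ξ‖ * ft0 α φ t ξ)
  rw [show ft1 α φ t ξ - Complex.I * ‖ξ‖ * ft0 α φ t ξ
    + (ft1 α φ t ξ + Complex.I * ‖ξ‖ * ft0 α φ t ξ) = 2 * ft1 α φ t ξ by ring, norm_mul,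
    Complex.norm_two] at na
  rw [show ft1 α φ t ξ - Complex.I * ‖ξ‖ * ft0 α φ t ξ
    - (ft1 α φ t ξ + Complex.I * ‖ξ‖ * ft0 α φ t ξ)
    = -2 * (Complex.I * (‖ξ‖ * ft0 α φ t ξ)) by ring, norm_mul, norm_mul, norm_mul, norm_neg,
    Complex.norm_two, Complex.norm_I, Complex.norm_real, norm_norm, one_mul] at nb
  constructor <;> linarith

lemma LowEnergy.ae_norm_trW_le (he : LowEnergy ψ J φ t E) (hl : l ≤ 17) (α : Fin l → VF)
    (j : Fin 3) : ∀ᵐ ξ, ‖ft0 (trW j α) φ t ξ‖ ≤ 432 * E * wt4 ξ := by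
  filter_upwards [he.ae_norm_le hl α, he.field.ft0_trW he.isOpen he.mem (by omega) α j]
    with ξ h1 h2
  rw [h2, norm_mul, norm_mul, Complex.norm_I, one_mul]
  refine le_trans ?_ h1.2
  gcongr
  simpa using PiLp.norm_apply_le ξ j

lemma integrable_symbol_mul {m g : E3 → ℂ} {c : ℝ} (hm : ContDiffOn ℝ 0 m {0}ᶜ)
    (hb : ∀ ξ ≠ 0, ‖m ξ‖ ≤ B) (hg : LocallyIntegrable g) (h : ∀ᵐ ξ, ‖g ξ‖ ≤ c * wt4 ξ) :
    Integrable (fun ξ => m ξ * g ξ) := by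
  have hm' : AEStronglyMeasurable m volume := by
    have h1 := hm.continuousOn.aestronglyMeasurable (μ := volume)
      isOpen_compl_zero.measurableSet
    rwa [Measure.restrict_eq_self_of_ae_mem] at h1
    filter_upwards [ae_ne_zero] with ξ hξ using hξ
  refine ((integrable_wt4.const_mul c).const_mul B).mono' (hm'.mul hg.aestronglyMeasurable) ?_
  filter_upwards [h, ae_ne_zero] with ξ h1 h2
  rw [norm_mul]
  exact mul_le_mul (hb ξ h2) h1 (norm_nonneg _) ((norm_nonneg _).trans (hb ξ h2))

lemma norm_integral_symbol_mul_le {m g : E3 → ℂ} {c : ℝ} (hB : 0 ≤ B)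
    (hb : ∀ ξ ≠ 0, ‖m ξ‖ ≤ B) (h : ∀ᵐ ξ, ‖g ξ‖ ≤ c * wt4 ξ) (x : E3) :
    ‖∫ ξ, ph 0 x ξ * (m ξ * g ξ)‖ ≤ B * c * ∫ ξ, wt4 ξ := by
  rw [← integral_const_mul]
  refine norm_integral_le_of_norm_le (integrable_wt4.const_mul _) ?_
  filter_upwards [h, ae_ne_zero] with ξ h1 h2
  rw [norm_mul, norm_ph, one_mul, norm_mul, mul_assoc]
  exact mul_le_mul (hb ξ h2) h1 (norm_nonneg _) hB

end

/-! ### The linear system of boosts, scaling and rotations -/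

section
variable {ψ : ℝ → ℝ} {J : Set ℝ} {φ : ℝ → E3 → ℝ} {l : ℕ} {t B E : ℝ} {α : Fin l → VF}
  {M : E3 → ℂ} {x : E3}

/-- The Fourier multiplier `(2π)³ M` applied to `∂_t φ^α`. -/
def opT (M : E3 → ℂ) (α : Fin l → VF) (φ : ℝ → E3 → ℝ) (t : ℝ) (x : E3) : ℂ :=
  ∫ ξ, ph 0 x ξ * (M ξ * ft1 α φ t ξ)

/-- The Fourier multiplier `(2π)³ M` applied to `φ^α`. -/
def opX (M : E3 → ℂ) (α : Fin l → VF) (φ : ℝ → E3 → ℝ) (t : ℝ) (x : E3) : ℂ :=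
  ∫ ξ, ph 0 x ξ * (M ξ * ft0 α φ t ξ)

lemma integral_pd_ph_mul {g : E3 → ℂ} (hM : Away M) (hs : ContDiffOn ℝ 1 M {0}ᶜ)
    (hg : LocallyIntegrable g) (x : E3) (j : Fin 3) :
    ∫ ξ, g ξ * pd j (fun ξ => ph 0 x ξ * M ξ) ξ
      = Complex.I * x j * (∫ ξ, ph 0 x ξ * (M ξ * g ξ)) + ∫ ξ, ph 0 x ξ * (pd j M ξ * g ξ) := by
  have hMs := hM.contDiff hs
  rw [← integral_const_mul, ← integral_add
    ((integrable_ph_mul hM hMs.continuous hg x).const_mul _)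
    (integrable_ph_mul (hM.pd j) (continuous_pd hMs j) hg x)]
  refine integral_congr_ae ?_
  filter_upwards [ae_ne_zero] with ξ hξ
  rw [pd_mul (hasFDerivAt_ph 0 x hξ).differentiableAt (hMs.differentiable one_ne_zero ξ),
    pd_ph 0 x hξ]
  push_cast; ring

lemma ph_mul_test (hM : Away M) (hs : ContDiffOn ℝ 1 M {0}ᶜ) (x : E3) :
    ContDiff ℝ 1 (fun ξ => ph 0 x ξ * M ξ) ∧ HasCompactSupport (fun ξ => ph 0 x ξ * M ξ) :=
  ⟨(hM.mul_left _).contDiff ((contDiffOn_ph 0 x).mul hs), (hM.mul_left _).compact⟩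

lemma integral_mul_ph (g : E3 → ℂ) (M : E3 → ℂ) (x : E3) :
    ∫ ξ, g ξ * (ph 0 x ξ * M ξ) = ∫ ξ, ph 0 x ξ * (M ξ * g ξ) := by
  congr 1; ext ξ; ring

/-- The boost L_j = t∂_j + x_j∂_t commuted with the multiplier: x_j corresponds to a ξ-derivative,
which falls on the phase (giving x_j outside) and on M (giving the commutator, of one order lower).
The next two lemmas do the same for S and Ω_i. -/
lemma IsScalarField.opT_boost (h : IsScalarField J φ) (ht : t ∈ J) (hl : l + 1 ≤ 20)
    (α : Fin l → VF) (hM : Away M) (hs : ContDiffOn ℝ 1 M {0}ᶜ) (x : E3) (j : Fin 3) :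
    x j * opT M α φ t x + t * opX M (trW j α) φ t x
      = opX M (boostW j α) φ t x + Complex.I * opT (pd j M) α φ t x := by
  obtain ⟨h1, h2⟩ := ph_mul_test hM hs x
  have key := h.integral_boost ht hl α j h1 h2
  rw [integral_pd_ph_mul hM hs (h.isFT1 ht (by omega) α).locallyIntegrable_right,
    integral_mul_ph, integral_mul_ph] at key
  simp only [opT, opX]
  rw [key]
  linear_combination ((x j : ℂ) * ∫ ξ, ph 0 x ξ * (M ξ * ft1 α φ t ξ)) * Complex.I_mul_I

lemma IsScalarField.opT_scal (h : IsScalarField J φ) (ht : t ∈ J) (hl : l + 1 ≤ 20)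
    (α : Fin l → VF) (hM : Away M) (hs : ContDiffOn ℝ 1 M {0}ᶜ) (x : E3) :
    (∑ j, x j * opX M (trW j α) φ t x) + t * opT M α φ t x
      = opX M (scalW α) φ t x + Complex.I * ∑ j, opX (pd j M) (trW j α) φ t x := by
  obtain ⟨h1, h2⟩ := ph_mul_test hM hs x
  have key := h.integral_scal ht hl α h1 h2
  simp only [integral_pd_ph_mul hM hs (h.isFT0 ht hl _).locallyIntegrable_right,
    integral_mul_ph] at key
  simp only [opT, opX]
  rw [key]
  simp only [Fin.sum_univ_three]
  linear_combination ((x 0 : ℂ) * (∫ ξ, ph 0 x ξ * (M ξ * ft0 (trW 0 α) φ t ξ))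
    + x 1 * (∫ ξ, ph 0 x ξ * (M ξ * ft0 (trW 1 α) φ t ξ))
    + x 2 * ∫ ξ, ph 0 x ξ * (M ξ * ft0 (trW 2 α) φ t ξ)) * Complex.I_mul_I

lemma IsScalarField.opX_rot (h : IsScalarField J φ) (ht : t ∈ J) (hl : l + 1 ≤ 20)
    (α : Fin l → VF) (hM : Away M) (hs : ContDiffOn ℝ 1 M {0}ᶜ) (x : E3) (i : Fin 3) :
    x (i + 1) * opX M (trW (i + 2) α) φ t x - x (i + 2) * opX M (trW (i + 1) α) φ t x
      = opX M (rotW i α) φ t x + Complex.I * (opX (pd (i + 1) M) (trW (i + 2) α) φ t x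
        - opX (pd (i + 2) M) (trW (i + 1) α) φ t x) := by
  obtain ⟨h1, h2⟩ := ph_mul_test hM hs x
  have key := h.integral_rot0 ht hl α i h1 h2
  simp only [integral_pd_ph_mul hM hs (h.isFT0 ht hl _).locallyIntegrable_right,
    integral_mul_ph] at key
  simp only [opX]
  rw [key]
  linear_combination ((x (i + 1) : ℂ) * (∫ ξ, ph 0 x ξ * (M ξ * ft0 (trW (i + 2) α) φ t ξ))
    - x (i + 2) * ∫ ξ, ph 0 x ξ * (M ξ * ft0 (trW (i + 1) α) φ t ξ)) * Complex.I_mul_I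

/-- Solving the linear system given by the boosts, the scaling and the rotations. -/
lemma norm_le_of_cone {T0 : ℂ} {T : Fin 3 → ℂ} {x : E3} {t κ : ℝ} (hκ : 0 ≤ κ)
    (hd : 0 < |(|t| - ‖x‖)|)
    (hL : ∀ j, ‖(x j : ℂ) * T0 + t * T j‖ ≤ 4 * κ)
    (hS : ‖(∑ j, (x j : ℂ) * T j) + t * T0‖ ≤ 4 * κ)
    (hO : ∀ i : Fin 3, ‖(x (i + 1) : ℂ) * T (i + 2) - x (i + 2) * T (i + 1)‖ ≤ 4 * κ) :
    ‖T0‖ ≤ 28 * (κ / |(|t| - ‖x‖)|) ∧ ∀ k, ‖T k‖ ≤ 28 * (κ / |(|t| - ‖x‖)|) := by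
  have hsq := sum_sq_eq x
  have hx : ∀ j, ‖(x j : ℂ)‖ ≤ ‖x‖ := fun j => by simpa using PiLp.norm_apply_le x j
  have ht : ‖(t : ℂ)‖ = |t| := by simp
  have hR : ∀ j k, ‖(x j : ℂ) * T k - x k * T j‖ ≤ 4 * κ := by
    have h0 := hO 0
    have h1 := hO 1
    have h2 := hO 2
    simp only [zero_add, Fin.isValue, show (1 : Fin 3) + 1 = 2 from rfl,
      show (1 : Fin 3) + 2 = 0 from rfl, show (2 : Fin 3) + 1 = 0 from rfl,
      show (2 : Fin 3) + 2 = 1 from rfl] at h0 h1 h2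
    have hz : ∀ j, ‖(x j : ℂ) * T j - x j * T j‖ ≤ 4 * κ := fun j => by
      rw [sub_self, norm_zero]; positivity
    intro j k
    fin_cases j <;> fin_cases k
    exacts [hz 0, h2, norm_sub_rev (_ : ℂ) _ ▸ h1, norm_sub_rev (_ : ℂ) _ ▸ h2, hz 1, h0, h1,
      norm_sub_rev (_ : ℂ) _ ▸ h0, hz 2]
  have hpos : 0 < |t| + ‖x‖ := by
    by_contra h
    have h1 : |t| = 0 := by linarith [abs_nonneg t, norm_nonneg x]
    have h2 : ‖x‖ = 0 := by linarith [abs_nonneg t, norm_nonneg x]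
    rw [h1, h2] at hd; simp at hd
  have hn : ‖(‖x‖ : ℂ) ^ 2 - (t : ℂ) ^ 2‖ = |(|t| - ‖x‖)| * (|t| + ‖x‖) := by
    rw [← Complex.ofReal_pow, ← Complex.ofReal_pow, ← Complex.ofReal_sub, Complex.norm_real,
      Real.norm_eq_abs, ← sq_abs t, show ‖x‖ ^ 2 - |t| ^ 2 = -((|t| - ‖x‖) * (|t| + ‖x‖)) by ring,
      abs_neg, abs_mul, abs_of_pos hpos]
  -- The determinant has size d(|t| + |x|), and the coefficients of the inverse are linear in t and
  -- x. The quotient is 1/d.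
  have fin : ∀ z : ℂ, ‖((‖x‖ : ℂ) ^ 2 - (t : ℂ) ^ 2) * z‖ ≤ 28 * κ * (|t| + ‖x‖) →
      ‖z‖ ≤ 28 * (κ / |(|t| - ‖x‖)|) := fun z hz => by
    rw [norm_mul, hn] at hz
    rw [← mul_div_assoc, le_div_iff₀ hd]
    refine le_of_mul_le_mul_right ?_ hpos
    linarith
  have hsum3 : ∀ (z : Fin 3 → ℂ) (c : ℝ), (∀ j, ‖z j‖ ≤ c) → ‖∑ j, z j‖ ≤ 3 * c := fun z c h =>
    (norm_sum_le _ _).trans ((Finset.sum_le_sum fun j _ => h j).trans (by simp))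
  have hxm : ∀ j {z : ℂ}, ‖z‖ ≤ 4 * κ → ‖(x j : ℂ) * z‖ ≤ ‖x‖ * (4 * κ) := fun j z hz => by
    rw [norm_mul]; exact mul_le_mul (hx j) hz (norm_nonneg _) (norm_nonneg _)
  have htm : ∀ {z : ℂ}, ‖z‖ ≤ 4 * κ → ‖(t : ℂ) * z‖ ≤ |t| * (4 * κ) := fun hz => by
    rw [norm_mul, ht]; gcongr
  have hpt : 0 ≤ |t| * κ := by positivity
  have hpx : 0 ≤ ‖x‖ * κ := by positivity
  constructor
  · refine fin _ ?_
    have : ((‖x‖ : ℂ) ^ 2 - (t : ℂ) ^ 2) * T0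
        = (∑ j, (x j : ℂ) * (x j * T0 + t * T j)) - t * ((∑ j, (x j : ℂ) * T j) + t * T0) := by
      rw [← hsq]; simp only [Fin.sum_univ_three]; ring
    rw [this]
    refine (norm_sub_le _ _).trans ?_
    have := hsum3 _ _ fun j => hxm j (hL j)
    have := htm hS
    linarith
  · intro k
    refine fin _ ?_
    have : ((‖x‖ : ℂ) ^ 2 - (t : ℂ) ^ 2) * T k
        = (∑ j, (x j : ℂ) * (x j * T k - x k * T j)) + x k * ((∑ j, (x j : ℂ) * T j) + t * T0)
          - t * (x k * T0 + t * T k) := by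
      rw [← hsq]; simp only [Fin.sum_univ_three]; ring
    rw [this]
    refine (norm_sub_le _ _).trans ((add_le_add (norm_add_le _ _) le_rfl).trans ?_)
    have := hsum3 _ _ fun j => hxm j (hR j k)
    have := hxm k hS
    have := htm (hL k)
    linarith

lemma opX_eq_norm_mul {N : E3 → ℂ} (h : ∀ ξ ≠ 0, M ξ = N ξ * ‖ξ‖) :
    opX M α φ t x = ∫ ξ, ph 0 x ξ * (N ξ * (‖ξ‖ * ft0 α φ t ξ)) := by
  refine integral_congr_ae ?_
  filter_upwards [ae_ne_zero] with ξ hξ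
  rw [h ξ hξ]; ring

lemma IsScalarField.opX_trW (h : IsScalarField J φ) (hJ : IsOpen J) (ht : t ∈ J) (hl : l + 1 ≤ 20)
    (α : Fin l → VF) (j : Fin 3) :
    opX M (trW j α) φ t x
      = ∫ ξ, ph 0 x ξ * ((Complex.I * (om j ξ * M ξ)) * (‖ξ‖ * ft0 α φ t ξ)) := by
  refine integral_congr_ae ?_
  filter_upwards [ae_ne_zero, h.ft0_trW hJ ht hl α j] with ξ hξ h1
  rw [h1, om]
  linear_combination (-(ph 0 x ξ * M ξ * Complex.I * ξ j * ft0 α φ t ξ)) * rinv_mul_norm hξ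

/-- Decay away from the light cone, for the operators `M` applied to derivatives. -/
theorem exists_op_away (hψ : IsCutoff ψ) : ∃ C, 0 ≤ C ∧ ∀ {J : Set ℝ} {φ : ℝ → E3 → ℝ}
    {t E B : ℝ} {l : ℕ} {α : Fin l → VF} {M : E3 → ℂ} {x : E3}, LowEnergy ψ J φ t E → l ≤ 13 →
    0 ≤ B → IsTruncated B M → 0 < |(|t| - ‖x‖)| →
    ‖opT M α φ t x‖ ≤ C * (B * E / |(|t| - ‖x‖)| / |(|t| - ‖x‖)|) ∧
    ∀ k, ‖opX M (trW k α) φ t x‖ ≤ C * (B * E / |(|t| - ‖x‖)| / |(|t| - ‖x‖)|) := by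
  obtain ⟨C, hC, h⟩ := exists_halfWave_away hψ
  obtain ⟨K, hK, hrinv⟩ := exists_ord_rinv 2
  obtain ⟨L, hL, hom⟩ := exists_ord_om 2
  have ho := isOpen_compl_zero
  have hz := zero_notMem_compl
  refine ⟨28 * (C * (1 + 4 * K + 4 * L)), by positivity,
    fun {J φ t E B l α M x} he hl hB hM hd => ?_⟩
  have hE := he.nonneg
  have hs1 : ContDiffOn ℝ 1 M {0}ᶜ := hM.smooth.of_le (by norm_num)
  set b := B * E / |(|t| - ‖x‖)| with hb
  have hb0 : 0 ≤ b := by positivity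
  set κ := C * (1 + 4 * K + 4 * L) * b with hκ
  have hκ0 : 0 ≤ κ := by positivity
  -- All terms on the right of the three identities take this form, with a symbol N of order -1
  -- acting on ∂_t φ^β or |∇|φ^β. The half-wave bound gives each of them one factor 1/d. Up to 14
  -- letters occur because S, Ω_i and L_j lengthen the word.
  have key : ∀ {m : ℕ} (β : Fin m → VF), m ≤ 14 → ∀ (N : E3 → ℂ) (c : ℝ), 0 ≤ c → Away N →
      ContDiffOn ℝ 2 N {0}ᶜ → Ord {0}ᶜ 2 (-1) (c * B) N → c ≤ 1 + 4 * K + 4 * L →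
      ‖∫ ξ, ph 0 x ξ * (N ξ * ft1 β φ t ξ)‖ ≤ κ ∧
        ‖∫ ξ, ph 0 x ξ * (N ξ * (‖ξ‖ * ft0 β φ t ξ))‖ ≤ κ := by
    intro m β hm N c hc hN hNs hNo hcle
    have hle : C * (c * B * E / |(|t| - ‖x‖)|) ≤ κ := by
      rw [hκ, mul_assoc C, mul_assoc c, mul_div_assoc c, ← hb]
      gcongr
    exact norm_le_of_halfWave he.field he.mem (by omega) β hN (hNs.of_le (by simp)) x
      ((h he hm (by positivity) hN hNs hNo hd).trans hle)
      ((h he hm (by positivity) hN.reflect (contDiffOn_reflect hNs) hNo.reflect hd).trans hle)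
  have hpdA : ∀ j, Away (pd j M) := fun j => hM.away.pd j
  have hpdS : ∀ j, ContDiffOn ℝ 2 (pd j M) {0}ᶜ := fun j => by
    exact_mod_cast contDiffOn_pd ho (k := 2) (by exact_mod_cast hM.smooth) j
  have hpdO : ∀ j, Ord {0}ᶜ 2 (-1) B (pd j M) := fun j => by simpa using hM.ord.2.2 j
  -- No derivative acts on the field here; writing M = (M/|ξ|)·|ξ| supplies |∇| and the missing
  -- order -1.
  have p1 : ∀ {m : ℕ} (β : Fin m → VF), m ≤ 14 → ‖opX M β φ t x‖ ≤ κ := by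
    intro m β hm
    have hN : Ord {0}ᶜ 2 (-1) ((4 * K) * B) (fun ξ => rinv ξ * M ξ) := by
      have := hrinv.mul ho hz hK hB (hM.ord.mono_order (by norm_num))
      convert! this using 1
      ring
    have := (key β hm (fun ξ => rinv ξ * M ξ) (4 * K) (by positivity) (hM.away.mul_left _)
      (contDiffOn_rinv.mul (hM.smooth.of_le (by norm_num))) hN (by linarith)).2
    rwa [opX_eq_norm_mul (N := fun ξ => rinv ξ * M ξ) fun ξ hξ => by
      linear_combination (-M ξ) * rinv_mul_norm hξ]
  have p2 : ∀ j, ‖opT (pd j M) α φ t x‖ ≤ κ := fun j =>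
    (key α (by omega) (pd j M) 1 zero_le_one (hpdA j) (hpdS j) (by simpa using hpdO j)
      (by linarith)).1
  have p3 : ∀ j k, ‖opX (pd j M) (trW k α) φ t x‖ ≤ κ := by
    intro j k
    rw [he.field.opX_trW he.isOpen he.mem (by omega)]
    refine (key α (by omega) _ (4 * L) (by positivity) (((hpdA j).mul_left _).mul_left _)
      (contDiffOn_const.mul ((contDiffOn_om k).mul (hpdS j))) ?_ (by linarith)).2
    have := ((hom k).mul ho hz hL hB (hpdO j)).const_mul ho Complex.I
    rw [Complex.norm_I, one_mul] at this
    convert! this using 1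
    ring
  have tri : ∀ {a c : ℂ}, ‖a‖ ≤ κ → ‖c‖ ≤ 3 * κ → ‖a + Complex.I * c‖ ≤ 4 * κ := by
    intro a c ha hc
    refine (norm_add_le _ _).trans ?_
    rw [norm_mul, Complex.norm_I, one_mul]; linarith
  have main := norm_le_of_cone (T0 := opT M α φ t x) (T := fun j => opX M (trW j α) φ t x)
    (x := x) (t := t) hκ0 hd (fun j => ?_) ?_ (fun i => ?_)
  · have hc : 28 * (κ / |(|t| - ‖x‖)|)
        = 28 * (C * (1 + 4 * K + 4 * L)) * (b / |(|t| - ‖x‖)|) := by rw [hκ]; ring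
    rw [hc] at main
    exact main
  · rw [he.field.opT_boost he.mem (by omega) α hM.away hs1 x j]
    exact tri (p1 _ (by omega)) ((p2 j).trans (by linarith))
  · rw [he.field.opT_scal he.mem (by omega) α hM.away hs1 x]
    refine tri (p1 _ (by omega)) ((norm_sum_le _ _).trans
      ((Finset.sum_le_sum fun j _ => p3 j j).trans (by simp)))
  · rw [he.field.opX_rot he.mem (by omega) α hM.away hs1 x i]
    refine tri (p1 _ (by omega)) ((norm_sub_le _ _).trans ?_)
    linarith [p3 (i + 1) (i + 2), p3 (i + 2) (i + 1)]

end

/-! ### Assembly of the regions and passage to general symbols -/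

section
variable {ψ : ℝ → ℝ} {J : Set ℝ} {φ : ℝ → E3 → ℝ} {l : ℕ} {t B E : ℝ} {α : Fin l → VF}
  {m M : E3 → ℂ} {x : E3}

lemma exists_isTruncated_om : ∃ L, 0 ≤ L ∧ ∀ {B : ℝ} {M : E3 → ℂ}, 0 ≤ B → IsTruncated B M →
    ∀ k, IsTruncated (L * B) (fun ξ => Complex.I * (om k ξ * M ξ)) := by
  obtain ⟨L, hL, hom⟩ := exists_ord_om 3
  refine ⟨8 * L, by positivity, fun {B M} hB hM k => ⟨(hM.away.mul_left _).mul_left _,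
    contDiffOn_const.mul ((contDiffOn_om k).mul hM.smooth), ?_⟩⟩
  have := ((hom k).mul isOpen_compl_zero zero_notMem_compl hL hB hM.ord).const_mul
    isOpen_compl_zero Complex.I
  rw [Complex.norm_I, one_mul] at this
  convert! this using 1
  ring

/-- A bound for half waves of truncated symbols gives a bound for the derivatives of the field. -/
lemma exists_op_of_halfWave : ∃ L, 1 ≤ L ∧ ∀ {J : Set ℝ} {φ : ℝ → E3 → ℝ} {t B b c : ℝ} {l : ℕ}
    {α : Fin l → VF} {M : E3 → ℂ} {x : E3}, IsScalarField J φ → IsOpen J → t ∈ J → l + 1 ≤ 20 →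
    0 ≤ B → 0 ≤ b → 0 < c → IsTruncated B M →
    (∀ B' M', 0 ≤ B' → IsTruncated B' M' → c * ‖halfWave M' α φ t x‖ ≤ b * B') →
    c * ‖opT M α φ t x‖ ≤ L * (b * B) ∧ ∀ k, c * ‖opX M (trW k α) φ t x‖ ≤ L * (b * B) := by
  obtain ⟨L, hL, hom⟩ := exists_isTruncated_om
  refine ⟨1 + L, by linarith, fun {J φ t B b c l α M x} hφ hJ ht hl hB hb hc hM h => ?_⟩
  have key : ∀ B' M', 0 ≤ B' → IsTruncated B' M' →
      c * ‖∫ ξ, ph 0 x ξ * (M' ξ * ft1 α φ t ξ)‖ ≤ b * B' ∧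
        c * ‖∫ ξ, ph 0 x ξ * (M' ξ * (‖ξ‖ * ft0 α φ t ξ))‖ ≤ b * B' := by
    intro B' M' hB' hM'
    have h1 := h B' M' hB' hM'
    have h2 := h B' _ hB' hM'.reflect
    rw [mul_comm, ← le_div_iff₀ hc] at h1 h2
    have := norm_le_of_halfWave hφ ht (by omega) α hM'.away (hM'.smooth.of_le (by simp)) x h1 h2
    rwa [le_div_iff₀ hc, le_div_iff₀ hc, mul_comm, mul_comm ‖_‖] at this
  have hbB : 0 ≤ b * B := by positivity
  have hLbB : 0 ≤ L * (b * B) := by positivity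
  refine ⟨(key B M hB hM).1.trans (by linarith), fun k => ?_⟩
  rw [hφ.opX_trW hJ ht hl]
  refine (key (L * B) _ (by positivity) (hom hB hM k)).2.trans ?_
  linarith

/-- The decay estimate for truncated symbols. -/
theorem exists_op_decay (hψ : IsCutoff ψ) : ∃ C, 0 ≤ C ∧ ∀ {J : Set ℝ} {φ : ℝ → E3 → ℝ}
    {t E B : ℝ} {l : ℕ} {α : Fin l → VF} {M : E3 → ℂ} {x : E3}, LowEnergy ψ J φ t E → l ≤ 13 →
    0 ≤ B → IsTruncated B M →
    (1 + |t|) * (1 + |(|t| - ‖x‖)|) * ‖opT M α φ t x‖ ≤ C * (B * E) ∧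
    ∀ k, (1 + |t|) * (1 + |(|t| - ‖x‖)|) * ‖opX M (trW k α) φ t x‖ ≤ C * (B * E) := by
  obtain ⟨C₁, hC₁, h₁⟩ := exists_op_away hψ
  obtain ⟨C₂, hC₂, h₂⟩ := exists_halfWave_near hψ
  obtain ⟨C₃, hC₃, h₃⟩ := exists_halfWave_dispersive
  obtain ⟨L, hL, hop⟩ := exists_op_of_halfWave
  set W := ∫ ξ, wt4 ξ
  have hW : 0 ≤ W := integral_nonneg wt4_nonneg
  refine ⟨6 * (C₁ + L * C₂ + L * C₃ + 432 * W), by positivity,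
    fun {J φ t E B l α M x} he hl hB hM => ?_⟩
  have hE := he.nonneg
  set d := |(|t| - ‖x‖)| with hd
  have hd0 : 0 ≤ d := abs_nonneg _
  have ht0 := abs_nonneg t
  have hx0 := norm_nonneg x
  have hBE : 0 ≤ B * E := by positivity
  have hp1 : 0 ≤ C₁ * (B * E) := by positivity
  have hp2 : 0 ≤ L * C₂ * (B * E) := by positivity
  have hp3 : 0 ≤ L * C₃ * (B * E) := by positivity
  have hp4 : 0 ≤ W * (B * E) := by positivity
  -- Each region has its own gain c with (1 + |t|)(1 + d) ≤ 6c: namely 1, |x|, d|x| and d².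
  have fin : ∀ {c K z : ℝ}, 0 ≤ z → (1 + |t|) * (1 + d) ≤ 6 * c → c * z ≤ K →
      K ≤ C₁ * (B * E) + L * C₂ * (B * E) + L * C₃ * (B * E) + 432 * (W * (B * E)) →
      (1 + |t|) * (1 + d) * z ≤ 6 * (C₁ + L * C₂ + L * C₃ + 432 * W) * (B * E) := by
    intro c K z hz h1 h2 h3
    have := mul_le_mul_of_nonneg_right h1 hz
    linarith
  have cone : d ≥ |t| - ‖x‖ := le_abs_self _
  -- For d < 1: absolute convergence if |t| < 2, otherwise |x| ≥ |t|/2 and the dispersive bound. For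
  -- d ≥ 1: if 2 ≤ |t| ≤ 2|x|, the bound 1/(d|x|); otherwise the bound 1/d² from the vector fields.
  rcases lt_or_ge d 1 with hd1 | hd1
  · rcases lt_or_ge |t| 2 with ht2 | ht2
    · have hM0 : ∀ ξ ≠ 0, ‖M ξ‖ ≤ B := fun ξ hξ => by
        simpa using hM.ord.bound ξ (by simpa using hξ)
      have hfin : ∀ z : ℝ, 0 ≤ z → z ≤ B * (432 * E) * W → (1 + |t|) * (1 + d) * z
          ≤ 6 * (C₁ + L * C₂ + L * C₃ + 432 * W) * (B * E) := fun z hz h =>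
        fin (c := 1) hz (by nlinarith) (by linarith) (by linarith)
      have hae := he.ae_norm_le (by omega : l ≤ 17) α
      exact ⟨hfin _ (norm_nonneg _)
        (norm_integral_symbol_mul_le hB hM0 (hae.mono fun _ h => h.1) x),
        fun k => hfin _ (norm_nonneg _)
          (norm_integral_symbol_mul_le hB hM0 (he.ae_norm_trW_le (by omega) α k) x)⟩
    · have hx : |t| / 2 ≤ ‖x‖ := by linarith
      have hxp : 0 < ‖x‖ := by linarith
      have := hop (c := ‖x‖) (b := C₃ * E) (B := B) (x := x) (α := α) he.field he.isOpen he.mem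
        (by omega) hB (by positivity) hxp hM fun B' M' hB' hM' =>
          (h₃ he hl hB' hM' (norm_pos_iff.1 hxp)).trans (le_of_eq (by ring))
      exact ⟨fin (norm_nonneg _) (by nlinarith) this.1 (by linarith),
        fun k => fin (norm_nonneg _) (by nlinarith) (this.2 k) (by linarith)⟩
  · have hdp : 0 < d := by linarith
    by_cases hcase : |t| / 2 ≤ ‖x‖ ∧ 2 ≤ |t|
    · have hxp : 0 < ‖x‖ := by linarith [hcase.1, hcase.2]
      have := hop (c := d * ‖x‖) (b := C₂ * E) (B := B) (x := x) (α := α) he.field he.isOpen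
        he.mem (by omega) hB (by positivity) (by positivity) hM fun B' M' hB' hM' => by
          have h := h₂ (α := α) he hl hB' hM' (norm_pos_iff.1 hxp) hdp
          rw [← mul_div_assoc, le_div_iff₀ hdp] at h
          linarith
      have hc : (1 + |t|) * (1 + d) ≤ 6 * (d * ‖x‖) := by
        have h1 : 1 + |t| ≤ 3 * ‖x‖ := by linarith [hcase.1, hcase.2]
        have h2 : 1 + d ≤ 2 * d := by linarith
        calc (1 + |t|) * (1 + d) ≤ (3 * ‖x‖) * (2 * d) := by gcongr
          _ = _ := by ring
      exact ⟨fin (norm_nonneg _) hc this.1 (by linarith),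
        fun k => fin (norm_nonneg _) hc (this.2 k) (by linarith)⟩
    -- Either |x| < |t|/2, so that d > |t|/2, or |t| < 2; in both cases d ≥ 1 finishes.
    · have h1 : 1 + |t| ≤ 3 * d := by
        by_contra hcon
        refine hcase ⟨?_, ?_⟩
        · by_contra h; linarith [not_le.1 h]
        · by_contra h; linarith [not_le.1 h]
      have hc : (1 + |t|) * (1 + d) ≤ 6 * (d * d) := by
        have h2 : 1 + d ≤ 2 * d := by linarith
        calc (1 + |t|) * (1 + d) ≤ (3 * d) * (2 * d) := by gcongr
          _ = _ := by ring
      have := h₁ (α := α) he hl hB hM hdp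
      have hz : ∀ z : ℝ, z ≤ C₁ * (B * E / d / d) → d * d * z ≤ C₁ * (B * E) := fun z hz => by
        rw [← mul_div_assoc, le_div_iff₀ hdp, ← mul_div_assoc] at hz
        rw [le_div_iff₀ hdp] at hz
        linarith
      exact ⟨fin (norm_nonneg _) hc (hz _ this.1) (by linarith),
        fun k => fin (norm_nonneg _) hc (hz _ (this.2 k)) (by linarith)⟩

lemma multiplier_eq (m u : E3 → ℂ) (x : E3) : multiplier m u x
    = (((2 * Real.pi) ^ 3 : ℝ) : ℂ)⁻¹ * ∫ ξ, ph 0 x ξ * (m ξ * fourierFun u ξ) := by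
  simp [multiplier, fourierInvInt, ph]

lemma norm_multiplier_le (m u : E3 → ℂ) (x : E3) :
    ‖multiplier m u x‖ ≤ ‖∫ ξ, ph 0 x ξ * (m ξ * fourierFun u ξ)‖ := by
  rw [multiplier_eq, norm_mul, norm_inv, Complex.norm_real]
  refine mul_le_of_le_one_left (norm_nonneg _) (inv_le_one_of_one_le₀ ?_)
  rw [Real.norm_of_nonneg (by positivity)]
  exact one_le_pow₀ (by linarith [Real.two_le_pi])

lemma IsSymbol.norm_le (hψ : IsCutoff ψ) (hm : IsSymbol ψ m) :
    ∀ ξ ≠ 0, ‖m ξ‖ ≤ 16 * (symbolNorm ψ m).toReal := fun ξ hξ => by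
  simpa using (hm.ord hψ).bound ξ (by simpa using hξ)

lemma fourierFun_dx (α : Fin l → VF) (φ : ℝ → E3 → ℝ) (t : ℝ) (j : Fin 3) :
    fourierFun (toC (dx j (gam α φ) t)) = ft0 (trW j α) φ t := by
  rw [ft0, gam_trW]

lemma LowEnergy.integrable_ft1 (he : LowEnergy ψ J φ t E) (hm : IsSymbol ψ m) (hl : l ≤ 13)
    (α : Fin l → VF) : Integrable (fun ξ => m ξ * ft1 α φ t ξ) :=
  integrable_symbol_mul (hm.1.of_le (by simp)) (hm.norm_le he.cutoff)
    (he.field.isFT1 he.mem (by omega) α).locallyIntegrable_right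
    ((he.ae_norm_le (by omega) α).mono fun _ h => h.1)

lemma LowEnergy.integrable_ft0_trW (he : LowEnergy ψ J φ t E) (hm : IsSymbol ψ m) (hl : l ≤ 13)
    (α : Fin l → VF) (j : Fin 3) : Integrable (fun ξ => m ξ * ft0 (trW j α) φ t ξ) :=
  integrable_symbol_mul (hm.1.of_le (by simp)) (hm.norm_le he.cutoff)
    (he.field.isFT0 he.mem (by omega) _).locallyIntegrable_right
    (he.ae_norm_trW_le (by omega) α j)

/-- The decay estimate for a single field. -/
theorem exists_multiplier_decay (hψ : IsCutoff ψ) : ∃ C, 0 ≤ C ∧ ∀ {J : Set ℝ} {φ : ℝ → E3 → ℝ}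
    {t E : ℝ} {l : ℕ} {α : Fin l → VF} {m : E3 → ℂ} {x : E3}, LowEnergy ψ J φ t E → l ≤ 13 →
    IsSymbol ψ m →
    (1 + |t|) * (1 + |(|t| - ‖x‖)|) * ‖multiplier m (toC (dt (gam α φ) t)) x‖
      ≤ C * ((symbolNorm ψ m).toReal * E) ∧
    ∀ j, (1 + |t|) * (1 + |(|t| - ‖x‖)|) * ‖multiplier m (toC (dx j (gam α φ) t)) x‖
      ≤ C * ((symbolNorm ψ m).toReal * E) := by
  obtain ⟨C, hC, h⟩ := exists_op_decay hψ
  obtain ⟨K, hK, htr⟩ := exists_isTruncated_trunc hψ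
  refine ⟨C * K, by positivity, fun {J φ t E l α m x} he hl hm => ?_⟩
  have hS : 0 ≤ (symbolNorm ψ m).toReal := ENNReal.toReal_nonneg
  have hev : ∀ R : ℝ, 0 < R → _ := fun R hR =>
    h (α := α) (x := x) he hl (by positivity) (htr m hm R hR)
  -- Truncated symbols obey the bound uniformly in R, and the integrability of m u allows R → ∞ by
  -- dominated convergence.
  have lim : ∀ u : E3 → ℂ, Integrable (fun ξ => m ξ * u ξ) →
      (∀ R > 0, (1 + |t|) * (1 + |(|t| - ‖x‖)|) * ‖∫ ξ, ph 0 x ξ * (trunc ψ R m ξ * u ξ)‖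
        ≤ C * (K * (symbolNorm ψ m).toReal * E)) →
      (1 + |t|) * (1 + |(|t| - ‖x‖)|) * ‖∫ ξ, ph 0 x ξ * (m ξ * u ξ)‖
        ≤ C * K * ((symbolNorm ψ m).toReal * E) := by
    intro u hu hb
    have hi : Integrable (fun ξ => ph 0 x ξ * (m ξ * u ξ)) :=
      hu.bdd_mul (c := 1) (continuous_ph 0 x).aestronglyMeasurable
        (Eventually.of_forall fun ξ => (norm_ph 0 x ξ).le)
    rw [mul_assoc C K, ← mul_assoc K]
    refine le_of_tendsto ((tendsto_integral_trunc hψ hi).norm.const_mul _) ?_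
    filter_upwards [eventually_gt_atTop 0] with R hR using hb R hR
  have mono : ∀ u : E3 → ℂ, (1 + |t|) * (1 + |(|t| - ‖x‖)|) * ‖multiplier m u x‖
      ≤ (1 + |t|) * (1 + |(|t| - ‖x‖)|) * ‖∫ ξ, ph 0 x ξ * (m ξ * fourierFun u ξ)‖ := fun u => by
    gcongr; exact norm_multiplier_le m u x
  refine ⟨(mono _).trans (lim _ (he.integrable_ft1 hm hl α) fun R hR => (hev R hR).1),
    fun j => (mono _).trans ?_⟩
  rw [fourierFun_dx]
  exact lim _ (he.integrable_ft0_trW hm hl α j) fun R hR => (hev R hR).2 j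

/-- The slack δ creates the strict inequality needed to extract weak derivatives from the infima in
the energy; it is sent to 0 in `exists_enorm_multiplier_le`. -/
lemma lowEnergy_of_lt_top (hψ : IsCutoff ψ) (hφ : IsScalarField J φ) (hJ : IsOpen J) (ht : t ∈ J)
    (h : energyLow ψ φ t < ⊤) {δ : ℝ} (hδ : 0 < δ) :
    LowEnergy ψ J φ t ((energyLow ψ φ t).toReal + δ) := by
  have hE : 0 ≤ (energyLow ψ φ t).toReal := ENNReal.toReal_nonneg
  refine ⟨hψ, hφ, hJ, ht, by positivity, ?_⟩
  rw [ENNReal.lt_ofReal_iff_toReal_lt h.ne]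
  linarith

/-- Needed separately because the right-hand side of the estimate is 0·∞ = 0 when the symbol norm
vanishes and the energy is infinite. -/
lemma multiplier_eq_zero (hψ : IsCutoff ψ) (hm : IsSymbol ψ m) (h : symbolNorm ψ m = 0)
    (u : E3 → ℂ) (x : E3) : multiplier m u x = 0 := by
  have h0 : ∀ ξ ≠ 0, m ξ = 0 := fun ξ hξ => by
    have := hm.norm_le hψ ξ hξ
    rw [h, ENNReal.toReal_zero, mul_zero] at this
    exact norm_le_zero_iff.1 this
  rw [multiplier_eq, integral_eq_zero_of_ae, mul_zero]
  filter_upwards [ae_ne_zero] with ξ hξ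
  simp [h0 ξ hξ]

/-- The pointwise estimate for each of the terms of the sum. -/
theorem exists_enorm_multiplier_le (hψ : IsCutoff ψ) : ∃ C : ℝ≥0, ∀ m, IsSymbol ψ m →
    ∀ J : Set ℝ, IsOpen J → ∀ φ, IsScalarField J φ → ∀ t ∈ J, ∀ x : E3, ∀ l ≤ 13,
    ∀ α : Fin l → VF, ∀ u : E3 → ℂ,
    (u = toC (dt (gam α φ) t) ∨ ∃ j, u = toC (dx j (gam α φ) t)) →
    ‖multiplier m u x‖ₑ ≤ C * ENNReal.ofReal ((1 + |t|)⁻¹ * (1 + |(|t| - ‖x‖)|)⁻¹)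
      * symbolNorm ψ m * energyLow ψ φ t := by
  obtain ⟨C, hC, h⟩ := exists_multiplier_decay hψ
  -- Adding 1 makes the constant positive, so that the bound is really ∞ when the energy is infinite
  -- and the symbol norm is not zero.
  refine ⟨Real.toNNReal (C + 1), fun m hm J hJ φ hφ t ht x l hl α u hu => ?_⟩
  set w := (1 + |t|)⁻¹ * (1 + |(|t| - ‖x‖)|)⁻¹ with hw
  have hw0 : 0 < w := by positivity
  rcases eq_or_ne (symbolNorm ψ m) 0 with hS | hS
  · rw [multiplier_eq_zero hψ hm hS]; simp
  rcases eq_or_ne (energyLow ψ φ t) ⊤ with hE | hE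
  · rw [hE, ENNReal.mul_top]
    · exact le_top
    · refine mul_ne_zero (mul_ne_zero ?_ (ENNReal.ofReal_pos.2 hw0).ne') hS
      exact ENNReal.coe_ne_zero.2 (Real.toNNReal_pos.2 (by linarith)).ne'
  set S := (symbolNorm ψ m).toReal with hSd
  set e := (energyLow ψ φ t).toReal with hed
  have hS0 : 0 ≤ S := ENNReal.toReal_nonneg
  have he0 : 0 ≤ e := ENNReal.toReal_nonneg
  have hb : ∀ δ > 0, ‖multiplier m u x‖ ≤ C * w * S * (e + δ) := by
    intro δ hδ
    have h1 := h (α := α) (x := x) (lowEnergy_of_lt_top hψ hφ hJ ht hE.lt_top hδ) hl hm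
    have h2 : (1 + |t|) * (1 + |(|t| - ‖x‖)|) * ‖multiplier m u x‖ ≤ C * (S * (e + δ)) := by
      rcases hu with rfl | ⟨j, rfl⟩
      exacts [h1.1, h1.2 j]
    rw [mul_comm, ← le_div_iff₀ (by positivity)] at h2
    refine h2.trans (le_of_eq ?_)
    rw [hw]; field_simp
  have hlim : ‖multiplier m u x‖ ≤ C * w * S * e := by
    have ht : Tendsto (fun δ : ℝ => C * w * S * (e + δ)) (𝓝[>] 0) (𝓝 (C * w * S * (e + 0))) :=
      (tendsto_const_nhds.mul (tendsto_const_nhds.add tendsto_id)).mono_left nhdsWithin_le_nhds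
    rw [add_zero] at ht
    exact ge_of_tendsto ht (by filter_upwards [self_mem_nhdsWithin] with δ hδ using hb δ hδ)
  rw [← ofReal_norm, ← ENNReal.ofReal_toReal hm.2.ne, ← ENNReal.ofReal_toReal hE]
  change _ ≤ ENNReal.ofReal (C + 1) * _ * _ * _
  rw [← ENNReal.ofReal_mul (by positivity), ← ENNReal.ofReal_mul (by positivity),
    ← ENNReal.ofReal_mul (by positivity)]
  refine ENNReal.ofReal_le_ofReal (hlim.trans ?_)
  gcongr
  linarith

end

end WaveDecay

end

theorem mainTheorem5 (ψ : ℝ → ℝ) (hψ : WaveDecay.IsCutoff ψ) :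
    ∃ C : ℝ≥0, ∀ m : WaveDecay.E3 → ℂ, WaveDecay.IsSymbol ψ m →
      ∀ (J : Set ℝ), IsOpen J →
      ∀ φ : ℝ → WaveDecay.E3 → ℝ, WaveDecay.IsScalarField J φ →
      ∀ t ∈ J,
        (WaveDecay.energyLow ψ φ t < ⊤ →
          ∀ l ≤ 13, ∀ ρ : Fin l → WaveDecay.VF,
            Integrable (fun ξ => m ξ * WaveDecay.fourierFun
              (WaveDecay.toC (WaveDecay.dt (WaveDecay.gam ρ φ) t)) ξ) ∧
            ∀ j : Fin 3, WaveDecay.HasFourierTransform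
                (WaveDecay.toC (WaveDecay.dx j (WaveDecay.gam ρ φ) t)) ∧
              Integrable (fun ξ => m ξ * WaveDecay.fourierFun
                (WaveDecay.toC (WaveDecay.dx j (WaveDecay.gam ρ φ) t)) ξ)) ∧
        ∀ x : WaveDecay.E3,
          ∑ l ∈ Finset.range 14, ∑ ρ : Fin l → WaveDecay.VF,
            (‖WaveDecay.multiplier m (WaveDecay.toC (WaveDecay.dt (WaveDecay.gam ρ φ) t)) x‖ₑ
              + ∑ j : Fin 3, ‖WaveDecay.multiplier m
                  (WaveDecay.toC (WaveDecay.dx j (WaveDecay.gam ρ φ) t)) x‖ₑ)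
          ≤ C * ENNReal.ofReal ((1 + |t|)⁻¹ * (1 + |(|t| - ‖x‖)|)⁻¹)
              * WaveDecay.symbolNorm ψ m * WaveDecay.energyLow ψ φ t := by
  obtain ⟨C, hC⟩ := WaveDecay.exists_enorm_multiplier_le hψ
  -- The number of words of length at most 13, times four first-order derivatives, times the
  -- constant for one term.
  refine ⟨(∑ l ∈ Finset.range 14, ∑ _ρ : Fin l → WaveDecay.VF, 4) * C,
    fun m hm J hJ φ hφ t ht => ⟨fun hE l hl ρ => ?_, fun x => ?_⟩⟩
  · have he := WaveDecay.lowEnergy_of_lt_top hψ hφ hJ ht hE one_pos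
    refine ⟨he.integrable_ft1 hm hl ρ, fun j => ⟨?_, ?_⟩⟩
    · have := (hφ.fourier (l + 1) (by omega) (WaveDecay.trW j ρ) t ht).1
      rwa [WaveDecay.gam_trW] at this
    · rw [WaveDecay.fourierFun_dx]
      exact he.integrable_ft0_trW hm hl ρ j
  · set Y := (C : ℝ≥0∞) * ENNReal.ofReal ((1 + |t|)⁻¹ * (1 + |(|t| - ‖x‖)|)⁻¹)
      * WaveDecay.symbolNorm ψ m * WaveDecay.energyLow ψ φ t with hY
    have hterm : ∀ l ∈ Finset.range 14, ∀ ρ : Fin l → WaveDecay.VF,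
        ‖WaveDecay.multiplier m (WaveDecay.toC (WaveDecay.dt (WaveDecay.gam ρ φ) t)) x‖ₑ
          + ∑ j : Fin 3, ‖WaveDecay.multiplier m
              (WaveDecay.toC (WaveDecay.dx j (WaveDecay.gam ρ φ) t)) x‖ₑ ≤ 4 * Y := by
      intro l hl ρ
      have hl' : l ≤ 13 := Nat.lt_succ_iff.1 (Finset.mem_range.1 hl)
      have h1 := hC m hm J hJ φ hφ t ht x l hl' ρ _ (Or.inl rfl)
      have h2 := fun j => hC m hm J hJ φ hφ t ht x l hl' ρ _ (Or.inr ⟨j, rfl⟩)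
      calc _ ≤ Y + ∑ _j : Fin 3, Y := add_le_add h1 (Finset.sum_le_sum fun j _ => h2 j)
        _ = 4 * Y := by
          rw [Finset.sum_const, Finset.card_univ, Fintype.card_fin, nsmul_eq_mul]
          push_cast
          ring
    calc _ ≤ ∑ l ∈ Finset.range 14, ∑ _ρ : Fin l → WaveDecay.VF, 4 * Y :=
          Finset.sum_le_sum fun l hl => Finset.sum_le_sum fun ρ _ => hterm l hl ρ
      _ = _ := by
          simp only [← Finset.sum_mul, hY]
          push_cast
          ring
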